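/- **Setting.** Let $\omega_1<\omega_2$ be real and let $F_{X,Y}$ be a probability law on $\mathbb R^2$ with support $(\omega_1,\omega_2)^2$ (it is carried by this open square and charges each of its nonempty open subsets), with non-atomic marginals $F_X,F_Y$ and $P(X=Y)=0$. Let $(X_i,Y_i)$, $i\ge1$, be i.i.d. with law $F_{X,Y}$. Write $\mathcal X_n=\{X_1,\dots,X_n\}$, $\mathcal Y_m=\{Y_1,\dots,Y_m\}$, let $Y_{(1)}<\dots<Y_{(m)}$ be the order statistics of $\mathcal Y_m$, and for $1\le i\le m-1$ put $\mathcal I_i=(Y_{(i)},Y_{(i+1)})$, $M_{c,i}=Y_{(i)}+c\,(Y_{(i+1)}-Y_{(i)})$. For real $r\ge1$ and $c\in[0,1]$ define the proximity region $$N(x,r,c)=\begin{cases}(Y_{(i)},\min(Y_{(i+1)},Y_{(i)}+r(x-Y_{(i)})))& x\in\mathcal I_i,\ x\le M_{c,i},\\ (\max(Y_{(i)},Y_{(i+1)}-r(Y_{(i+1)}-x)),Y_{(i+1)})& x\in\mathcal I_i,\ x> M_{c,i},\\ (Y_{(1)}-r(Y_{(1)}-x),Y_{(1)})& x<Y_{(1)},\\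 (Y_{(m)},Y_{(m)}+r(x-Y_{(m)}))& x>Y_{(m)},\\ \{x\}& x\in\mathcal Y_m.\end{cases}$$ Let $\gamma_{n,m}=\gamma_{n,m}(F_{X,Y},r,c)$ be the domination number of the digraph with vertices $\mathcal X_n$ and an arc from $X_i$ to $X_j$ iff $X_j\in N(X_i,r,c)$ (a vertex dominates itself and its out-neighbours). For a law $F$ on $(a,b)$, let $p_n(F,r,c)$ be the probability that the domination number is $2$ when $\mathcal X_n$ is an i.i.d. sample from $F$ and $\mathcal Y_2=\{a,b\}$, and let $p(F,r,c)=\lim_n p_n(F,r,c)$. Let $F_i$ be $F_X$ conditioned on $\mathcal I_i$, and $r^*=1/\max(c,1-c)$. **Theorem.** (i) For every fixed $n$, every $r\ge1$ and $c\in[0,1]$: $\lim_{m\to\infty}\gamma_{n,m}=n$ a.s. Now let $m\ge1$ be fixed. (ii) For $r=1$: if $c\in(0,1)$ then $\lim_{n\to\infty}P(\gamma_{n,m}=2m)=1$; if $c\in\{0,1\}$ then $\lim_{n\to\infty}P(\gamma_{n,m}=m+1)=1$. (iii) For $r>2$ and $c\in(0,1)$: $\lim_{n\to\infty}P(\gamma_{n,m}=m+1)=1$.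 (iv) For $r=2$ and $c\in[0,1]$, $c\ne1/2$: $\lim_{n\to\infty}P(\gamma_{n,m}=m+1)=1$. For $(r,c)=(2,1/2)$, if the limits $p(F_i,2,1/2)$ exist for almost every realization of $\mathcal Y_m$, then, as $n\to\infty$, $\gamma_{n,m}$ converges in law to $m+1+\sum_{i=1}^{m-1}B_i$, where, given $\mathcal Y_m$, the $B_i$ are independent Bernoulli variables with parameters $p(F_i,2,1/2)$. The convergence holds both conditionally, given $\mathcal Y_m=y$ for almost every realization $y$, and unconditionally. (v) For $r\in[1,2)$ and $c\in[0,1]$, as $n\to\infty$, $\gamma_{n,m}$ converges in law to $m+1$ if $r>r^*$; to $2m$ if $r<r^*$; and, if $r=r^*$ and the limits $p(F_i,r,c)$ exist for almost every realization of $\mathcal Y_m$, to $m+1+\sum_{i=1}^{m-1}B_i$ in the same sense as in (iv), with Bernoulli parameters $p(F_i,r,c)$. In the critical case $r=r^*$ with $c\in(0,1)$ and $m\ge2$, if $F_X$ and $F_Y$ are absolutely continuous and the density of $F_X$ is positive a.e. on $(\omega_1,\omega_2)$, then almost surely all the limits $p(F_i,r,c)$, $1\le i\le m-1$, exist and lie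 in $(0,1)$, and the limit in law of $\gamma_{n,m}$ is non-degenerate. -/

import Mathlib

open MeasureTheory ProbabilityTheory Filter Topology

noncomputable section

namespace PICD

/-- `S` dominates `D`: every vertex lies in `S` or receives an arc from a vertex of `S`. -/
def IsDominating {V : Type*} (D : Digraph V) (S : Finset V) : Prop :=
  ∀ v, v ∈ S ∨ ∃ u ∈ S, D.Adj u v

/-- The (out-)domination number: the least cardinality of a dominating set. -/
def dominationNumber {V : Type*} (D : Digraph V) : ℕ :=
  sInf {k : ℕ | ∃ S : Finset V, IsDominating D S ∧ S.card = k}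

/-- The order statistics of `y 0, …, y (m-1)`: `orderStat y i` is the `(i+1)`-st smallest value. -/
def orderStat {m : ℕ} (y : Fin m → ℝ) (i : Fin m) : ℝ := y (Tuple.sort y i)

/-- Left end point of the `(i+1)`-st of the `m - 1` middle intervals. -/
def lo {m : ℕ} (y : Fin m → ℝ) (i : Fin (m - 1)) : ℝ :=
  orderStat y ⟨i, by have := i.isLt; omega⟩

/-- Right end point of the `(i+1)`-st of the `m - 1` middle intervals. -/
def hi {m : ℕ} (y : Fin m → ℝ) (i : Fin (m - 1)) : ℝ :=
  orderStat y ⟨i + 1, by have := i.isLt; omega⟩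

/-- The proximity region of a point `x` of a middle interval `(a, b)`, where
`M = a + c (b - a)`. The point `x = M` is assigned to the left case. Since `x` is in `(a, b)`,
for `c = 0` the second case always applies and for `c = 1` the first one does. -/
def middleRegion (a b r c x : ℝ) : Set ℝ :=
  if x ≤ a + c * (b - a) then Set.Ioo a (min b (a + r * (x - a)))
  else Set.Ioo (max a (b - r * (b - x))) b

/-- The proximity region `N(x, r, c)` with respect to the points `y 0, …, y (m-1)`. The cases
are: `x` is one of these points, `x` is in a middle interval, `x` is in an end interval. -/
def proximityRegion {m : ℕ} (y : Fin m → ℝ) (r c x : ℝ) : Set ℝ :=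
  {z | (x ∈ Set.range y ∧ z = x) ∨
    (∃ i : Fin (m - 1), x ∈ Set.Ioo (lo y i) (hi y i) ∧
      z ∈ middleRegion (lo y i) (hi y i) r c x) ∨
    (∃ h : 0 < m, x < orderStat y ⟨0, h⟩ ∧
      z ∈ Set.Ioo (orderStat y ⟨0, h⟩ - r * (orderStat y ⟨0, h⟩ - x)) (orderStat y ⟨0, h⟩)) ∨
    (∃ h : 0 < m, orderStat y ⟨m - 1, by omega⟩ < x ∧
      z ∈ Set.Ioo (orderStat y ⟨m - 1, by omega⟩)
        (orderStat y ⟨m - 1, by omega⟩ + r * (x - orderStat y ⟨m - 1, by omega⟩)))}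

/-- The parameterized interval catch digraph on the vertices `x 0, …, x (n-1)`. -/
def digraph {n m : ℕ} (r c : ℝ) (x : Fin n → ℝ) (y : Fin m → ℝ) : Digraph (Fin n) where
  Adj i j := x j ∈ proximityRegion y r c (x i)

/-- The domination number `γ` of the digraph on the points `x` with respect to the points `y`. -/
def domNumber {n m : ℕ} (r c : ℝ) (x : Fin n → ℝ) (y : Fin m → ℝ) : ℕ :=
  dominationNumber (digraph r c x y)

/-- `γ_{n,m}` for the first `n` terms of the sequence `X` and the first `m` terms of `Y`. -/
def gam {Ω : Type*} (X Y : ℕ → Ω → ℝ) (r c : ℝ) (n m : ℕ) (ω : Ω) : ℕ :=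
  domNumber r c (fun i : Fin n => X i ω) (fun j : Fin m => Y j ω)

/-- `p_n(F, r, c) = P(γ_{n,2} = 2)` for a random sample of size `n` from `F`, where the
`𝒴`-points are `a` and `b`. -/
def probTwo (F : Measure ℝ) (a b r c : ℝ) (n : ℕ) : ℝ :=
  (Measure.pi fun _ : Fin n => F).real {x | domNumber r c x ![a, b] = 2}

/-- `p = p(F, r, c)`, that is, `p` is the limit of `p_n(F, r, c)` as `n → ∞`. -/
def IsLimitProb (F : Measure ℝ) (a b r c : ℝ) (p : unitInterval) : Prop :=
  Tendsto (fun n => probTwo F a b r c n) atTop (𝓝 (p : ℝ))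

/-- `p i = p(F_i, r, c)` for every middle interval `I_i` of `y`, where `F_i` is the distribution
`FX` restricted to `I_i` (and normalised). -/
def AreLimitProbs {m : ℕ} (FX : Measure ℝ) (r c : ℝ) (y : Fin m → ℝ)
    (p : Fin (m - 1) → unitInterval) : Prop :=
  ∀ i, IsLimitProb (FX[|Set.Ioo (lo y i) (hi y i)]) (lo y i) (hi y i) r c (p i)

/-- The law of `m + 1 + ∑ B_i` for independent `B_i ∼ Bernoulli (p i)`, `i = 1, …, m - 1`. -/
def bernoulliSumLaw (m : ℕ) (p : Fin (m - 1) → unitInterval) : Measure ℕ :=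
  (Measure.pi fun i => bernoulliMeasure (1 : ℕ) 0 (p i)).map (fun B => m + 1 + ∑ i, B i)

instance (m : ℕ) (p : Fin (m - 1) → unitInterval) :
    IsProbabilityMeasure (bernoulliSumLaw m p) :=
  Measure.isProbabilityMeasure_map (by fun_prop)

/-- `r* = 1 / max(c, 1 - c)`. -/
def rStar (c : ℝ) : ℝ := 1 / max c (1 - c)

/-- The family `𝓗(ℝ)`: the joint law `F` is carried by the bounded open square `(ω₁, ω₂)²` and
charges every nonempty open part of it, its marginals are non-atomic (so that all `X` points and
all `Y` points are distinct a.s.), and `X` and `Y` do not collide. -/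
structure MemH (F : Measure (ℝ × ℝ)) (ω₁ ω₂ : ℝ) : Prop where
  prob : IsProbabilityMeasure F
  lt : ω₁ < ω₂
  carried : F (Set.Ioo ω₁ ω₂ ×ˢ Set.Ioo ω₁ ω₂)ᶜ = 0
  support_eq : F.support = closure (Set.Ioo ω₁ ω₂ ×ˢ Set.Ioo ω₁ ω₂)
  noAtoms_fst : NullSingletonClass (F.map Prod.fst)
  noAtoms_snd : NullSingletonClass (F.map Prod.snd)
  noCollision : F {z | z.1 = z.2} = 0

/-- The law `bernoulliSumLaw m p` as a bundled probability measure. -/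
def bernoulliSumProb (m : ℕ) (p : Fin (m - 1) → unitInterval) : ProbabilityMeasure ℕ :=
  ⟨bernoulliSumLaw m p, inferInstance⟩

/-- The conditional law of `γ_{n,m}` given `𝒴_m = y`. -/
def condLaw {Ω : Type*} [MeasurableSpace Ω] (μ : Measure Ω) [IsProbabilityMeasure μ]
    (X Y : ℕ → Ω → ℝ) (r c : ℝ) (n m : ℕ) (y : Fin m → ℝ) : ProbabilityMeasure ℕ :=
  ⟨condDistrib (fun ω => gam X Y r c n m ω) (fun ω (j : Fin m) => Y j ω) μ y, inferInstance⟩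

/-- `γ_{n,m}` converges in law, as `n → ∞`, to `m + 1 + ∑ B_i`, where, given the `𝒴`-points `y`,
the `B_i` are independent Bernoulli variables with parameters `p y i`. The first part is
convergence of the conditional laws given `𝒴_m = y`, for almost every realization `y`; the
second part is convergence of the unconditional laws. -/
def ConvergesToBernoulliSum {Ω : Type*} [MeasurableSpace Ω] (μ : Measure Ω)
    [IsProbabilityMeasure μ] (X Y : ℕ → Ω → ℝ) (r c : ℝ) (m : ℕ)
    (p : (Fin m → ℝ) → Fin (m - 1) → unitInterval) : Prop :=
  (∀ᵐ y ∂(μ.map fun ω (j : Fin m) => Y j ω),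
    Tendsto (fun n => condLaw μ X Y r c n m y) atTop (𝓝 (bernoulliSumProb m (p y)))) ∧
  ∀ S : Set ℕ, Tendsto (fun n : ℕ => μ {ω | gam X Y r c n m ω ∈ S}) atTop
    (𝓝 (∫⁻ y, bernoulliSumLaw m (p y) S ∂(μ.map fun ω (j : Fin m) => Y j ω)))

end PICD

end

open PICD

noncomputable section

namespace PICD

/-! ### Domination numbers of digraphs that split into cells -/

/-! Arcs never leave the cells cut out by the points `y`: the `m - 1` middle intervals and the two
end intervals. In an end interval the outermost sample point dominates, because `r ≥ 1`. In a middle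
interval the sample points nearest to `M` on either side dominate together, so the cell costs 1 or
2. Once all cells are occupied, the domination number is `m + 1` plus the number of middle intervals
without a single dominating point (`domNumber_eq`). In (i) the regime is opposite: the Y-points
eventually separate the finitely many X-points, and no arc between distinct vertices is left.

In an interval `(a, b)` a point `x ≤ M` reaches `a + r (x - a)`, which is at most `a + r c (b - a)`;
the other side is symmetric. If `r c > 1` or `r (1 - c) > 1`, that is `r > r*`, a whole subinterval
consists of dominating points. If both products are below 1, points close to `a` and to `b` rule out
every candidate. An i.i.d. sample visits all subintervals infinitely often, so both cases are
deterministic facts about a `GenericSeq`. Since `r* ≤ 2`, with equality only for `c = 1/2`, parts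
(ii)-(iv) reduce to these facts, to the limit law, and to `r = 1`, `c ∈ {0, 1}`, where an extreme
point dominates.

For the limit law, fix `y` and condition on the cell of each sample point: the cells then carry
independent samples from the conditioned laws, with sizes tending to infinity (`tendsto_pi_range`).
The first `m` X-points may depend on `𝒴_m`, but only extreme points and points nearest to `M`
matter, so finitely many terms are eventually irrelevant (`eventually_domNumber_shift`), and the
remaining ones are independent of `𝒴_m` (`tendsto_condDistrib`).

In the critical case, say `r c = 1`, a point at distance `d` to the left of `M` reaches `b - r d`.
It dominates iff `r d` is less than the gap between `b` and the rightmost sample point. On the scale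
`1 / n` the two competing distances behave like independent exponential variables whose rates come
from the density of `F_X` at `M` and at `b`, so the probability of domination tends to `β / (α + β)`
(`tendsto_race`). Absolute continuity supplies these positive densities almost surely. -/

open Classical in
/-- If the arcs of `D` stay within the cells of a partition and every cell is dominated by two of
its vertices, then each cell contributes `1` or `2` to the domination number. -/
theorem dominationNumber_eq_of_cells {V C : Type*} [Fintype C] (D : Digraph V) (cell : V → C)
    (hne : ∀ c, ∃ u, cell u = c) (hadj : ∀ u v, D.Adj u v → cell u = cell v)
    (hpair : ∀ c, ∃ u u', cell u = c ∧ cell u' = c ∧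
      ∀ v, cell v = c → v = u ∨ v = u' ∨ D.Adj u v ∨ D.Adj u' v) :
    dominationNumber D = Fintype.card C +
      (Finset.univ.filter fun c => ¬ ∃ u, cell u = c ∧ ∀ v, cell v = c → v = u ∨ D.Adj u v).card := by
  set P : C → Prop := fun c => ∃ u, cell u = c ∧ ∀ v, cell v = c → v = u ∨ D.Adj u v with hP
  have hsum : Fintype.card C + (Finset.univ.filter fun c => ¬ P c).card
      = ∑ c : C, (if P c then 1 else 2) := by
    rw [Finset.card_filter, Fintype.card_eq_sum_ones, ← Finset.sum_add_distrib]
    refine Finset.sum_congr rfl fun c _ => ?_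
    by_cases h : P c <;> simp [h]
  rw [hsum]
  have hT : ∀ c, ∃ T : Finset V, (∀ u ∈ T, cell u = c) ∧ T.card ≤ (if P c then 1 else 2) ∧
      ∀ v, cell v = c → v ∈ T ∨ ∃ u ∈ T, D.Adj u v := by
    intro c
    by_cases h : P c
    · obtain ⟨u, hu, hd⟩ := id h
      refine ⟨{u}, by simpa using hu, by simp [h], fun v hv => ?_⟩
      simpa using hd v hv
    · obtain ⟨u, u', hu, hu', hd⟩ := hpair c
      refine ⟨{u, u'}, by simp [hu, hu'], by simpa [h] using Finset.card_le_two, fun v hv => ?_⟩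
      rcases hd v hv with h | h | h | h <;> simp [h]
  choose T hT1 hT2 hT3 using hT
  have hub : dominationNumber D ≤ ∑ c : C, (if P c then 1 else 2) := by
    have hdom : IsDominating D (Finset.univ.biUnion T) := by
      intro v
      rcases hT3 (cell v) v rfl with h | ⟨u, hu, h⟩
      · exact Or.inl (Finset.mem_biUnion.2 ⟨_, Finset.mem_univ _, h⟩)
      · exact Or.inr ⟨u, Finset.mem_biUnion.2 ⟨_, Finset.mem_univ _, hu⟩, h⟩
    calc dominationNumber D ≤ (Finset.univ.biUnion T).card := Nat.sInf_le ⟨_, hdom, rfl⟩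
      _ ≤ ∑ c, (T c).card := Finset.card_biUnion_le
      _ ≤ _ := Finset.sum_le_sum fun c _ => hT2 c
  refine le_antisymm hub (le_csInf ?_ ?_)
  · refine ⟨_, Finset.univ.biUnion T, fun v => ?_, rfl⟩
    rcases hT3 (cell v) v rfl with h | ⟨u, hu, h⟩
    · exact Or.inl (Finset.mem_biUnion.2 ⟨_, Finset.mem_univ _, h⟩)
    · exact Or.inr ⟨u, Finset.mem_biUnion.2 ⟨_, Finset.mem_univ _, hu⟩, h⟩
  · rintro k ⟨S, hS, rfl⟩
    -- Lower bound: arcs stay within cells, so the part of `S` in a cell must dominate that cell on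
    -- its own. It is nonempty, and a single point suffices only if `P` holds.
    rw [Finset.card_eq_sum_card_fiberwise (f := cell) (t := Finset.univ) (by simp)]
    refine Finset.sum_le_sum fun c _ => ?_
    have hS' : ∀ v, cell v = c → v ∈ S.filter (fun u => cell u = c) ∨
        ∃ u ∈ S.filter (fun u => cell u = c), D.Adj u v := by
      intro v hv
      rcases hS v with h | ⟨u, hu, h⟩
      · exact Or.inl (Finset.mem_filter.2 ⟨h, hv⟩)
      · exact Or.inr ⟨u, Finset.mem_filter.2 ⟨hu, (hadj u v h).trans hv⟩, h⟩
    obtain ⟨v₀, hv₀⟩ := hne c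
    have hpos : 1 ≤ (S.filter fun u => cell u = c).card := by
      rw [Nat.one_le_iff_ne_zero, Finset.card_ne_zero]
      rcases hS' v₀ hv₀ with h | ⟨u, hu, -⟩
      exacts [⟨_, h⟩, ⟨_, hu⟩]
    split_ifs with h
    · exact hpos
    · by_contra hlt
      obtain ⟨u, hu⟩ := Finset.card_eq_one.1 (by omega : (S.filter fun u => cell u = c).card = 1)
      have huc : cell u = c := by
        have : u ∈ S.filter fun u => cell u = c := by rw [hu]; exact Finset.mem_singleton_self u
        exact (Finset.mem_filter.1 this).2
      refine h ⟨u, huc, fun v hv => ?_⟩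
      simpa [hu] using hS' v hv

/-- Take every vertex as a cell of its own; each cell then costs exactly one. -/
theorem dominationNumber_eq_card {V : Type*} [Fintype V] (D : Digraph V)
    (h : ∀ u v, D.Adj u v → u = v) : dominationNumber D = Fintype.card V := by
  classical
  rw [dominationNumber_eq_of_cells D id (fun c => ⟨c, rfl⟩) h
    (fun c => ⟨c, c, rfl, rfl, fun v hv => Or.inl hv⟩)]
  simp

/-! ### Order statistics and the cells cut out by the points `y` -/

theorem orderStat_mono {m : ℕ} (y : Fin m → ℝ) : Monotone (orderStat y) := Tuple.monotone_sort y

theorem exists_orderStat_eq {m : ℕ} (y : Fin m → ℝ) (j : Fin m) : ∃ k, orderStat y k = y j :=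
  ⟨(Tuple.sort y).symm j, by simp [orderStat]⟩

theorem orderStat_mem_range {m : ℕ} (y : Fin m → ℝ) (k : Fin m) : orderStat y k ∈ Set.range y :=
  ⟨_, rfl⟩

theorem orderStat_strictMono {m : ℕ} {y : Fin m → ℝ} (hy : y.Injective) :
    StrictMono (orderStat y) :=
  (orderStat_mono y).strictMono_of_injective (hy.comp (Tuple.sort y).injective)

theorem lo_lt_hi {m : ℕ} {y : Fin m → ℝ} (hy : y.Injective) (i : Fin (m - 1)) : lo y i < hi y i :=
  orderStat_strictMono hy (by simp [Fin.lt_def])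

theorem forall_lt_iff {m : ℕ} (y : Fin m → ℝ) (h : 0 < m) (x : ℝ) :
    (∀ j, x < y j) ↔ x < orderStat y ⟨0, h⟩ := by
  constructor
  · exact fun hx => hx _
  · intro hx j
    obtain ⟨k, hk⟩ := exists_orderStat_eq y j
    exact hk ▸ hx.trans_le (orderStat_mono y (by simp [Fin.le_def]))

theorem forall_gt_iff {m : ℕ} (y : Fin m → ℝ) (h : 0 < m) (x : ℝ) :
    (∀ j, y j < x) ↔ orderStat y ⟨m - 1, by omega⟩ < x := by
  constructor
  · exact fun hx => hx _
  · intro hx j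
    obtain ⟨k, hk⟩ := exists_orderStat_eq y j
    refine hk ▸ (orderStat_mono y ?_).trans_lt hx
    have := k.isLt
    simp only [Fin.le_def]; omega

/-- The cells cut out by the points `y`: the middle intervals and the two end intervals. -/
def cellSet {m : ℕ} (y : Fin m → ℝ) : Fin (m - 1) ⊕ Bool → Set ℝ
  | .inl i => Set.Ioo (lo y i) (hi y i)
  | .inr false => {x | ∀ j, x < y j}
  | .inr true => {x | ∀ j, y j < x}

theorem le_lo_or_hi_le {m : ℕ} (y : Fin m → ℝ) (i : Fin (m - 1)) (k : Fin m) :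
    orderStat y k ≤ lo y i ∨ hi y i ≤ orderStat y k := by
  rcases le_or_gt (k : ℕ) i with h | h
  · exact Or.inl (orderStat_mono y (by simpa [Fin.le_def] using h))
  · exact Or.inr (orderStat_mono y (by simpa [Fin.le_def] using h))

theorem not_mem_range_of_mem_middle {m : ℕ} (y : Fin m → ℝ) (i : Fin (m - 1)) {x : ℝ}
    (hx : x ∈ Set.Ioo (lo y i) (hi y i)) : x ∉ Set.range y := by
  rintro ⟨j, rfl⟩
  obtain ⟨k, hk⟩ := exists_orderStat_eq y j
  rcases le_lo_or_hi_le y i k with h | h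
  · exact absurd hx.1 (by rw [← hk]; exact not_lt.2 h)
  · exact absurd hx.2 (by rw [← hk]; exact not_lt.2 h)

theorem eq_of_mem_middle {m : ℕ} (y : Fin m → ℝ) {i j : Fin (m - 1)} {x : ℝ}
    (hi : x ∈ Set.Ioo (lo y i) (hi y i)) (hj : x ∈ Set.Ioo (lo y j) (PICD.hi y j)) : i = j := by
  rcases lt_trichotomy i j with h | h | h
  · have : PICD.hi y i ≤ lo y j := orderStat_mono y (by simpa [Fin.le_def] using h)
    exact absurd (hi.2.trans_le this) (not_lt.2 hj.1.le)
  · exact h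
  · have : PICD.hi y j ≤ lo y i := orderStat_mono y (by simpa [Fin.le_def] using h)
    exact absurd (hj.2.trans_le this) (not_lt.2 hi.1.le)

/-- The assumption `hm` matters: for `m = 0` both end cells are the whole line. -/
theorem cellSet_unique {m : ℕ} (hm : 0 < m) (y : Fin m → ℝ) {c d : Fin (m - 1) ⊕ Bool} {x : ℝ}
    (hc : x ∈ cellSet y c) (hd : x ∈ cellSet y d) : c = d := by
  have h0 : Fin m := ⟨0, hm⟩
  rcases c with i | _ | _ <;> rcases d with j | _ | _
  · exact congrArg _ (eq_of_mem_middle y hc hd)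
  · exact absurd hc.1 (not_lt.2 (hd _).le)
  · exact absurd hc.2 (not_lt.2 (hd _).le)
  · exact absurd hd.1 (not_lt.2 (hc _).le)
  · rfl
  · exact absurd (hc h0) (not_lt.2 (hd h0).le)
  · exact absurd hd.2 (not_lt.2 (hc _).le)
  · exact absurd (hd h0) (not_lt.2 (hc h0).le)
  · rfl

theorem exists_mem_cellSet {m : ℕ} (hm : 0 < m) (y : Fin m → ℝ) {x : ℝ} (hx : x ∉ Set.range y) :
    ∃ c, x ∈ cellSet y c := by
  by_cases h1 : ∀ j, x < y j
  · exact ⟨.inr false, h1⟩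
  by_cases h2 : ∀ j, y j < x
  · exact ⟨.inr true, h2⟩
  rw [forall_lt_iff y hm] at h1
  rw [forall_gt_iff y hm] at h2
  have hne : ∀ k, orderStat y k ≠ x := fun k hk => hx (hk ▸ orderStat_mem_range y k)
  have h0 : orderStat y ⟨0, hm⟩ < x := lt_of_le_of_ne (not_lt.1 h1) (hne _)
  -- The last order statistic below `x` is the left end of the middle interval containing `x`.
  obtain ⟨k, hk, hmax⟩ := (Finset.univ.filter fun k => orderStat y k < x).exists_max_image id
    ⟨_, Finset.mem_filter.2 ⟨Finset.mem_univ _, h0⟩⟩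
  have hkx : orderStat y k < x := (Finset.mem_filter.1 hk).2
  have hklt : (k : ℕ) < m - 1 := by
    by_contra hcon
    have : k = ⟨m - 1, by omega⟩ := Fin.ext (by have := k.isLt; simp only; omega)
    exact h2 (this ▸ hkx)
  refine ⟨.inl ⟨k, hklt⟩, hkx, ?_⟩
  by_contra hcon
  have hlt : orderStat y ⟨k + 1, by omega⟩ < x := lt_of_le_of_ne (not_lt.1 hcon) (hne _)
  have := hmax _ (Finset.mem_filter.2 ⟨Finset.mem_univ _, hlt⟩)
  simp [Fin.le_def] at this

/-! ### Proximity regions -/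

theorem middleRegion_subset (a b r c x : ℝ) : middleRegion a b r c x ⊆ Set.Ioo a b := by
  unfold middleRegion
  split_ifs
  · exact Set.Ioo_subset_Ioo_right (min_le_left _ _)
  · exact Set.Ioo_subset_Ioo_left (le_max_left _ _)

theorem mem_middleRegion_of_le {a b r c x z : ℝ} (hx : x ≤ a + c * (b - a)) :
    z ∈ middleRegion a b r c x ↔ z ∈ Set.Ioo a b ∧ z < a + r * (x - a) := by
  simp [middleRegion, hx, and_assoc]

theorem mem_middleRegion_of_lt {a b r c x z : ℝ} (hx : a + c * (b - a) < x) :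
    z ∈ middleRegion a b r c x ↔ z ∈ Set.Ioo a b ∧ b - r * (b - x) < z := by
  simp only [middleRegion, not_le.2 hx, if_false, Set.mem_Ioo, max_lt_iff]
  tauto

theorem mem_proximityRegion_middle {m : ℕ} (y : Fin m → ℝ) (r c : ℝ) {x : ℝ} (i : Fin (m - 1))
    (hx : x ∈ Set.Ioo (lo y i) (hi y i)) (z : ℝ) :
    z ∈ proximityRegion y r c x ↔ z ∈ middleRegion (lo y i) (hi y i) r c x := by
  have hm : 0 < m := by have := i.isLt; omega
  constructor
  · rintro (⟨h, -⟩ | ⟨j, hj, hz⟩ | ⟨h, hlt, -⟩ | ⟨h, hlt, -⟩)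
    · exact absurd h (not_mem_range_of_mem_middle y i hx)
    · rwa [eq_of_mem_middle y hx hj]
    · have : orderStat y ⟨0, h⟩ ≤ lo y i := orderStat_mono y (by simp [Fin.le_def])
      exact absurd (hlt.trans_le this) (not_lt.2 hx.1.le)
    · have : hi y i ≤ orderStat y ⟨m - 1, by omega⟩ :=
        orderStat_mono y (by have := i.isLt; simp only [Fin.le_def]; omega)
      exact absurd (this.trans_lt hlt) (not_lt.2 hx.2.le)
  · exact fun hz => Or.inr (Or.inl ⟨i, hx, hz⟩)

theorem mem_cellSet_of_mem_proximityRegion {m : ℕ} (y : Fin m → ℝ) {r c x z : ℝ}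
    (hx : x ∉ Set.range y) (hz : z ∈ proximityRegion y r c x) :
    ∃ d, x ∈ cellSet y d ∧ z ∈ cellSet y d := by
  rcases hz with ⟨h, -⟩ | ⟨j, hj, hz⟩ | ⟨h, hlt, hz⟩ | ⟨h, hlt, hz⟩
  · exact absurd h hx
  · exact ⟨.inl j, hj, middleRegion_subset _ _ _ _ _ hz⟩
  · exact ⟨.inr false, (forall_lt_iff y h x).2 hlt, (forall_lt_iff y h z).2 hz.2⟩
  · exact ⟨.inr true, (forall_gt_iff y h x).2 hlt, (forall_gt_iff y h z).2 hz.1⟩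

/-- Some point of `A ∩ (a, b)` dominates all of `A ∩ (a, b)`. -/
def HasDominator (A : Set ℝ) (a b r c : ℝ) : Prop :=
  ∃ x ∈ A ∩ Set.Ioo a b, ∀ z ∈ A ∩ Set.Ioo a b, z = x ∨ z ∈ middleRegion a b r c x

/-- Since `r ≥ 1`, the region of a left-case point contains all points of the interval to its left,
and that of a right-case point all points to its right. Hence the largest sample point up to `M` and
the smallest beyond `M` suffice; if one side is empty, the same point is used twice. -/
theorem exists_dominating_pair {ι : Type*} [Finite ι] (x : ι → ℝ) {a b r c : ℝ} (hr : 1 ≤ r)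
    (hne : ∃ u, x u ∈ Set.Ioo a b) :
    ∃ u u', x u ∈ Set.Ioo a b ∧ x u' ∈ Set.Ioo a b ∧ ∀ v, x v ∈ Set.Ioo a b →
      x v = x u ∨ x v = x u' ∨ x v ∈ middleRegion a b r c (x u) ∨
        x v ∈ middleRegion a b r c (x u') := by
  classical
  cases nonempty_fintype ι
  have hL : ∀ u v, x u ∈ Set.Ioo a b → x u ≤ a + c * (b - a) → x v ∈ Set.Ioo a b → x v < x u →
      x v ∈ middleRegion a b r c (x u) := by
    intro u v hu hu' hv hlt
    refine (mem_middleRegion_of_le hu').2 ⟨hv, ?_⟩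
    nlinarith [hu.1, mul_nonneg (sub_nonneg.2 hr) (sub_nonneg.2 hu.1.le)]
  have hR : ∀ u v, x u ∈ Set.Ioo a b → a + c * (b - a) < x u → x v ∈ Set.Ioo a b → x u < x v →
      x v ∈ middleRegion a b r c (x u) := by
    intro u v hu hu' hv hlt
    refine (mem_middleRegion_of_lt hu').2 ⟨hv, ?_⟩
    nlinarith [hu.1, mul_nonneg (sub_nonneg.2 hr) (sub_nonneg.2 hu.2.le)]
  have key : ∀ p : ι → Prop, (∃ u, p u) → (∃ u, p u ∧ ∀ v, p v → x v ≤ x u) ∧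
      ∃ u, p u ∧ ∀ v, p v → x u ≤ x v := by
    rintro p ⟨u, hu⟩
    have hs : (Finset.univ.filter p).Nonempty := ⟨u, by simpa using hu⟩
    obtain ⟨w, hw, hmax⟩ := Finset.exists_max_image _ x hs
    obtain ⟨w', hw', hmin⟩ := Finset.exists_min_image _ x hs
    exact ⟨⟨w, by simpa using hw, fun v hv => hmax v (by simpa using hv)⟩,
      ⟨w', by simpa using hw', fun v hv => hmin v (by simpa using hv)⟩⟩
  by_cases h1 : ∃ u, x u ∈ Set.Ioo a b ∧ x u ≤ a + c * (b - a)
  · obtain ⟨u, hu, humax⟩ := (key _ h1).1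
    by_cases h2 : ∃ u, x u ∈ Set.Ioo a b ∧ a + c * (b - a) < x u
    · obtain ⟨w, hw, hwmin⟩ := (key _ h2).2
      refine ⟨u, w, hu.1, hw.1, fun v hv => ?_⟩
      rcases le_or_gt (x v) (a + c * (b - a)) with h | h
      · rcases (humax v ⟨hv, h⟩).eq_or_lt with h' | h'
        · exact Or.inl h'
        · exact Or.inr (Or.inr (Or.inl (hL u v hu.1 hu.2 hv h')))
      · rcases (hwmin v ⟨hv, h⟩).eq_or_lt with h' | h'
        · exact Or.inr (Or.inl h'.symm)
        · exact Or.inr (Or.inr (Or.inr (hR w v hw.1 hw.2 hv h')))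
    · push Not at h2
      refine ⟨u, u, hu.1, hu.1, fun v hv => ?_⟩
      rcases (humax v ⟨hv, h2 v hv⟩).eq_or_lt with h' | h'
      · exact Or.inl h'
      · exact Or.inr (Or.inr (Or.inl (hL u v hu.1 hu.2 hv h')))
  · push Not at h1
    obtain ⟨u₀, hu₀⟩ := hne
    obtain ⟨w, hw, hwmin⟩ := (key (fun u => x u ∈ Set.Ioo a b) ⟨u₀, hu₀⟩).2
    refine ⟨w, w, hw, hw, fun v hv => ?_⟩
    rcases (hwmin v hv).eq_or_lt with h' | h'
    · exact Or.inl h'.symm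
    · exact Or.inr (Or.inr (Or.inl (hR w v hw (h1 w hw) hv h')))

/-- The leftmost point works: for `r ≥ 1` its region extends from itself or further left up to
`Y_(1)`. This is why an end interval never costs two. -/
theorem exists_dominating_left {n m : ℕ} (x : Fin n → ℝ) (y : Fin m → ℝ) {r : ℝ} (c : ℝ)
    (hr : 1 ≤ r) (hm : 0 < m) (hne : ∃ u, x u ∈ cellSet y (.inr false)) :
    ∃ u, x u ∈ cellSet y (.inr false) ∧ ∀ v, x v ∈ cellSet y (.inr false) →
      x v = x u ∨ x v ∈ proximityRegion y r c (x u) := by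
  classical
  obtain ⟨u₀, hu₀⟩ := hne
  obtain ⟨w, hw, hmin⟩ := Finset.exists_min_image
    (Finset.univ.filter fun u => x u ∈ cellSet y (.inr false)) x ⟨u₀, by simpa using hu₀⟩
  have hw' : x w ∈ cellSet y (.inr false) := by simpa using hw
  refine ⟨w, hw', fun v hv => ?_⟩
  rcases (hmin v (by simpa using hv)).eq_or_lt with h | h
  · exact Or.inl h.symm
  · have h1 := (forall_lt_iff y hm _).1 hw'
    have h2 := (forall_lt_iff y hm _).1 hv
    refine Or.inr (Or.inr (Or.inr (Or.inl ⟨hm, h1, ?_, h2⟩)))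
    nlinarith [mul_nonneg (sub_nonneg.2 hr) (sub_nonneg.2 h1.le)]

theorem exists_dominating_right {n m : ℕ} (x : Fin n → ℝ) (y : Fin m → ℝ) {r : ℝ} (c : ℝ)
    (hr : 1 ≤ r) (hm : 0 < m) (hne : ∃ u, x u ∈ cellSet y (.inr true)) :
    ∃ u, x u ∈ cellSet y (.inr true) ∧ ∀ v, x v ∈ cellSet y (.inr true) →
      x v = x u ∨ x v ∈ proximityRegion y r c (x u) := by
  classical
  obtain ⟨u₀, hu₀⟩ := hne
  obtain ⟨w, hw, hmax⟩ := Finset.exists_max_image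
    (Finset.univ.filter fun u => x u ∈ cellSet y (.inr true)) x ⟨u₀, by simpa using hu₀⟩
  have hw' : x w ∈ cellSet y (.inr true) := by simpa using hw
  refine ⟨w, hw', fun v hv => ?_⟩
  rcases (hmax v (by simpa using hv)).eq_or_lt with h | h
  · exact Or.inl h
  · have h1 := (forall_gt_iff y hm _).1 hw'
    have h2 := (forall_gt_iff y hm _).1 hv
    refine Or.inr (Or.inr (Or.inr (Or.inr ⟨hm, h1, h2, ?_⟩)))
    nlinarith [mul_nonneg (sub_nonneg.2 hr) (sub_nonneg.2 h1.le)]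

theorem hasDominator_range_iff {n m : ℕ} {x : Fin n → ℝ} (y : Fin m → ℝ) (r c : ℝ)
    (hx : x.Injective) (i : Fin (m - 1)) :
    HasDominator (Set.range x) (lo y i) (hi y i) r c ↔
      ∃ u, x u ∈ Set.Ioo (lo y i) (hi y i) ∧ ∀ v, x v ∈ Set.Ioo (lo y i) (hi y i) →
        v = u ∨ (digraph r c x y).Adj u v := by
  constructor
  · rintro ⟨_, ⟨⟨u, rfl⟩, hu⟩, h⟩
    refine ⟨u, hu, fun v hv => ?_⟩
    exact (h _ ⟨⟨v, rfl⟩, hv⟩).imp (fun h => hx h)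
      fun h => (mem_proximityRegion_middle y r c i hu _).2 h
  · rintro ⟨u, hu, h⟩
    refine ⟨x u, ⟨⟨u, rfl⟩, hu⟩, ?_⟩
    rintro _ ⟨⟨v, rfl⟩, hv⟩
    exact (h v hv).imp (fun h => congrArg x h)
      fun h => (mem_proximityRegion_middle y r c i hu _).1 h

-- There are `(m - 1) + 2` cells, which gives `m + 1`; the end cells always have a single dominating
-- point, so only middle intervals can add to the count.
open Classical in
theorem domNumber_eq {n m : ℕ} {x : Fin n → ℝ} {y : Fin m → ℝ} {r c : ℝ} (hr : 1 ≤ r)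
    (hm : 0 < m) (hx : x.Injective) (hxy : ∀ u j, x u ≠ y j)
    (hne : ∀ d, ∃ u, x u ∈ cellSet y d) :
    domNumber r c x y = m + 1 + (Finset.univ.filter fun i : Fin (m - 1) =>
      ¬ HasDominator (Set.range x) (lo y i) (hi y i) r c).card := by
  have hmem : ∀ u, x u ∉ Set.range y := fun u ⟨j, hj⟩ => hxy u j hj.symm
  choose cell hcell using fun u => exists_mem_cellSet hm y (hmem u)
  have hiff : ∀ u d, cell u = d ↔ x u ∈ cellSet y d := fun u d =>
    ⟨fun h => h ▸ hcell u, fun h => cellSet_unique hm y (hcell u) h⟩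
  rw [domNumber, dominationNumber_eq_of_cells (digraph r c x y) cell
    (fun d => (hne d).imp fun u hu => (hiff u d).2 hu)]
  · rw [Fintype.card_sum, Fintype.card_fin, Fintype.card_bool]
    simp only [hiff]
    have : (Finset.univ.filter fun d : Fin (m - 1) ⊕ Bool => ¬ ∃ u, x u ∈ cellSet y d ∧
        ∀ v, x v ∈ cellSet y d → v = u ∨ (digraph r c x y).Adj u v) =
        (Finset.univ.filter fun i : Fin (m - 1) =>
          ¬ HasDominator (Set.range x) (lo y i) (hi y i) r c).map ⟨Sum.inl, Sum.inl_injective⟩ := by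
      ext d
      rcases d with i | _ | _
      · simp only [Finset.mem_filter, Finset.mem_univ, true_and, Finset.mem_map,
          Function.Embedding.coeFn_mk, Sum.inl.injEq, exists_eq_right,
          hasDominator_range_iff y r c hx]
        rfl
      · obtain ⟨u, hu, h⟩ := exists_dominating_left x y c hr hm (hne _)
        simp only [Finset.mem_filter, Finset.mem_univ, true_and, Finset.mem_map,
          Function.Embedding.coeFn_mk, reduceCtorEq, and_false, exists_false, iff_false, not_not]
        exact ⟨u, hu, fun v hv => (h v hv).imp (fun h => hx h) id⟩
      · obtain ⟨u, hu, h⟩ := exists_dominating_right x y c hr hm (hne _)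
        simp only [Finset.mem_filter, Finset.mem_univ, true_and, Finset.mem_map,
          Function.Embedding.coeFn_mk, reduceCtorEq, and_false, exists_false, iff_false, not_not]
        exact ⟨u, hu, fun v hv => (h v hv).imp (fun h => hx h) id⟩
    rw [this, Finset.card_map]
    omega
  · intro u v h
    obtain ⟨d, hu, hv⟩ := mem_cellSet_of_mem_proximityRegion y (hmem u) h
    rw [(hiff u d).2 hu, (hiff v d).2 hv]
  · rintro (i | _ | _)
    · obtain ⟨u, u', hu, hu', h⟩ := exists_dominating_pair x (c := c) hr (hne (.inl i))
      refine ⟨u, u', (hiff _ _).2 hu, (hiff _ _).2 hu', fun v hv => ?_⟩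
      rcases h v ((hiff _ _).1 hv) with h | h | h | h
      · exact Or.inl (hx h)
      · exact Or.inr (Or.inl (hx h))
      · exact Or.inr (Or.inr (Or.inl ((mem_proximityRegion_middle y r c i hu _).2 h)))
      · exact Or.inr (Or.inr (Or.inr ((mem_proximityRegion_middle y r c i hu' _).2 h)))
    · obtain ⟨u, hu, h⟩ := exists_dominating_left x y c hr hm (hne _)
      refine ⟨u, u, (hiff _ _).2 hu, (hiff _ _).2 hu, fun v hv => ?_⟩
      rcases h v ((hiff _ _).1 hv) with h | h
      · exact Or.inl (hx h)
      · exact Or.inr (Or.inr (Or.inl h))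
    · obtain ⟨u, hu, h⟩ := exists_dominating_right x y c hr hm (hne _)
      refine ⟨u, u, (hiff _ _).2 hu, (hiff _ _).2 hu, fun v hv => ?_⟩
      rcases h v ((hiff _ _).1 hv) with h | h
      · exact Or.inl (hx h)
      · exact Or.inr (Or.inr (Or.inl h))

/-! ### When a middle interval has a dominating point -/

theorem hasDominator_of_left {A : Set ℝ} {a b r c x : ℝ} (hx : x ∈ A) (hxI : x ∈ Set.Ioo a b)
    (hxM : x ≤ a + c * (b - a)) (h : b ≤ a + r * (x - a)) : HasDominator A a b r c :=
  ⟨x, ⟨hx, hxI⟩, fun _ hz => Or.inr ((mem_middleRegion_of_le hxM).2 ⟨hz.2, hz.2.2.trans_le h⟩)⟩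

theorem hasDominator_of_right {A : Set ℝ} {a b r c x : ℝ} (hx : x ∈ A) (hxI : x ∈ Set.Ioo a b)
    (hxM : a + c * (b - a) < x) (h : b - r * (b - x) ≤ a) : HasDominator A a b r c :=
  ⟨x, ⟨hx, hxI⟩, fun _ hz => Or.inr ((mem_middleRegion_of_lt hxM).2 ⟨hz.2, h.trans_lt hz.2.1⟩)⟩

/-- The maximum is positive for every real `c`, because `c` and `1 - c` cannot both be nonpositive;
so the denominator can be cleared. -/
theorem rStar_lt_iff {r c : ℝ} (hr : 1 ≤ r) : rStar c < r ↔ 1 < r * c ∨ 1 < r * (1 - c) := by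
  have hmax : 0 < max c (1 - c) := by
    rcases le_or_gt c 0 with h | h
    · exact lt_max_of_lt_right (by linarith)
    · exact lt_max_of_lt_left h
  rw [rStar, div_lt_iff₀ hmax, mul_max_of_nonneg _ _ (by linarith), lt_max_iff]

theorem lt_rStar_iff {r c : ℝ} (hr : 1 ≤ r) : r < rStar c ↔ r * c < 1 ∧ r * (1 - c) < 1 := by
  have hmax : 0 < max c (1 - c) := by
    rcases le_or_gt c 0 with h | h
    · exact lt_max_of_lt_right (by linarith)
    · exact lt_max_of_lt_left h
  rw [rStar, lt_div_iff₀ hmax, mul_max_of_nonneg _ _ (by linarith), max_lt_iff]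

/-- A left-case point reaches `b` as soon as its distance from `a` is at least `(b - a) / r`. Such
points exist left of `M` with room to spare exactly when `r c > 1`; the condition `r (1 - c) > 1` is
the mirror image. -/
theorem exists_interval_hasDominator {a b r c : ℝ} (hab : a < b) (hr : 1 ≤ r)
    (hc : c ∈ Set.Icc (0 : ℝ) 1) (h : rStar c < r) :
    ∃ p q, a ≤ p ∧ p < q ∧ q ≤ b ∧
      ∀ A : Set ℝ, (∃ x ∈ A, x ∈ Set.Ioo p q) → HasDominator A a b r c := by
  have hr0 : 0 < r := by linarith
  have hd : 0 < b - a := by linarith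
  have hpos : 0 < (b - a) / r := by positivity
  rcases (rStar_lt_iff hr).1 h with h | h
  · have h1 : (b - a) / r < c * (b - a) := by
      rw [div_lt_iff₀ hr0]; nlinarith
    refine ⟨a + (b - a) / r, a + c * (b - a), by linarith, by linarith,
      by nlinarith [hc.2], ?_⟩
    rintro A ⟨x, hx, hp, hq⟩
    refine hasDominator_of_left hx ⟨by linarith, by nlinarith [hc.2]⟩ hq.le ?_
    have h2 : (b - a) / r < x - a := by linarith
    rw [div_lt_iff₀ hr0] at h2
    linarith
  · have h1 : (b - a) / r < (1 - c) * (b - a) := by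
      rw [div_lt_iff₀ hr0]; nlinarith
    refine ⟨a + c * (b - a), b - (b - a) / r, by nlinarith [hc.1], by linarith,
      by linarith, ?_⟩
    rintro A ⟨x, hx, hp, hq⟩
    refine hasDominator_of_right hx ⟨by nlinarith [hc.1], by linarith⟩ hp ?_
    have h2 : (b - a) / r < b - x := by linarith
    rw [div_lt_iff₀ hr0] at h2
    linarith

/-- A point right of `a + r c (b - a)` cannot be dominated from the left case. -/
theorem lt_of_dominated_left {a b r c x z : ℝ} (hab : a < b) (hr : 1 ≤ r) (hc : 0 ≤ c)
    (hxM : x ≤ a + c * (b - a)) (h : z = x ∨ z ∈ middleRegion a b r c x) :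
    z ≤ a + r * c * (b - a) := by
  have h1 : 0 ≤ c * (b - a) := mul_nonneg hc (by linarith)
  rcases h with rfl | h
  · nlinarith
  · have := ((mem_middleRegion_of_le hxM).1 h).2
    nlinarith

/-- A point left of `b - r (1 - c) (b - a)` cannot be dominated from the right case. -/
theorem lt_of_dominated_right {a b r c x z : ℝ} (hab : a < b) (hr : 1 ≤ r) (hc : c ≤ 1)
    (hxM : a + c * (b - a) < x) (h : z = x ∨ z ∈ middleRegion a b r c x) :
    b - r * (1 - c) * (b - a) ≤ z := by
  have h1 : 0 ≤ (1 - c) * (b - a) := mul_nonneg (by linarith) (by linarith)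
  rcases h with rfl | h
  · nlinarith
  · have := ((mem_middleRegion_of_lt hxM).1 h).2
    nlinarith

/-- One witness lies beyond the reach of every left-case point, the other beyond the reach of every
right-case point. -/
theorem not_hasDominator {A : Set ℝ} {a b r c : ℝ} (hab : a < b) (hr : 1 ≤ r)
    (hc : c ∈ Set.Icc (0 : ℝ) 1)
    (h1 : ∃ x ∈ A, x ∈ Set.Ioo a b ∧ a + r * c * (b - a) < x)
    (h2 : ∃ x ∈ A, x ∈ Set.Ioo a b ∧ x < b - r * (1 - c) * (b - a)) :
    ¬ HasDominator A a b r c := by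
  rintro ⟨x, ⟨hxA, hxI⟩, hx⟩
  obtain ⟨z, hz, hzI, hz'⟩ := h1
  obtain ⟨w, hw, hwI, hw'⟩ := h2
  rcases le_or_gt x (a + c * (b - a)) with h | h
  · exact absurd (lt_of_dominated_left hab hr hc.1 h (hx z ⟨hz, hzI⟩)) (not_le.2 hz')
  · exact absurd (lt_of_dominated_right hab hr hc.2 h (hx w ⟨hw, hwI⟩)) (not_le.2 hw')

/-- For `c = 0` or `c = 1` all points of the interval fall under the same case, so the minimum or
the maximum dominates even when `r = 1`. Finiteness of `A` is what provides the extreme point. -/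
theorem hasDominator_of_endpoint {A : Set ℝ} (hA : A.Finite) {a b r c : ℝ} (hr : 1 ≤ r)
    (hc : c = 0 ∨ c = 1) (hne : (A ∩ Set.Ioo a b).Nonempty) : HasDominator A a b r c := by
  have hfin : (A ∩ Set.Ioo a b).Finite := hA.subset Set.inter_subset_left
  rcases hc with rfl | rfl
  · obtain ⟨w, hw, hmin⟩ := Set.exists_min_image _ id hfin hne
    refine ⟨w, hw, fun z hz => ?_⟩
    rcases (hmin z hz).eq_or_lt with h | h
    · exact Or.inl h.symm
    · refine Or.inr ((mem_middleRegion_of_lt (by simpa using hw.2.1)).2 ⟨hz.2, ?_⟩)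
      simp only [id] at h
      nlinarith [mul_nonneg (sub_nonneg.2 hr) (sub_nonneg.2 hw.2.2.le)]
  · obtain ⟨w, hw, hmax⟩ := Set.exists_max_image _ id hfin hne
    refine ⟨w, hw, fun z hz => ?_⟩
    rcases (hmax z hz).eq_or_lt with h | h
    · exact Or.inl h
    · refine Or.inr ((mem_middleRegion_of_le (by linarith [hw.2.2])).2 ⟨hz.2, ?_⟩)
      simp only [id] at h
      nlinarith [mul_nonneg (sub_nonneg.2 hr) (sub_nonneg.2 hw.2.1.le)]

/-- Points that are not extreme and not closest to `M` do not matter. -/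
theorem hasDominator_union_iff {A B : Set ℝ} {a b r c : ℝ} (hr : 1 ≤ r)
    (hB : ∀ z ∈ B, z ∈ Set.Ioo a b → z ≠ a + c * (b - a) ∧ (∃ x ∈ A, x ∈ Set.Ioo a z) ∧
      (∃ x ∈ A, x ∈ Set.Ioo z b) ∧
      (z < a + c * (b - a) → ∃ x ∈ A, x ∈ Set.Ioo z (min b (a + c * (b - a)))) ∧
      (a + c * (b - a) < z → ∃ x ∈ A, x ∈ Set.Ioo (max a (a + c * (b - a))) z)) :
    HasDominator (A ∪ B) a b r c ↔ HasDominator A a b r c := by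
  constructor
  · rintro ⟨x, ⟨hxA, hxI⟩, hx⟩
    rcases hxA with hxA | hxB
    · exact ⟨x, ⟨hxA, hxI⟩, fun z hz => hx z ⟨Or.inl hz.1, hz.2⟩⟩
    by_cases hxA : x ∈ A
    · exact ⟨x, ⟨hxA, hxI⟩, fun z hz => hx z ⟨Or.inl hz.1, hz.2⟩⟩
    obtain ⟨hne, -, -, hl, hrt⟩ := hB x hxB hxI
    have hx' : ∀ z ∈ A ∩ Set.Ioo a b, z ∈ middleRegion a b r c x := fun z hz =>
      (hx z ⟨Or.inl hz.1, hz.2⟩).resolve_left fun h => hxA (h ▸ hz.1)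
    -- A dominating point from `B` is replaced by a point of `A` between it and `M`, whose region is
    -- larger.
    rcases lt_or_gt_of_ne hne with h | h
    · obtain ⟨w, hwA, hw⟩ := hl h
      have hwM := hw.2.trans_le (min_le_right _ _)
      refine ⟨w, ⟨hwA, hxI.1.trans hw.1, hw.2.trans_le (min_le_left _ _)⟩, fun z hz => Or.inr ?_⟩
      have h3 := (mem_middleRegion_of_le h.le).1 (hx' z hz)
      exact (mem_middleRegion_of_le hwM.le).2 ⟨h3.1, by nlinarith [hw.1]⟩
    · obtain ⟨w, hwA, hw⟩ := hrt h
      have hwM := (le_max_right _ _).trans_lt hw.1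
      refine ⟨w, ⟨hwA, (le_max_left _ _).trans_lt hw.1, hw.2.trans hxI.2⟩,
        fun z hz => Or.inr ?_⟩
      have h3 := (mem_middleRegion_of_lt h).1 (hx' z hz)
      exact (mem_middleRegion_of_lt hwM).2 ⟨h3.1, by nlinarith [hw.2]⟩
  · rintro ⟨x, ⟨hxA, hxI⟩, hx⟩
    refine ⟨x, ⟨Or.inl hxA, hxI⟩, ?_⟩
    rintro z ⟨hz | hz, hzI⟩
    · exact hx z ⟨hz, hzI⟩
    -- `z` lies between two points of `A`. A left-case region that reaches the upper neighbour `v`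
    -- also reaches `z`; a right-case region that reaches the lower neighbour `w` does so too.
    obtain ⟨-, ⟨w, hwA, hw⟩, ⟨v, hvA, hv⟩, -, -⟩ := hB z hz hzI
    rcases le_or_gt x (a + c * (b - a)) with h | h
    · refine or_iff_not_imp_left.2 fun _ => (mem_middleRegion_of_le h).2 ⟨hzI, ?_⟩
      rcases hx v ⟨hvA, hzI.1.trans hv.1, hv.2⟩ with h' | h'
      · nlinarith [hv.1, hxI.1]
      · exact hv.1.trans ((mem_middleRegion_of_le h).1 h').2
    · refine or_iff_not_imp_left.2 fun _ => (mem_middleRegion_of_lt h).2 ⟨hzI, ?_⟩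
      rcases hx w ⟨hwA, hw.1, hw.2.trans hzI.2⟩ with h' | h'
      · nlinarith [hw.2, hxI.2]
      · exact ((mem_middleRegion_of_lt h).1 h').2.trans hw.2

/-! ### Sequences that visit every subinterval infinitely often -/

/-- The sequence `x` has distinct terms in `(ω₁, ω₂)`, different from the distinct points `y`, and
visits each subinterval infinitely often. -/
structure GenericSeq (ω₁ ω₂ : ℝ) (x : ℕ → ℝ) {m : ℕ} (y : Fin m → ℝ) : Prop where
  lt : ω₁ < ω₂
  inj : x.Injective
  inj_y : y.Injective
  ne : ∀ i j, x i ≠ y j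
  mem_y : ∀ j, y j ∈ Set.Ioo ω₁ ω₂
  visits : ∀ p q, ω₁ ≤ p → p < q → q ≤ ω₂ → ∀ N, ∃ k, N ≤ k ∧ x k ∈ Set.Ioo p q

namespace GenericSeq

variable {ω₁ ω₂ : ℝ} {x : ℕ → ℝ} {m : ℕ} {y : Fin m → ℝ}

theorem shift (h : GenericSeq ω₁ ω₂ x y) (s : ℕ) : GenericSeq ω₁ ω₂ (fun k => x (s + k)) y where
  lt := h.lt
  inj := fun _ _ hij => Nat.add_left_cancel (h.inj hij)
  inj_y := h.inj_y
  ne := fun i j => h.ne _ j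
  mem_y := h.mem_y
  visits := by
    intro p q h1 h2 h3 N
    obtain ⟨k, hk, hk'⟩ := h.visits p q h1 h2 h3 (s + N)
    exact ⟨k - s, by omega, by rwa [Nat.add_sub_cancel' (by omega)]⟩

theorem orderStat_mem (h : GenericSeq ω₁ ω₂ x y) (k : Fin m) : orderStat y k ∈ Set.Ioo ω₁ ω₂ :=
  h.mem_y _

theorem eventually_visits (h : GenericSeq ω₁ ω₂ x y) {p q : ℝ} (h1 : ω₁ ≤ p) (h2 : p < q)
    (h3 : q ≤ ω₂) : ∀ᶠ n in atTop, ∃ u : Fin n, x u ∈ Set.Ioo p q := by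
  obtain ⟨k, -, hk⟩ := h.visits p q h1 h2 h3 0
  filter_upwards [eventually_gt_atTop k] with n hn using ⟨⟨k, hn⟩, hk⟩

theorem eventually_visits_middle (h : GenericSeq ω₁ ω₂ x y) (i : Fin (m - 1)) {p q : ℝ}
    (h1 : lo y i ≤ p) (h2 : p < q) (h3 : q ≤ hi y i) :
    ∀ᶠ n in atTop, ∃ z ∈ Set.range (fun u : Fin n => x u), z ∈ Set.Ioo p q :=
  (h.eventually_visits ((h.orderStat_mem _).1.le.trans h1) h2
    (h3.trans (h.orderStat_mem _).2.le)).mono fun _ ⟨u, hu⟩ => ⟨_, ⟨u, rfl⟩, hu⟩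

theorem eventually_cells_nonempty (h : GenericSeq ω₁ ω₂ x y) (hm : 0 < m) :
    ∀ᶠ n in atTop, ∀ d, ∃ u : Fin n, x u ∈ cellSet y d := by
  rw [eventually_all]
  rintro (i | _ | _)
  · exact h.eventually_visits (h.orderStat_mem _).1.le (lo_lt_hi h.inj_y i) (h.orderStat_mem _).2.le
  · refine (h.eventually_visits le_rfl (h.orderStat_mem ⟨0, hm⟩).1 (h.orderStat_mem _).2.le).mono ?_
    exact fun n ⟨u, hu⟩ => ⟨u, (forall_lt_iff y hm _).2 hu.2⟩
  · refine (h.eventually_visits (h.orderStat_mem ⟨m - 1, by omega⟩).1.le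
      (h.orderStat_mem _).2 le_rfl).mono ?_
    exact fun n ⟨u, hu⟩ => ⟨u, (forall_gt_iff y hm _).2 hu.1⟩

open Classical in
theorem eventually_domNumber_eq (h : GenericSeq ω₁ ω₂ x y) (hm : 0 < m) {r : ℝ} (c : ℝ)
    (hr : 1 ≤ r) : ∀ᶠ n in atTop, domNumber r c (fun u : Fin n => x u) y = m + 1 +
      (Finset.univ.filter fun i : Fin (m - 1) =>
        ¬ HasDominator (Set.range fun u : Fin n => x u) (lo y i) (hi y i) r c).card := by
  filter_upwards [h.eventually_cells_nonempty hm] with n hn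
  exact domNumber_eq hr hm (fun i j hij => Fin.ext (h.inj hij)) (fun u j => h.ne _ _) hn

theorem eventually_eq_succ (h : GenericSeq ω₁ ω₂ x y) (hm : 0 < m) {r c : ℝ} (hr : 1 ≤ r)
    (hd : ∀ i : Fin (m - 1), ∀ᶠ n in atTop,
      HasDominator (Set.range fun u : Fin n => x u) (lo y i) (hi y i) r c) :
    ∀ᶠ n in atTop, domNumber r c (fun u : Fin n => x u) y = m + 1 := by
  filter_upwards [h.eventually_domNumber_eq hm c hr, eventually_all.2 hd] with n h1 h2
  simp [h1, h2]

theorem eventually_eq_two_mul (h : GenericSeq ω₁ ω₂ x y) (hm : 0 < m) {r c : ℝ} (hr : 1 ≤ r)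
    (hd : ∀ i : Fin (m - 1), ∀ᶠ n in atTop,
      ¬ HasDominator (Set.range fun u : Fin n => x u) (lo y i) (hi y i) r c) :
    ∀ᶠ n in atTop, domNumber r c (fun u : Fin n => x u) y = 2 * m := by
  filter_upwards [h.eventually_domNumber_eq hm c hr, eventually_all.2 hd] with n h1 h2
  simp only [h1, h2, not_false_eq_true, Finset.filter_true, Finset.card_univ, Fintype.card_fin]
  omega

theorem eventually_eq_succ_of_rStar_lt (h : GenericSeq ω₁ ω₂ x y) (hm : 0 < m) {r c : ℝ}
    (hr : 1 ≤ r) (hc : c ∈ Set.Icc (0 : ℝ) 1) (hrc : rStar c < r) :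
    ∀ᶠ n in atTop, domNumber r c (fun u : Fin n => x u) y = m + 1 := by
  refine h.eventually_eq_succ hm hr fun i => ?_
  obtain ⟨p, q, h1, h2, h3, h4⟩ := exists_interval_hasDominator (lo_lt_hi h.inj_y i) hr hc hrc
  exact (h.eventually_visits_middle i h1 h2 h3).mono fun n hn => h4 _ hn

theorem eventually_eq_succ_of_endpoint (h : GenericSeq ω₁ ω₂ x y) (hm : 0 < m) {r c : ℝ}
    (hr : 1 ≤ r) (hc : c = 0 ∨ c = 1) :
    ∀ᶠ n in atTop, domNumber r c (fun u : Fin n => x u) y = m + 1 := by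
  refine h.eventually_eq_succ hm hr fun i => ?_
  refine (h.eventually_visits_middle i le_rfl (lo_lt_hi h.inj_y i) le_rfl).mono fun n hn => ?_
  exact hasDominator_of_endpoint (Set.finite_range _) hr hc hn

theorem eventually_eq_two_mul_of_lt_rStar (h : GenericSeq ω₁ ω₂ x y) (hm : 0 < m) {r c : ℝ}
    (hr : 1 ≤ r) (hc : c ∈ Set.Icc (0 : ℝ) 1) (hrc : r < rStar c) :
    ∀ᶠ n in atTop, domNumber r c (fun u : Fin n => x u) y = 2 * m := by
  refine h.eventually_eq_two_mul hm hr fun i => ?_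
  obtain ⟨h1, h2⟩ := (lt_rStar_iff hr).1 hrc
  have hab := lo_lt_hi h.inj_y i
  have h3 : 0 ≤ r * c := mul_nonneg (by linarith) hc.1
  have h4 : 0 ≤ r * (1 - c) := mul_nonneg (by linarith) (by linarith [hc.2])
  filter_upwards [h.eventually_visits_middle i (p := lo y i + r * c * (hi y i - lo y i))
      (q := hi y i) (by nlinarith) (by nlinarith) le_rfl,
    h.eventually_visits_middle i (p := lo y i)
      (q := hi y i - r * (1 - c) * (hi y i - lo y i)) le_rfl (by nlinarith) (by nlinarith)]
    with n ⟨z, hz, hz1, hz2⟩ ⟨w, hw, hw1, hw2⟩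
  exact not_hasDominator hab hr hc ⟨z, hz, ⟨by nlinarith, hz2⟩, hz1⟩
    ⟨w, hw, ⟨hw1, by nlinarith⟩, hw2⟩

/-- Finitely many terms have no influence on the domination number in the long run. -/
theorem eventually_domNumber_shift (h : GenericSeq ω₁ ω₂ x y) (hm : 0 < m) {r c : ℝ}
    (hr : 1 ≤ r) (hM : ∀ k i j, i ≠ j → x k ≠ y i + c * (y j - y i)) (s : ℕ) :
    ∀ᶠ n in atTop, domNumber r c (fun u : Fin (s + n) => x u) y =
      domNumber r c (fun u : Fin n => x (s + u)) y := by
  have h1 := (tendsto_add_atTop_nat s).eventually (h.eventually_domNumber_eq hm c hr)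
  have key : ∀ᶠ n in atTop, ∀ i : Fin (m - 1),
      (HasDominator (Set.range fun u : Fin (s + n) => x u) (lo y i) (hi y i) r c ↔
        HasDominator (Set.range fun u : Fin n => x (s + u)) (lo y i) (hi y i) r c) := by
    rw [eventually_all]
    intro i
    have hs := h.shift s
    set a := lo y i
    set b := hi y i
    -- The two ends of a middle interval are `y`-values with different indices, so `hM` applies.
    have hMi : ∀ k, x k ≠ a + c * (b - a) := fun k => hM k _ _ fun heq => by
      have := (Tuple.sort y).injective heq
      simp [Fin.ext_iff] at this
    -- Later terms eventually provide all neighbours that `hasDominator_union_iff` asks for around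
    -- an early term. The `min` and `max` keep the target intervals inside `(a, b)`, as `c` is not
    -- confined to `[0, 1]` here.
    have hpt : ∀ t : Fin s, ∀ᶠ n in atTop, x t ∈ Set.Ioo a b →
        (∃ w ∈ Set.range (fun u : Fin n => x (s + u)), w ∈ Set.Ioo a (x t)) ∧
        (∃ w ∈ Set.range (fun u : Fin n => x (s + u)), w ∈ Set.Ioo (x t) b) ∧
        (x t < a + c * (b - a) → ∃ w ∈ Set.range (fun u : Fin n => x (s + u)),
          w ∈ Set.Ioo (x t) (min b (a + c * (b - a)))) ∧
        (a + c * (b - a) < x t → ∃ w ∈ Set.range (fun u : Fin n => x (s + u)),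
          w ∈ Set.Ioo (max a (a + c * (b - a))) (x t)) := by
      intro t
      by_cases ht : x t ∈ Set.Ioo a b
      · have e1 := hs.eventually_visits_middle i le_rfl ht.1 ht.2.le
        have e2 := hs.eventually_visits_middle i ht.1.le ht.2 le_rfl
        rcases lt_or_gt_of_ne (hMi t) with hlt | hgt
        · have e3 := hs.eventually_visits_middle i ht.1.le (lt_min ht.2 hlt) (min_le_left _ _)
          filter_upwards [e1, e2, e3] with n n1 n2 n3 _
          exact ⟨n1, n2, fun _ => n3, fun h' => absurd h' (not_lt.2 hlt.le)⟩
        · have e3 := hs.eventually_visits_middle i (le_max_left _ _) (max_lt ht.1 hgt) ht.2.le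
          filter_upwards [e1, e2, e3] with n n1 n2 n3 _
          exact ⟨n1, n2, fun h' => absurd h' (not_lt.2 hgt.le), fun _ => n3⟩
      · exact Eventually.of_forall fun n hn => absurd hn ht
    filter_upwards [eventually_all.2 hpt] with n hn
    have hrange : (Set.range fun u : Fin (s + n) => x u) =
        (Set.range fun u : Fin n => x (s + u)) ∪ Set.range fun t : Fin s => x t := by
      ext z
      constructor
      · rintro ⟨u, rfl⟩
        by_cases hu : (u : ℕ) < s
        · exact Or.inr ⟨⟨u, hu⟩, rfl⟩
        · exact Or.inl ⟨⟨u - s, by have := u.isLt; omega⟩,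
            congrArg x (Nat.add_sub_cancel' (not_lt.1 hu))⟩
      · rintro (⟨u, rfl⟩ | ⟨t, rfl⟩)
        · exact ⟨⟨s + u, by have := u.isLt; omega⟩, rfl⟩
        · exact ⟨⟨t, by have := t.isLt; omega⟩, rfl⟩
    rw [hrange]
    refine hasDominator_union_iff hr ?_
    rintro _ ⟨t, rfl⟩ ht
    exact ⟨hMi t, hn t ht⟩
  filter_upwards [h1, key, (h.shift s).eventually_domNumber_eq hm c hr] with n n1 n2 n3
  rw [add_comm n s] at n1
  rw [n1, n3]
  congr 2
  ext i
  simp only [Finset.mem_filter, n2 i]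

end GenericSeq

/-- Points separated by the points `y` form a digraph without arcs between distinct vertices. -/
theorem domNumber_eq_of_separated {n m : ℕ} {x : Fin n → ℝ} {y : Fin m → ℝ} (r c : ℝ)
    (hxy : ∀ u j, x u ≠ y j) (hsep : ∀ u v, x u < x v → ∃ j, x u < y j ∧ y j < x v)
    (hx : x.Injective) : domNumber r c x y = n := by
  rw [domNumber, dominationNumber_eq_card, Fintype.card_fin]
  intro u v h
  obtain ⟨d, hu, hv⟩ := mem_cellSet_of_mem_proximityRegion y (fun ⟨j, hj⟩ => hxy u j hj.symm) h
  have key : ∀ u v, x u ∈ cellSet y d → x v ∈ cellSet y d → ¬ x u < x v := by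
    intro u v hu hv hlt
    obtain ⟨j, hj1, hj2⟩ := hsep u v hlt
    rcases d with i | _ | _
    · exact not_mem_range_of_mem_middle y i ⟨hu.1.trans hj1, hj2.trans hv.2⟩ ⟨j, rfl⟩
    · exact absurd (hv j) (not_lt.2 hj2.le)
    · exact absurd (hu j) (not_lt.2 hj1.le)
  exact hx (le_antisymm (not_lt.1 (key v u hv hu)) (not_lt.1 (key u v hu hv)))

/-! ### Almost sure properties of independent samples -/

section Samples

variable {Ω : Type*} [MeasurableSpace Ω] {μ : Measure Ω} {E : Type*} [MeasurableSpace E]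

/-- Second Borel-Cantelli lemma: the events are independent with the same positive probability, so
their probabilities sum to infinity. -/
theorem ae_frequently_mem {X : ℕ → Ω → E} {ν : Measure E} (hX : ∀ i, Measurable (X i))
    (hindep : iIndepFun X μ) (hlaw : ∀ i, μ.map (X i) = ν) {S : Set E} (hS : MeasurableSet S)
    (hpos : ν S ≠ 0) : ∀ᵐ ω ∂μ, ∀ N, ∃ k, N ≤ k ∧ X k ω ∈ S := by
  have := hindep.isProbabilityMeasure
  have h1 : iIndepSet (fun k => X k ⁻¹' S) μ := by
    rw [iIndepSet_iff_meas_biInter fun k => hX k hS]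
    intro s
    exact hindep.measure_inter_preimage_eq_mul s fun _ _ => hS
  have h2 : (∑' n, μ (X n ⁻¹' S)) = ⊤ := by
    have : ∀ n, μ (X n ⁻¹' S) = ν S := fun n => by rw [← hlaw n, Measure.map_apply (hX n) hS]
    simp only [this]
    exact ENNReal.tsum_const_eq_top_of_ne_zero hpos
  have h3 := measure_limsup_eq_one (fun n => hX n hS) h1 h2
  have h4 : MeasurableSet (limsup (fun k => X k ⁻¹' S) atTop) :=
    MeasurableSet.measurableSet_limsup fun n => hX n hS
  rw [← prob_compl_eq_zero_iff h4] at h3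
  filter_upwards [measure_eq_zero_iff_ae_notMem.1 h3] with ω hω N
  have := Set.notMem_compl_iff.1 hω
  rw [mem_limsup_iff_frequently_mem] at this
  obtain ⟨k, hk, hk'⟩ := frequently_atTop.1 this N
  exact ⟨k, hk, hk'⟩

/-- By Fubini: the sections of the diagonal are singletons, so it is enough that one of the two laws
is diffuse. -/
theorem ae_ne_of_indepFun [MeasurableSingletonClass E] [MeasurableEq E] {U V : Ω → E}
    [IsProbabilityMeasure μ] (hU : Measurable U)
    (hV : Measurable V) (h : IndepFun U V μ) [NullSingletonClass (μ.map V)] :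
    ∀ᵐ ω ∂μ, U ω ≠ V ω := by
  have h1 := (indepFun_iff_map_prod_eq_prod_map_map hU.aemeasurable hV.aemeasurable).1 h
  have hm : MeasurableSet {z : E × E | z.1 = z.2} := measurableSet_eq_fun measurable_fst measurable_snd
  have h2 : (μ.map fun ω => (U ω, V ω)) {z : E × E | z.1 = z.2} = 0 := by
    rw [h1, Measure.measure_prod_null hm]
    refine Eventually.of_forall fun u => ?_
    have : Prod.mk u ⁻¹' {z : E × E | z.1 = z.2} = {u} := by ext v; simp [eq_comm]
    simp [this]
  rw [Measure.map_apply (hU.prodMk hV) hm] at h2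
  exact measure_eq_zero_iff_ae_notMem.1 h2

theorem ae_injective [MeasurableSingletonClass E] [MeasurableEq E] {ι : Type*} [Countable ι]
    {X : ι → Ω → E} (hX : ∀ i, Measurable (X i)) (hindep : iIndepFun X μ)
    (hlaw : ∀ i, NullSingletonClass (μ.map (X i))) :
    ∀ᵐ ω ∂μ, Function.Injective fun i => X i ω := by
  have := hindep.isProbabilityMeasure
  have h : ∀ i j, ∀ᵐ ω ∂μ, i ≠ j → X i ω ≠ X j ω := by
    intro i j
    by_cases hij : i = j
    · exact Eventually.of_forall fun ω h => absurd hij h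
    · filter_upwards [ae_ne_of_indepFun (hX i) (hX j) (hindep.indepFun hij)] with ω hω _ using hω
  filter_upwards [ae_all_iff.2 fun i => ae_all_iff.2 (h i)] with ω hω i j hij
  by_contra hne
  exact hω i j hne hij

theorem ae_visits {X : ℕ → Ω → ℝ} {ν : Measure ℝ} (hX : ∀ i, Measurable (X i))
    (hindep : iIndepFun X μ) (hlaw : ∀ i, μ.map (X i) = ν) {ω₁ ω₂ : ℝ}
    (hpos : ∀ p q, ω₁ ≤ p → p < q → q ≤ ω₂ → ν (Set.Ioo p q) ≠ 0) :
    ∀ᵐ ω ∂μ, ∀ p q, ω₁ ≤ p → p < q → q ≤ ω₂ → ∀ N, ∃ k, N ≤ k ∧ X k ω ∈ Set.Ioo p q := by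
  have h : ∀ p q : ℚ, ∀ᵐ ω ∂μ, ω₁ ≤ p → (p : ℝ) < q → q ≤ ω₂ →
      ∀ N, ∃ k, N ≤ k ∧ X k ω ∈ Set.Ioo (p : ℝ) q := by
    intro p q
    by_cases hpq : ω₁ ≤ p ∧ (p : ℝ) < q ∧ q ≤ ω₂
    · filter_upwards [ae_frequently_mem hX hindep hlaw measurableSet_Ioo
        (hpos p q hpq.1 hpq.2.1 hpq.2.2)] with ω hω _ _ _ using hω
    · exact Eventually.of_forall fun ω h1 h2 h3 => absurd ⟨h1, h2, h3⟩ hpq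
  filter_upwards [ae_all_iff.2 fun p => ae_all_iff.2 (h p)] with ω hω p q h1 h2 h3 N
  -- Countably many rational intervals suffice, since every `(p, q)` contains one of them.
  obtain ⟨p', hp, hp'⟩ := exists_rat_btwn h2
  obtain ⟨q', hq, hq'⟩ := exists_rat_btwn hp'
  obtain ⟨k, hk, hk'⟩ := hω p' q' (h1.trans hp.le) hq (hq'.le.trans h3) N
  exact ⟨k, hk, hp.trans hk'.1, hk'.2.trans hq'⟩

/-- Finitely many given points are avoided, and an i.i.d. sample of a diffuse law with full support
on `(ω₁, ω₂)` is generic. -/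
theorem ae_genericSeq {X : ℕ → Ω → ℝ} {ν : Measure ℝ} [NullSingletonClass ν]
    (hX : ∀ i, Measurable (X i)) (hindep : iIndepFun X μ) (hlaw : ∀ i, μ.map (X i) = ν) {ω₁ ω₂ : ℝ}
    (hω : ω₁ < ω₂) (hpos : ∀ p q, ω₁ ≤ p → p < q → q ≤ ω₂ → ν (Set.Ioo p q) ≠ 0) {m : ℕ}
    {y : Fin m → ℝ} (hy : y.Injective) (hy' : ∀ j, y j ∈ Set.Ioo ω₁ ω₂) :
    ∀ᵐ ω ∂μ, GenericSeq ω₁ ω₂ (fun k => X k ω) y := by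
  have hne : ∀ᵐ ω ∂μ, ∀ i j, X i ω ≠ y j := by
    rw [ae_all_iff]; intro i
    rw [ae_all_iff]; intro j
    have : μ.map (X i) {y j} = 0 := by rw [hlaw i]; exact measure_singleton _
    rw [Measure.map_apply (hX i) (measurableSet_singleton _)] at this
    exact measure_eq_zero_iff_ae_notMem.1 this
  filter_upwards [hne, ae_visits hX hindep hlaw hpos,
    ae_injective hX hindep fun i => by rw [hlaw i]; infer_instance] with ω h1 h2 h3
  exact ⟨hω, h3, hy, h1, hy', h2⟩

end Samples

/-! ### Measurability -/

/-- The number factors through the adjacency relation, which takes values in a finite space. -/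
theorem measurable_dominationNumber {Ω V : Type*} [MeasurableSpace Ω] [Fintype V]
    {D : Ω → Digraph V} (h : ∀ u v, MeasurableSet {ω | (D ω).Adj u v}) :
    Measurable fun ω => dominationNumber (D ω) := by
  have hadj : Measurable fun ω (u v : V) => (D ω).Adj u v :=
    measurable_pi_lambda _ fun u => measurable_pi_lambda _ fun v => measurable_to_prop (by
      simpa [Set.preimage] using h u v)
  have : (fun ω => dominationNumber (D ω)) =
      (fun A : V → V → Prop => dominationNumber (V := V) ⟨A⟩) ∘ fun ω u v => (D ω).Adj u v := rfl
  rw [this]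
  exact Measurable.comp (measurable_of_finite _) hadj

/-- On each of the finitely many sets where the sorting permutation is constant, an order statistic
is a coordinate. These sets are cut out by comparisons of coordinates, with ties broken by index. -/
theorem measurable_orderStat {m : ℕ} (i : Fin m) : Measurable fun y : Fin m → ℝ => orderStat y i := by
  have hσ : ∀ σ : Equiv.Perm (Fin m), MeasurableSet {y : Fin m → ℝ | Tuple.sort y = σ} := by
    intro σ
    have : {y : Fin m → ℝ | Tuple.sort y = σ} = {y | (∀ i j, i ≤ j → y (σ i) ≤ y (σ j)) ∧
        ∀ i j, i < j → y (σ i) = y (σ j) → σ i < σ j} := by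
      ext y
      rw [Set.mem_ofPred_eq, eq_comm, Tuple.eq_sort_iff]
      rfl
    rw [this]
    measurability
  have h : Measurable fun y : Fin m → ℝ => ∑ σ : Equiv.Perm (Fin m),
      {y : Fin m → ℝ | Tuple.sort y = σ}.indicator (fun y => y (σ i)) y :=
    Finset.measurable_sum _ fun σ _ => (measurable_pi_apply _).indicator (hσ σ)
  convert h with y
  rw [Finset.sum_eq_single (Tuple.sort y)]
  · simp [orderStat]
  · intro σ _ hne
    exact Set.indicator_of_notMem (fun h => hne (Set.mem_ofPred.1 h).symm) _
  · simp

theorem measurableSet_mem_middleRegion {Ω : Type*} [MeasurableSpace Ω] {a b x z : Ω → ℝ}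
    (r c : ℝ) (ha : Measurable a) (hb : Measurable b) (hx : Measurable x) (hz : Measurable z) :
    MeasurableSet {ω | z ω ∈ middleRegion (a ω) (b ω) r c (x ω)} := by
  have : {ω | z ω ∈ middleRegion (a ω) (b ω) r c (x ω)} =
      ({ω | x ω ≤ a ω + c * (b ω - a ω)} ∩ ({ω | a ω < z ω} ∩ {ω | z ω < b ω} ∩
        {ω | z ω < a ω + r * (x ω - a ω)})) ∪
      ({ω | a ω + c * (b ω - a ω) < x ω} ∩ ({ω | a ω < z ω} ∩ {ω | z ω < b ω} ∩
        {ω | b ω - r * (b ω - x ω) < z ω})) := by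
    ext ω
    rcases le_or_gt (x ω) (a ω + c * (b ω - a ω)) with h | h
    · simp [mem_middleRegion_of_le h, h, not_lt.2 h]
    · simp [mem_middleRegion_of_lt h, h, not_le.2 h]
  rw [this]
  have h1 := fun (f g : Ω → ℝ) (hf : Measurable f) (hg : Measurable g) => measurableSet_lt hf hg
  refine ((measurableSet_le hx (by fun_prop)).inter (((h1 _ _ ha hz).inter (h1 _ _ hz hb)).inter
    (h1 _ _ hz (by fun_prop)))).union ((h1 _ _ (by fun_prop) hx).inter
    (((h1 _ _ ha hz).inter (h1 _ _ hz hb)).inter (h1 _ _ (by fun_prop) hz)))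

theorem measurableSet_exists {Ω : Type*} {ι : Sort*} [MeasurableSpace Ω] [Countable ι] {p : ι → Ω → Prop}
    (h : ∀ i, MeasurableSet {ω | p i ω}) : MeasurableSet {ω | ∃ i, p i ω} := by
  convert MeasurableSet.iUnion h using 1
  ext ω
  simp

theorem measurable_domNumber {n m : ℕ} (r c : ℝ) :
    Measurable fun p : (Fin n → ℝ) × (Fin m → ℝ) => domNumber r c p.1 p.2 := by
  refine measurable_dominationNumber fun u v => ?_
  have hx : ∀ u, Measurable fun p : (Fin n → ℝ) × (Fin m → ℝ) => p.1 u := fun u => by fun_prop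
  have hy : ∀ j, Measurable fun p : (Fin n → ℝ) × (Fin m → ℝ) => p.2 j := fun u => by fun_prop
  have ho : ∀ j, Measurable fun p : (Fin n → ℝ) × (Fin m → ℝ) => orderStat p.2 j :=
    fun j => (measurable_orderStat j).comp measurable_snd
  refine MeasurableSet.union ?_ (MeasurableSet.union ?_ (MeasurableSet.union ?_ ?_))
  · refine MeasurableSet.inter ?_ (measurableSet_eq_fun (hx v) (hx u))
    exact measurableSet_exists fun j => measurableSet_eq_fun (hy j) (hx u)
  · refine measurableSet_exists fun i => MeasurableSet.inter ?_
      (measurableSet_mem_middleRegion r c (ho _) (ho _) (hx u) (hx v))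
    exact (measurableSet_lt (ho _) (hx u)).inter (measurableSet_lt (hx u) (ho _))
  · refine measurableSet_exists fun h => ?_
    refine MeasurableSet.inter (measurableSet_lt (hx u) (ho _))
      (MeasurableSet.inter (measurableSet_lt (by have := ho ⟨0, h⟩; fun_prop) (hx v))
        (measurableSet_lt (hx v) (ho _)))
  · refine measurableSet_exists fun h => ?_
    refine MeasurableSet.inter (measurableSet_lt (ho _) (hx u))
      (MeasurableSet.inter (measurableSet_lt (ho _) (hx v))
        (measurableSet_lt (hx v) (by have := ho ⟨m - 1, by omega⟩; fun_prop)))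

theorem measurableSet_hasDominator {ι : Type*} [Countable ι] (a b r c : ℝ) :
    MeasurableSet {x : ι → ℝ | HasDominator (Set.range x) a b r c} := by
  have : {x : ι → ℝ | HasDominator (Set.range x) a b r c} = ⋃ u : ι, {x | x u ∈ Set.Ioo a b} ∩
      ⋂ v : ι, {x | x v ∈ Set.Ioo a b}ᶜ ∪ ({x | x v = x u} ∪
        {x | x v ∈ middleRegion a b r c (x u)}) := by
    ext x
    simp only [HasDominator, Set.mem_ofPred_eq, Set.mem_iUnion, Set.mem_inter_iff, Set.mem_iInter,
      Set.mem_union, Set.mem_compl_iff, Set.mem_range]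
    constructor
    · rintro ⟨_, ⟨⟨u, rfl⟩, hu⟩, h⟩
      exact ⟨u, hu, fun v => or_iff_not_imp_left.2 fun hv => h _ ⟨⟨v, rfl⟩, not_not.1 hv⟩⟩
    · rintro ⟨u, hu, h⟩
      refine ⟨x u, ⟨⟨u, rfl⟩, hu⟩, ?_⟩
      rintro _ ⟨⟨v, rfl⟩, hv⟩
      exact (h v).resolve_left fun h => h hv
  rw [this]
  have hx : ∀ u, Measurable fun x : ι → ℝ => x u := fun u => by fun_prop
  refine MeasurableSet.iUnion fun u => (hx u measurableSet_Ioo).inter (MeasurableSet.iInter fun v =>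
    (hx v measurableSet_Ioo).compl.union ((measurableSet_eq_fun (hx v) (hx u)).union
      (measurableSet_mem_middleRegion r c measurable_const measurable_const (hx u) (hx v))))

/-! ### Independence of the cells of a multinomial split -/

section Split

variable {E L : Type*} [MeasurableSpace E] [Fintype L]

/-- The product over all indices is regrouped by the value of `f`. It is checked on boxes, where it
becomes the regrouping of a finite product. -/
theorem pi_map_fiber {ι : Type*} [Fintype ι] [DecidableEq L] (ν : L → Measure E)
    [∀ l, IsProbabilityMeasure (ν l)] (f : ι → L) :
    (Measure.pi fun l => Measure.pi fun _ : {j // f j = l} => ν l).map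
      (fun w j => w (f j) ⟨j, rfl⟩) = Measure.pi fun j => ν (f j) := by
  symm
  refine Measure.pi_eq fun s hs => ?_
  have hmeas : Measurable fun (w : ∀ l, {j // f j = l} → E) (j : ι) => w (f j) ⟨j, rfl⟩ := by
    fun_prop
  rw [Measure.map_apply hmeas (MeasurableSet.univ_pi hs)]
  have : (fun (w : ∀ l, {j // f j = l} → E) (j : ι) => w (f j) ⟨j, rfl⟩) ⁻¹' Set.univ.pi s =
      Set.univ.pi fun l => Set.univ.pi fun j : {j // f j = l} => s j.1 := by
    ext w
    simp only [Set.mem_preimage, Set.mem_univ_pi, Subtype.forall]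
    exact ⟨fun h l j hj => by subst hj; exact h j, fun h j => h _ j rfl⟩
  rw [this, Measure.pi_pi]
  simp only [Measure.pi_pi]
  rw [← Fintype.prod_fiberwise f fun j => ν (f j) (s j)]
  refine Finset.prod_congr rfl fun l _ => Finset.prod_congr rfl fun j _ => ?_
  rw [j.2]

/-- The range of a sample does not see how the sample is indexed. This allows a fibre of an
assignment to be replaced by `Fin k`. -/
theorem pi_range_congr {ι κ : Type*} [Fintype ι] [Fintype κ] (e : ι ≃ κ) (ν : Measure E)
    [SigmaFinite ν] (P : Set E → Prop) :
    (Measure.pi fun _ : ι => ν) {w | P (Set.range w)} =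
      (Measure.pi fun _ : κ => ν) {w | P (Set.range w)} := by
  rw [← (measurePreserving_piCongrLeft (fun _ : κ => ν) e).measure_preimage_equiv]
  congr 1
  ext w
  have : Set.range (MeasurableEquiv.piCongrLeft (fun _ : κ => E) e w) = Set.range w := by
    rw [← e.surjective.range_comp]
    congr 1
    ext i
    exact Equiv.piCongrLeft_apply_apply (P := fun _ : κ => E) e w i
  change P _ ↔ P _
  rw [this]

variable {ν : Measure E} [IsProbabilityMeasure ν]

theorem pi_cond_box {ι : Type*} [Fintype ι] {S : ι → Set E} (hS : ∀ j, MeasurableSet (S j))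
    (hpos : ∀ j, ν (S j) ≠ 0) :
    (Measure.pi fun _ : ι => ν)[|Set.univ.pi S] = Measure.pi fun j => ν[|S j] := by
  have := fun j => cond_isProbabilityMeasure (hpos j)
  symm
  refine Measure.pi_eq fun s hs => ?_
  rw [cond_apply (MeasurableSet.univ_pi hS), ← Set.pi_inter_distrib, Measure.pi_pi, Measure.pi_pi,
    ENNReal.prod_inv_distrib (fun _ _ _ _ _ => Or.inr (measure_ne_top _ _)),
    ← Finset.prod_mul_distrib]
  exact Finset.prod_congr rfl fun j _ => (cond_apply (hS j) _ _).symm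

/-- Given which cell each sample point lies in, properties of the parts of the sample in the
different cells are independent. -/
theorem pi_inter_box {n : ℕ} [DecidableEq L] {S : L → Set E} (hS : ∀ l, MeasurableSet (S l))
    (hdisj : ∀ l l' x, x ∈ S l → x ∈ S l' → l = l') (hpos : ∀ l, ν (S l) ≠ 0)
    {Q : L → Set E → Prop} (hQ : ∀ l T T', T ∩ S l = T' ∩ S l → (Q l T ↔ Q l T'))
    (hmeas : MeasurableSet {x : Fin n → E | ∀ l, Q l (Set.range x)}) (f : Fin n → L) :
    (Measure.pi fun _ : Fin n => ν)
      (Set.univ.pi (fun j => S (f j)) ∩ {x | ∀ l, Q l (Set.range x)}) =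
    (∏ l, (Measure.pi fun _ : Fin (Fintype.card {j // f j = l}) => ν[|S l]) {w | Q l (Set.range w)})
      * (Measure.pi fun _ : Fin n => ν) (Set.univ.pi fun j => S (f j)) := by
  have := fun l => cond_isProbabilityMeasure (hpos l)
  have hbox : MeasurableSet (Set.univ.pi fun j => S (f j)) := MeasurableSet.univ_pi fun j => hS _
  have hbpos : (Measure.pi fun _ : Fin n => ν) (Set.univ.pi fun j => S (f j)) ≠ 0 := by
    rw [Measure.pi_pi]
    exact Finset.prod_ne_zero_iff.2 fun j _ => hpos _
  rw [← cond_mul_eq_inter hbox, pi_cond_box (fun j => hS _) fun j => hpos _,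
    ← pi_map_fiber (fun l => ν[|S l]) f, Measure.map_apply (by fun_prop) hmeas]
  congr 1
  have h1 : ∀ l, (Measure.pi fun _ : Fin (Fintype.card {j // f j = l}) => ν[|S l])
      {w | Q l (Set.range w)} =
      (Measure.pi fun _ : {j // f j = l} => ν[|S l]) {w | Q l (Set.range w)} := fun l =>
    (pi_range_congr (Fintype.equivFin _) _ _).symm
  simp only [h1]
  rw [← Measure.pi_pi]
  -- Almost surely block `l` stays in `S l`. By disjointness the whole sample meets `S l` exactly in
  -- that block, so `hQ` lets `Q l` be read off from the block alone.
  refine measure_congr ?_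
  have hae : ∀ᵐ w ∂(Measure.pi fun l => Measure.pi fun _ : {j // f j = l} => ν[|S l]),
      ∀ l j, w l j ∈ S l := by
    rw [ae_all_iff]; intro l
    have h2 : ∀ᵐ w ∂(Measure.pi fun _ : {j // f j = l} => ν[|S l]), ∀ j, w j ∈ S l := by
      rw [ae_all_iff]; intro j
      exact (Measure.quasiMeasurePreserving_eval (fun _ : {j // f j = l} => ν[|S l]) j).ae
        (ae_cond_mem (hS l))
    exact (Measure.quasiMeasurePreserving_eval
      (fun l => Measure.pi fun _ : {j // f j = l} => ν[|S l]) l).ae h2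
  filter_upwards [hae] with w hw
  refine propext ?_
  change (∀ l, Q l (Set.range fun j => w (f j) ⟨j, rfl⟩)) ↔ w ∈ Set.univ.pi _
  rw [Set.mem_univ_pi]
  refine forall_congr' fun l => hQ l _ _ ?_
  ext z
  constructor
  · rintro ⟨⟨j, rfl⟩, hz⟩
    have := hdisj _ _ _ hz (hw (f j) ⟨j, rfl⟩)
    subst this
    exact ⟨⟨_, rfl⟩, hz⟩
  · rintro ⟨⟨⟨j, rfl⟩, rfl⟩, hz⟩
    exact ⟨⟨j, rfl⟩, hz⟩

/-- The number of sample points in `S`. -/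
def countIn {n : ℕ} (S : Set E) (x : Fin n → E) : ℕ := ∑ j, S.indicator (fun _ => 1) (x j)

theorem measurable_countIn {n : ℕ} {S : Set E} (hS : MeasurableSet S) :
    Measurable (countIn (n := n) S) :=
  Finset.measurable_sum _ fun j _ => (measurable_const.indicator hS).comp (measurable_pi_apply j)

/-- The formula of `pi_inter_box` is summed over all assignments `f` of points to cells. Its product
depends on `f` only through the fibre sizes, which on the box are the counts, so the sum is an
integral. -/
theorem pi_eq_lintegral_count {n : ℕ} {S : L → Set E} (hS : ∀ l, MeasurableSet (S l))
    (hdisj : ∀ l l' x, x ∈ S l → x ∈ S l' → l = l') (hpos : ∀ l, ν (S l) ≠ 0)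
    (hcov : ∀ᵐ x ∂ν, ∃ l, x ∈ S l)
    {Q : L → Set E → Prop} (hQ : ∀ l T T', T ∩ S l = T' ∩ S l → (Q l T ↔ Q l T'))
    (hmeas : MeasurableSet {x : Fin n → E | ∀ l, Q l (Set.range x)}) :
    (Measure.pi fun _ : Fin n => ν) {x | ∀ l, Q l (Set.range x)} =
    ∫⁻ x, ∏ l, (Measure.pi fun _ : Fin (countIn (S l) x) => ν[|S l]) {w | Q l (Set.range w)}
      ∂(Measure.pi fun _ : Fin n => ν) := by
  classical
  have hbox : ∀ f : Fin n → L, MeasurableSet (Set.univ.pi fun j => S (f j)) := fun f =>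
    MeasurableSet.univ_pi fun j => hS _
  have hd : Pairwise (Function.onFun Disjoint fun f : Fin n → L => Set.univ.pi fun j => S (f j)) := by
    intro f g hfg
    refine Set.disjoint_left.2 fun x hx hx' => hfg (funext fun j => ?_)
    exact hdisj _ _ _ (hx j trivial) (hx' j trivial)
  have hae : ∀ᵐ x ∂(Measure.pi fun _ : Fin n => ν),
      x ∈ ⋃ f : Fin n → L, Set.univ.pi fun j => S (f j) := by
    have : ∀ᵐ x ∂(Measure.pi fun _ : Fin n => ν), ∀ j, ∃ l, x j ∈ S l := by
      rw [ae_all_iff]; intro j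
      exact (Measure.quasiMeasurePreserving_eval (fun _ : Fin n => ν) j).ae hcov
    filter_upwards [this] with x hx
    choose f hf using hx
    exact Set.mem_iUnion.2 ⟨f, fun j _ => hf j⟩
  rw [← Measure.restrict_eq_self_of_ae_mem hae, lintegral_iUnion hbox hd,
    Measure.restrict_apply hmeas, Set.inter_comm, Set.iUnion_inter, measure_iUnion]
  · refine tsum_congr fun f => ?_
    rw [pi_inter_box hS hdisj hpos hQ hmeas f, ← setLIntegral_const]
    refine setLIntegral_congr_fun (hbox f) fun x hx => ?_
    refine Finset.prod_congr rfl fun l _ => ?_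
    have : countIn (S l) x = Fintype.card {j // f j = l} := by
      rw [Fintype.card_subtype, Finset.card_filter, countIn]
      refine Finset.sum_congr rfl fun j _ => ?_
      by_cases h : f j = l
      · rw [if_pos h, Set.indicator_of_mem (h ▸ hx j trivial)]
      · rw [if_neg h, Set.indicator_of_notMem fun h' => h (hdisj _ _ _ (hx j trivial) h')]
    rw [this]
  · exact fun f g hfg => (hd hfg).mono Set.inter_subset_left Set.inter_subset_left
  · exact fun f => (hbox f).inter hmeas

theorem tendsto_countIn {F : Type*} {S : Set F} {x : ℕ → F} (h : ∀ N, ∃ k, N ≤ k ∧ x k ∈ S) :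
    Tendsto (fun n => countIn S fun j : Fin n => x j) atTop atTop := by
  have heq : (fun n => countIn S fun j : Fin n => x j) =
      fun n => ∑ k ∈ Finset.range n, S.indicator (fun _ => 1) (x k) :=
    funext fun n => Fin.sum_univ_eq_sum_range (fun k => S.indicator (fun _ => 1) (x k)) n
  rw [heq]
  have hmono : Monotone fun n => ∑ k ∈ Finset.range n, S.indicator (fun _ => 1) (x k) :=
    fun a b hab => Finset.sum_le_sum_of_subset (Finset.range_mono hab)
  refine tendsto_atTop_atTop_of_monotone hmono fun b => ?_
  induction b with
  | zero => exact ⟨0, Nat.zero_le _⟩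
  | succ b ih =>
    obtain ⟨n, hn⟩ := ih
    obtain ⟨k, hk, hk'⟩ := h n
    refine ⟨k + 1, ?_⟩
    rw [Finset.sum_range_succ, Set.indicator_of_mem hk']
    exact Nat.add_le_add_right (hn.trans (hmono hk)) 1

/-- Places the samples of all sizes on one probability space, so that almost sure statements as `n →
∞` become available. -/
theorem infinitePi_map_fin (n : ℕ) :
    (Measure.infinitePi fun _ : ℕ => ν).map (fun x (j : Fin n) => x j) =
      Measure.pi fun _ : Fin n => ν := by
  rw [Measure.map_infinitePi_infinitePi_of_inj (P := fun _ : ℕ => ν) Fin.val_injective,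
    Measure.infinitePi_eq_pi]

theorem infinitePi_iid : iIndepFun (fun (i : ℕ) (x : ℕ → E) => x i)
    (Measure.infinitePi fun _ : ℕ => ν) ∧
    ∀ i : ℕ, (Measure.infinitePi fun _ : ℕ => ν).map (fun x => x i) = ν :=
  ⟨iIndepFun_infinitePi (X := fun _ x => x) fun _ => measurable_id,
    fun i => Measure.infinitePi_map_eval _ i⟩

/-- Almost surely every count tends to infinity, so the integrand in `pi_eq_lintegral_count`
converges to the constant `∏ l, t l`; dominated convergence applies with bound 1. -/
theorem tendsto_pi_range {S : L → Set E} (hS : ∀ l, MeasurableSet (S l))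
    (hdisj : ∀ l l' x, x ∈ S l → x ∈ S l' → l = l') (hpos : ∀ l, ν (S l) ≠ 0)
    (hcov : ∀ᵐ x ∂ν, ∃ l, x ∈ S l)
    {Q : L → Set E → Prop} (hQ : ∀ l T T', T ∩ S l = T' ∩ S l → (Q l T ↔ Q l T'))
    (hmeas : ∀ n, MeasurableSet {x : Fin n → E | ∀ l, Q l (Set.range x)}) {t : L → ENNReal}
    (ht : ∀ l, Tendsto (fun k : ℕ => (Measure.pi fun _ : Fin k => ν[|S l]) {w | Q l (Set.range w)})
      atTop (𝓝 (t l))) :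
    Tendsto (fun n : ℕ => (Measure.pi fun _ : Fin n => ν) {x | ∀ l, Q l (Set.range x)}) atTop
      (𝓝 (∏ l, t l)) := by
  have hprob := fun l => cond_isProbabilityMeasure (hpos l)
  set θ : L → ℕ → ENNReal := fun l k =>
    (Measure.pi fun _ : Fin k => ν[|S l]) {w | Q l (Set.range w)} with hθ
  have hθ1 : ∀ l k, θ l k ≤ 1 := fun l k => prob_le_one
  have ht1 : ∀ l, t l ≤ 1 := fun l => le_of_tendsto' (ht l) (hθ1 l)
  have hmeasθ : ∀ n, Measurable fun x : Fin n → E => ∏ l, θ l (countIn (S l) x) := fun n =>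
    Finset.measurable_prod _ fun l _ => (measurable_from_top (f := θ l)).comp
      (measurable_countIn (hS l))
  have hrestr : ∀ n, Measurable fun (x : ℕ → E) (j : Fin n) => x j := fun n => by fun_prop
  have heq : (fun n : ℕ => (Measure.pi fun _ : Fin n => ν) {x | ∀ l, Q l (Set.range x)}) =
      fun n => ∫⁻ x, ∏ l, θ l (countIn (S l) fun j : Fin n => x j)
        ∂(Measure.infinitePi fun _ : ℕ => ν) := by
    funext n
    rw [pi_eq_lintegral_count hS hdisj hpos hcov hQ (hmeas n), ← infinitePi_map_fin,
      lintegral_map (hmeasθ n) (hrestr n)]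
  rw [heq]
  have hconst : ∏ l, t l = ∫⁻ _, ∏ l, t l ∂(Measure.infinitePi fun _ : ℕ => ν) := by simp
  rw [hconst]
  refine tendsto_lintegral_of_dominated_convergence (fun _ => 1)
    (fun n => (hmeasθ n).comp (hrestr n)) (fun n => Eventually.of_forall fun x =>
      Finset.prod_le_one' fun l _ => hθ1 l _) (by simp) ?_
  have hae : ∀ᵐ x ∂(Measure.infinitePi fun _ : ℕ => ν), ∀ l, ∀ N, ∃ k, N ≤ k ∧ x k ∈ S l := by
    rw [ae_all_iff]; intro l
    exact ae_frequently_mem (fun i => measurable_pi_apply i) infinitePi_iid.1 infinitePi_iid.2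
      (hS l) (hpos l)
  filter_upwards [hae] with x hx
  exact ENNReal.tendsto_finsetProd_of_ne_top _ (fun l _ => (ht l).comp (tendsto_countIn (hx l)))
    fun l _ => ne_top_of_le_ne_top ENNReal.one_ne_top (ht1 l)

end Split

/-! ### The limit law for fixed points `y` -/

/-- The indicators of the symmetric differences tend to 0 almost everywhere, hence so do their
measures. This turns eventual pathwise agreement into equality of limits. -/
theorem tendsto_measure_of_ae_eventually_iff {Ω : Type*} [MeasurableSpace Ω] {P : Measure Ω}
    [IsFiniteMeasure P] {A B : ℕ → Set Ω} (hA : ∀ n, MeasurableSet (A n))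
    (hB : ∀ n, MeasurableSet (B n)) (h : ∀ᵐ ω ∂P, ∀ᶠ n in atTop, ω ∈ A n ↔ ω ∈ B n) {t : ENNReal}
    (ht : Tendsto (fun n => P (B n)) atTop (𝓝 t)) : Tendsto (fun n => P (A n)) atTop (𝓝 t) := by
  have hΔ : Tendsto (fun n => P (symmDiff (A n) (B n))) atTop (𝓝 0) := by
    rw [← measure_empty (μ := P)]
    refine tendsto_measure_of_ae_tendsto_indicator_of_isFiniteMeasure atTop MeasurableSet.empty
      (fun n => (hA n).symmDiff (hB n)) ?_
    filter_upwards [h] with ω hω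
    filter_upwards [hω] with n hn
    simp [Set.mem_symmDiff, hn]
  have ht' : t ≠ ⊤ := ne_top_of_le_ne_top (measure_ne_top P Set.univ)
    (le_of_tendsto' ht fun n => measure_mono (Set.subset_univ _))
  refine tendsto_of_tendsto_of_tendsto_of_le_of_le
    (by simpa using ENNReal.Tendsto.sub ht hΔ (Or.inl ht')) (by simpa using ht.add hΔ) ?_ ?_
  · intro n
    refine tsub_le_iff_right.2 ((measure_mono ?_).trans (measure_union_le _ _))
    intro ω hω
    by_cases h : ω ∈ A n
    · exact Or.inl h
    · exact Or.inr (Or.inr ⟨hω, h⟩)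
  · intro n
    refine (measure_mono ?_).trans (measure_union_le _ _)
    intro ω hω
    by_cases h : ω ∈ B n
    · exact Or.inl h
    · exact Or.inr (Or.inl ⟨hω, h⟩)

theorem orderStat_pair {a b : ℝ} (hab : a ≤ b) : orderStat ![a, b] = ![a, b] := by
  have : Tuple.sort ![a, b] = Equiv.refl _ := Tuple.sort_eq_refl_iff_monotone.2 (by
    intro i j hij
    fin_cases i <;> fin_cases j <;> simp_all)
  funext i
  simp [orderStat, this]

theorem lo_pair {a b : ℝ} (hab : a ≤ b) (i : Fin (2 - 1)) : lo ![a, b] i = a := by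
  obtain rfl : i = 0 := Fin.ext (by have := i.isLt; simp only [Fin.coe_ofNat_eq_mod]; omega)
  simp only [lo, orderStat_pair hab]
  rfl

theorem hi_pair {a b : ℝ} (hab : a ≤ b) (i : Fin (2 - 1)) : hi ![a, b] i = b := by
  obtain rfl : i = 0 := Fin.ext (by have := i.isLt; simp only [Fin.coe_ofNat_eq_mod]; omega)
  simp only [hi, orderStat_pair hab]
  rfl

/-- Here both end intervals are empty, so `domNumber_eq` does not apply; the cell formula is used
with a single cell instead. -/
theorem domNumber_pair_eq_two_iff {k : ℕ} (hk : 0 < k) {w : Fin k → ℝ} {a b r c : ℝ} (hr : 1 ≤ r)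
    (hw : w.Injective) (hwI : ∀ j, w j ∈ Set.Ioo a b) :
    domNumber r c w ![a, b] = 2 ↔ ¬ HasDominator (Set.range w) a b r c := by
  classical
  have hab : a ≤ b := ((hwI ⟨0, hk⟩).1.trans (hwI ⟨0, hk⟩).2).le
  have h1 := hasDominator_range_iff ![a, b] r c hw 0
  have h2 := fun u => mem_proximityRegion_middle ![a, b] r c (x := w u) 0
    (by rw [lo_pair hab, hi_pair hab]; exact hwI u)
  simp only [lo_pair hab, hi_pair hab] at h1 h2
  simp only [hwI, true_and, true_imp_iff] at h1
  rw [domNumber, dominationNumber_eq_of_cells (digraph r c w ![a, b]) (fun _ => ())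
    (fun _ => ⟨⟨0, hk⟩, rfl⟩) (fun _ _ _ => rfl)]
  · simp only [true_and, true_imp_iff, ← h1]
    by_cases h : HasDominator (Set.range w) a b r c <;> simp [h]
  · intro _
    obtain ⟨u, u', -, -, h⟩ := exists_dominating_pair w (c := c) hr ⟨⟨0, hk⟩, hwI _⟩
    refine ⟨u, u', rfl, rfl, fun v _ => ?_⟩
    rcases h v (hwI v) with h | h | h | h
    · exact Or.inl (hw h)
    · exact Or.inr (Or.inl (hw h))
    · exact Or.inr (Or.inr (Or.inl ((h2 u _).2 h)))
    · exact Or.inr (Or.inr (Or.inr ((h2 u' _).2 h)))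

theorem ae_pi_injective {ι : Type*} [Fintype ι] (ν : Measure ℝ) [IsProbabilityMeasure ν]
    [NullSingletonClass ν] : ∀ᵐ w ∂(Measure.pi fun _ : ι => ν), Function.Injective w :=
  ae_injective (fun i => measurable_pi_apply i)
    (iIndepFun_pi (μ := fun _ : ι => ν) (X := fun _ x => x) fun _ => aemeasurable_id)
    fun i => by rw [(measurePreserving_eval (fun _ : ι => ν) i).map_eq]; infer_instance

/-- The case `k = 0` has to be excluded: an empty sample has domination number 0 and also no
dominating point. -/
theorem probTwo_eq {ν : Measure ℝ} [IsProbabilityMeasure ν] [NullSingletonClass ν] {a b r : ℝ}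
    (c : ℝ) (hr : 1 ≤ r) (hI : ∀ᵐ x ∂ν, x ∈ Set.Ioo a b) {k : ℕ} (hk : 0 < k) :
    probTwo ν a b r c k =
      (Measure.pi fun _ : Fin k => ν).real {w | ¬ HasDominator (Set.range w) a b r c} := by
  refine measureReal_congr ?_
  have : ∀ᵐ w ∂(Measure.pi fun _ : Fin k => ν), ∀ j, w j ∈ Set.Ioo a b := by
    rw [ae_all_iff]; intro j
    exact (Measure.quasiMeasurePreserving_eval (fun _ : Fin k => ν) j).ae hI
  filter_upwards [this, ae_pi_injective ν] with w hw hinj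
  exact propext (domNumber_pair_eq_two_iff hk hr hinj hw)

open Classical in
/-- The limiting probability that exactly the middle intervals in `s` need two points. -/
def patternProb {ι : Type*} (p : ι → unitInterval) (s : Finset ι) (i : ι) : ENNReal :=
  if i ∈ s then ENNReal.ofReal (p i) else ENNReal.ofReal (1 - p i)

open Classical in
theorem bernoulliSumLaw_apply (m : ℕ) (p : Fin (m - 1) → unitInterval) (S : Set ℕ) :
    bernoulliSumLaw m p S = ∑ s ∈ Finset.univ.filter (fun s : Finset (Fin (m - 1)) =>
      m + 1 + s.card ∈ S), ∏ i, patternProb p s i := by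
  have hone : ∀ i, bernoulliMeasure (1 : ℕ) 0 (p i) {1} = ENNReal.ofReal (p i) := fun i => by
    rw [← ENNReal.ofReal_toReal (measure_ne_top (bernoulliMeasure (1 : ℕ) 0 (p i)) {1})]
    congr 1
    simp
  have hzero : ∀ i, bernoulliMeasure (1 : ℕ) 0 (p i) {1}ᶜ = ENNReal.ofReal (1 - p i) := fun i => by
    rw [← ENNReal.ofReal_toReal (measure_ne_top (bernoulliMeasure (1 : ℕ) 0 (p i)) {1}ᶜ)]
    congr 1
    simp
  have hnull : ∀ i, ∀ᵐ B ∂(bernoulliMeasure (1 : ℕ) 0 (p i)), B = 1 ∨ B = 0 := fun i => by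
    simp [ae_iff]
  rw [bernoulliSumLaw, Measure.map_apply (by fun_prop) MeasurableSet.of_discrete]
  set P := Measure.pi fun i => bernoulliMeasure (1 : ℕ) 0 (p i) with hP
  set f : (Fin (m - 1) → ℕ) → Finset (Fin (m - 1)) :=
    fun B => Finset.univ.filter fun i => B i = 1 with hf
  -- With `{1}ᶜ` in place of `{0}` the preimage is exactly a box, without an exceptional null set.
  have hpre : ∀ s, f ⁻¹' {s} = Set.univ.pi fun i => if i ∈ s then {1} else {1}ᶜ := by
    intro s
    ext B
    simp only [Set.mem_preimage, Set.mem_singleton_iff, hf, Finset.ext_iff, Finset.mem_filter,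
      Finset.mem_univ, true_and, Set.mem_univ_pi]
    refine forall_congr' fun i => ?_
    by_cases h : i ∈ s <;> simp [h]
  have hae : (fun B => m + 1 + ∑ i, B i) ⁻¹' S =ᵐ[P]
      f ⁻¹' ↑(Finset.univ.filter (fun s : Finset (Fin (m - 1)) => m + 1 + s.card ∈ S)) := by
    have : ∀ᵐ B ∂P, ∀ i, B i = 1 ∨ B i = 0 := by
      rw [ae_all_iff]; intro i
      exact (Measure.quasiMeasurePreserving_eval
        (fun i => bernoulliMeasure (1 : ℕ) 0 (p i)) i).ae (hnull i)
    filter_upwards [this] with B hB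
    refine propext ?_
    have hsum : ∑ i, B i = (f B).card := by
      rw [hf, Finset.card_filter]
      refine Finset.sum_congr rfl fun i _ => ?_
      rcases hB i with h | h <;> simp [h]
    change m + 1 + ∑ i, B i ∈ S ↔ f B ∈ _
    rw [hsum]
    simp
  rw [measure_congr hae, ← sum_measure_preimage_singleton]
  · refine Finset.sum_congr rfl fun s _ => ?_
    rw [hpre, hP, Measure.pi_pi]
    refine Finset.prod_congr rfl fun i _ => ?_
    by_cases h : i ∈ s
    · simp [patternProb, h, hone]
    · simp [patternProb, h, hzero]
  · intro s _
    exact MeasurableSet.of_discrete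

theorem cellSet_measurable {m : ℕ} (y : Fin m → ℝ) (d : Fin (m - 1) ⊕ Bool) :
    MeasurableSet (cellSet y d) := by
  rcases d with i | _ | _
  · exact measurableSet_Ioo
  · have : cellSet y (.inr false) = ⋂ j, Set.Iio (y j) := by ext; simp [cellSet]
    rw [this]
    exact MeasurableSet.iInter fun j => measurableSet_Iio
  · have : cellSet y (.inr true) = ⋂ j, Set.Ioi (y j) := by ext; simp [cellSet]
    rw [this]
    exact MeasurableSet.iInter fun j => measurableSet_Ioi

theorem measure_cellSet_ne_zero {ν : Measure ℝ} {ω₁ ω₂ : ℝ}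
    (hpos : ∀ p q, ω₁ ≤ p → p < q → q ≤ ω₂ → ν (Set.Ioo p q) ≠ 0) {m : ℕ} (hm : 0 < m)
    {y : Fin m → ℝ} (hy : y.Injective) (hy' : ∀ j, y j ∈ Set.Ioo ω₁ ω₂)
    (d : Fin (m - 1) ⊕ Bool) : ν (cellSet y d) ≠ 0 := by
  have ho : ∀ k, orderStat y k ∈ Set.Ioo ω₁ ω₂ := fun k => hy' _
  rcases d with i | _ | _
  · exact hpos _ _ (ho _).1.le (lo_lt_hi hy i) (ho _).2.le
  · refine ne_of_gt (lt_of_lt_of_le (pos_iff_ne_zero.2 (hpos _ _ le_rfl (ho ⟨0, hm⟩).1 (ho _).2.le))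
      (measure_mono fun x hx => (forall_lt_iff y hm x).2 hx.2))
  · refine ne_of_gt (lt_of_lt_of_le (pos_iff_ne_zero.2 (hpos _ _ (ho ⟨m - 1, by omega⟩).1.le
      (ho _).2 le_rfl)) (measure_mono fun x hx => (forall_gt_iff y hm x).2 hx.1))

theorem hasDominator_congr {A A' : Set ℝ} {a b : ℝ} (r c : ℝ)
    (h : A ∩ Set.Ioo a b = A' ∩ Set.Ioo a b) :
    HasDominator A a b r c ↔ HasDominator A' a b r c := by
  unfold HasDominator
  rw [h]

instance {E : Type*} [MeasurableSpace E] (ν : Measure E) [NullSingletonClass ν] (S : Set E) :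
    NullSingletonClass (ν[|S]) where
  measure_singleton x := cond_absolutelyContinuous (measure_singleton x)

open Classical in
/-- The middle intervals that need two points. -/
def doubleCells {m : ℕ} (r c : ℝ) (y : Fin m → ℝ) (A : Set ℝ) : Finset (Fin (m - 1)) :=
  Finset.univ.filter fun i => ¬ HasDominator A (lo y i) (hi y i) r c

theorem measurable_doubleCells {n m : ℕ} (r c : ℝ) (y : Fin m → ℝ) (s : Finset (Fin (m - 1))) :
    MeasurableSet {x : Fin n → ℝ | doubleCells r c y (Set.range x) = s} := by
  have : {x : Fin n → ℝ | doubleCells r c y (Set.range x) = s} =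
      ⋂ i, {x | ¬ HasDominator (Set.range x) (lo y i) (hi y i) r c ↔ i ∈ s} := by
    ext x
    simp [doubleCells, Finset.ext_iff]
  rw [this]
  refine MeasurableSet.iInter fun i => ?_
  by_cases h : i ∈ s
  · simp only [h, iff_true]
    exact (measurableSet_hasDominator (ι := Fin n) (lo y i) (hi y i) r c).compl
  · simpa [h] using measurableSet_hasDominator (ι := Fin n) (lo y i) (hi y i) r c

theorem tendsto_doubleCells {ν : Measure ℝ} [IsProbabilityMeasure ν] [NullSingletonClass ν]
    {ω₁ ω₂ : ℝ} (hpos : ∀ p q, ω₁ ≤ p → p < q → q ≤ ω₂ → ν (Set.Ioo p q) ≠ 0) {m : ℕ}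
    (hm : 0 < m) {y : Fin m → ℝ} (hy : y.Injective) (hy' : ∀ j, y j ∈ Set.Ioo ω₁ ω₂) {r c : ℝ}
    (hr : 1 ≤ r) {p : Fin (m - 1) → unitInterval} (hp : AreLimitProbs ν r c y p)
    (s : Finset (Fin (m - 1))) :
    Tendsto (fun n : ℕ => (Measure.pi fun _ : Fin n => ν)
      {x | doubleCells r c y (Set.range x) = s}) atTop (𝓝 (∏ i, patternProb p s i)) := by
  classical
  -- The end cells receive a trivial property, so they contribute a factor 1 to the limit.
  set Q : Fin (m - 1) ⊕ Bool → Set ℝ → Prop := fun d A => match d with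
    | .inl i => ¬ HasDominator A (lo y i) (hi y i) r c ↔ i ∈ s
    | .inr _ => True with hQ
  have hset : ∀ n, {x : Fin n → ℝ | doubleCells r c y (Set.range x) = s} =
      {x | ∀ d, Q d (Set.range x)} := by
    intro n
    ext x
    simp [doubleCells, Finset.ext_iff, hQ]
  have hcond : ∀ d, IsProbabilityMeasure (ν[|cellSet y d]) := fun d =>
    cond_isProbabilityMeasure (measure_cellSet_ne_zero hpos hm hy hy' d)
  have ht : ∀ d, Tendsto (fun k : ℕ => (Measure.pi fun _ : Fin k => ν[|cellSet y d])
      {w | Q d (Set.range w)}) atTop (𝓝 (Sum.elim (patternProb p s) (fun _ => 1) d)) := by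
    rintro (i | b)
    · have hc := hcond (.inl i)
      have hIoo : ∀ᵐ x ∂(ν[|cellSet y (.inl i)]), x ∈ Set.Ioo (lo y i) (hi y i) :=
        ae_cond_mem (cellSet_measurable y (.inl i))
      have h1 : Tendsto (fun k : ℕ => (Measure.pi fun _ : Fin k => ν[|cellSet y (.inl i)]).real
          {w | ¬ HasDominator (Set.range w) (lo y i) (hi y i) r c}) atTop (𝓝 (p i : ℝ)) := by
        refine (hp i).congr' ?_
        filter_upwards [eventually_gt_atTop 0] with k hk
        exact probTwo_eq (ν := ν[|cellSet y (.inl i)]) c hr hIoo hk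
      by_cases h : i ∈ s
      · simp only [Sum.elim_inl, patternProb, h, if_true, hQ, iff_true]
        refine (ENNReal.tendsto_ofReal h1).congr fun k => ?_
        rw [measureReal_def, ENNReal.ofReal_toReal (measure_ne_top _ _)]
      · simp only [Sum.elim_inl, patternProb, h, if_false, hQ, iff_false, not_not]
        refine (ENNReal.tendsto_ofReal (h1.const_sub 1)).congr fun k => ?_
        have hm := measurableSet_hasDominator (ι := Fin k) (lo y i) (hi y i) r c
        have h2 := probReal_compl_eq_one_sub
          (μ := Measure.pi fun _ : Fin k => ν[|cellSet y (.inl i)]) hm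
        change _ = (Measure.pi fun _ : Fin k => ν[|cellSet y (.inl i)])
          {w | HasDominator (Set.range w) (lo y i) (hi y i) r c}
        change _ = 1 - _ at h2
        rw [← ENNReal.ofReal_toReal (measure_ne_top (Measure.pi fun _ : Fin k =>
          ν[|cellSet y (.inl i)]) {w | HasDominator (Set.range w) (lo y i) (hi y i) r c})]
        congr 1
        change 1 - (Measure.pi fun _ : Fin k => ν[|cellSet y (.inl i)]).real
          {w | HasDominator (Set.range w) (lo y i) (hi y i) r c}ᶜ = _
        rw [probReal_compl_eq_one_sub hm, sub_sub_cancel]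
        rfl
    · have := hcond (.inr b)
      simp [hQ]
  have hcov : ∀ᵐ x ∂ν, ∃ d, x ∈ cellSet y d := by
    have : ∀ᵐ x ∂ν, x ∉ Set.range y :=
      measure_eq_zero_iff_ae_notMem.1 ((Set.finite_range y).measure_zero ν)
    exact this.mono fun x hx => exists_mem_cellSet hm y hx
  have := tendsto_pi_range (ν := ν) (S := cellSet y) (cellSet_measurable y)
    (fun d d' x => cellSet_unique hm y) (measure_cellSet_ne_zero hpos hm hy hy') hcov (Q := Q) ?_ ?_ ht
  · simpa [hset, Fintype.prod_sum_type] using this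
  · rintro (i | b) A A' hA
    · simp only [hQ, hasDominator_congr r c hA]
    · simp [hQ]
  · intro n
    rw [← hset]
    exact measurable_doubleCells r c y s

/-- Along almost every infinite sample the domination number is eventually `m + 1` plus the number
of double cells, so the joint limit of the double cells determines the law. -/
theorem tendsto_domNumber_law {ν : Measure ℝ} [IsProbabilityMeasure ν] [NullSingletonClass ν]
    {ω₁ ω₂ : ℝ} (hω : ω₁ < ω₂) (hpos : ∀ p q, ω₁ ≤ p → p < q → q ≤ ω₂ → ν (Set.Ioo p q) ≠ 0)
    {m : ℕ} (hm : 0 < m) {y : Fin m → ℝ} (hy : y.Injective) (hy' : ∀ j, y j ∈ Set.Ioo ω₁ ω₂)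
    {r c : ℝ} (hr : 1 ≤ r) {p : Fin (m - 1) → unitInterval} (hp : AreLimitProbs ν r c y p)
    (S : Set ℕ) :
    Tendsto (fun n : ℕ => (Measure.pi fun _ : Fin n => ν) {x | domNumber r c x y ∈ S}) atTop
      (𝓝 (bernoulliSumLaw m p S)) := by
  classical
  set s := Finset.univ.filter (fun s : Finset (Fin (m - 1)) => m + 1 + s.card ∈ S) with hs
  have hrestr : ∀ n, Measurable fun (x : ℕ → ℝ) (j : Fin n) => x j := fun n => by fun_prop
  have hmA : ∀ n, MeasurableSet {x : Fin n → ℝ | domNumber r c x y ∈ S} := fun n =>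
    (measurable_domNumber r c).comp (measurable_id.prodMk measurable_const)
      MeasurableSet.of_discrete
  have hmB : ∀ n, MeasurableSet {x : Fin n → ℝ | doubleCells r c y (Set.range x) ∈ s} := by
    intro n
    have : {x : Fin n → ℝ | doubleCells r c y (Set.range x) ∈ s} =
        ⋃ t ∈ s, {x | doubleCells r c y (Set.range x) = t} := by ext; simp
    rw [this]
    exact Finset.measurableSet_biUnion _ fun t _ => measurable_doubleCells r c y t
  have hB : Tendsto (fun n : ℕ => (Measure.pi fun _ : Fin n => ν)
      {x | doubleCells r c y (Set.range x) ∈ s}) atTop (𝓝 (bernoulliSumLaw m p S)) := by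
    rw [bernoulliSumLaw_apply]
    refine (tendsto_finsetSum s fun t _ =>
      tendsto_doubleCells hpos hm hy hy' hr hp t).congr fun n => ?_
    exact sum_measure_preimage_singleton (μ := Measure.pi fun _ : Fin n => ν) s
      (f := fun x : Fin n → ℝ => doubleCells r c y (Set.range x))
      fun t _ => measurable_doubleCells r c y t
  simp only [← infinitePi_map_fin (ν := ν)] at hB ⊢
  simp only [Measure.map_apply (hrestr _) (hmA _)]
  simp only [Measure.map_apply (hrestr _) (hmB _)] at hB
  refine tendsto_measure_of_ae_eventually_iff (fun n => hrestr n (hmA n))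
    (fun n => hrestr n (hmB n)) ?_ hB
  filter_upwards [ae_genericSeq (fun i => measurable_pi_apply i) (infinitePi_iid (ν := ν)).1
    infinitePi_iid.2 hω hpos hy hy'] with x hx
  filter_upwards [hx.eventually_domNumber_eq hm c hr] with n hn
  change domNumber r c (fun j : Fin n => x j) y ∈ S ↔ doubleCells r c y _ ∈ s
  rw [hn, hs, Finset.mem_filter]
  simp [doubleCells]

/-! ### The marginals of a law in `𝓗(ℝ)` -/

namespace MemH

variable {F : Measure (ℝ × ℝ)} {ω₁ ω₂ : ℝ}

theorem pos_of_isOpen (hF : MemH F ω₁ ω₂) {U : Set (ℝ × ℝ)} (hU : IsOpen U) {z : ℝ × ℝ} (hz : z ∈ U)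
    (hz' : z ∈ Set.Ioo ω₁ ω₂ ×ˢ Set.Ioo ω₁ ω₂) : F U ≠ 0 := by
  have h : z ∈ F.support := by rw [hF.support_eq]; exact subset_closure hz'
  exact ((Measure.mem_support_iff_forall z).1 h U (hU.mem_nhds hz)).ne'

theorem fst_Ioo_ne_zero (hF : MemH F ω₁ ω₂) (p q : ℝ) (h1 : ω₁ ≤ p) (h2 : p < q) (h3 : q ≤ ω₂) :
    F.map Prod.fst (Set.Ioo p q) ≠ 0 := by
  rw [Measure.map_apply measurable_fst measurableSet_Ioo]
  obtain ⟨z, hz⟩ := exists_between h2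
  have hz' : z ∈ Set.Ioo ω₁ ω₂ := ⟨h1.trans_lt hz.1, hz.2.trans_le h3⟩
  exact hF.pos_of_isOpen (isOpen_Ioo.preimage continuous_fst) (z := (z, z)) hz ⟨hz', hz'⟩

theorem snd_Ioo_ne_zero (hF : MemH F ω₁ ω₂) (p q : ℝ) (h1 : ω₁ ≤ p) (h2 : p < q) (h3 : q ≤ ω₂) :
    F.map Prod.snd (Set.Ioo p q) ≠ 0 := by
  rw [Measure.map_apply measurable_snd measurableSet_Ioo]
  obtain ⟨z, hz⟩ := exists_between h2
  have hz' : z ∈ Set.Ioo ω₁ ω₂ := ⟨h1.trans_lt hz.1, hz.2.trans_le h3⟩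
  exact hF.pos_of_isOpen (isOpen_Ioo.preimage continuous_snd) (z := (z, z)) hz ⟨hz', hz'⟩

end MemH

/-! ### Samples of pairs -/

/-- The standing assumptions of the theorem on the random sample. -/
structure IsSample {Ω : Type*} [MeasurableSpace Ω] (μ : Measure Ω) (F : Measure (ℝ × ℝ))
    (X Y : ℕ → Ω → ℝ) : Prop where
  measurable_X : ∀ i, Measurable (X i)
  measurable_Y : ∀ i, Measurable (Y i)
  indep : iIndepFun (fun i ω => (X i ω, Y i ω)) μ
  law : ∀ i, μ.map (fun ω => (X i ω, Y i ω)) = F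

namespace IsSample

variable {Ω : Type*} [MeasurableSpace Ω] {μ : Measure Ω} {F : Measure (ℝ × ℝ)} {ω₁ ω₂ : ℝ}
  {X Y : ℕ → Ω → ℝ}

theorem measurable_pair (h : IsSample μ F X Y) (i : ℕ) : Measurable fun ω => (X i ω, Y i ω) :=
  (h.measurable_X i).prodMk (h.measurable_Y i)

theorem indep_X (h : IsSample μ F X Y) : iIndepFun X μ :=
  h.indep.comp (fun _ => Prod.fst) fun _ => measurable_fst

theorem indep_Y (h : IsSample μ F X Y) : iIndepFun Y μ :=
  h.indep.comp (fun _ => Prod.snd) fun _ => measurable_snd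

theorem law_X (h : IsSample μ F X Y) (i : ℕ) : μ.map (X i) = F.map Prod.fst := by
  rw [← h.law i, Measure.map_map measurable_fst (h.measurable_pair i)]
  rfl

theorem law_Y (h : IsSample μ F X Y) (i : ℕ) : μ.map (Y i) = F.map Prod.snd := by
  rw [← h.law i, Measure.map_map measurable_snd (h.measurable_pair i)]
  rfl

theorem nullSingleton_X (h : IsSample μ F X Y) (hF : MemH F ω₁ ω₂) (i : ℕ) :
    NullSingletonClass (μ.map (X i)) := by rw [h.law_X i]; exact hF.noAtoms_fst

theorem nullSingleton_Y (h : IsSample μ F X Y) (hF : MemH F ω₁ ω₂) (i : ℕ) :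
    NullSingletonClass (μ.map (Y i)) := by rw [h.law_Y i]; exact hF.noAtoms_snd

theorem ae_mem (h : IsSample μ F X Y) (hF : MemH F ω₁ ω₂) :
    ∀ᵐ ω ∂μ, ∀ i, X i ω ∈ Set.Ioo ω₁ ω₂ ∧ Y i ω ∈ Set.Ioo ω₁ ω₂ := by
  rw [ae_all_iff]; intro i
  have h0 := hF.carried
  rw [← h.law i, Measure.map_apply (h.measurable_pair i)
    (measurableSet_Ioo.prod measurableSet_Ioo).compl] at h0
  filter_upwards [measure_eq_zero_iff_ae_notMem.1 h0] with ω hω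
  simpa [and_assoc] using hω

/-- Within one pair `X` and `Y` may be dependent, and only `noCollision` helps; across pairs
independence and a diffuse Y-law suffice. -/
theorem ae_X_ne_Y (h : IsSample μ F X Y) (hF : MemH F ω₁ ω₂) :
    ∀ᵐ ω ∂μ, ∀ i j, X i ω ≠ Y j ω := by
  have := h.indep.isProbabilityMeasure
  rw [ae_all_iff]; intro i
  rw [ae_all_iff]; intro j
  by_cases hij : i = j
  · subst hij
    have h0 := hF.noCollision
    rw [← h.law i, Measure.map_apply (h.measurable_pair i)
      (measurableSet_eq_fun measurable_fst measurable_snd)] at h0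
    exact measure_eq_zero_iff_ae_notMem.1 h0
  · have := h.nullSingleton_Y hF j
    exact ae_ne_of_indepFun (h.measurable_X i) (h.measurable_Y j)
      ((h.indep.indepFun hij).comp measurable_fst measurable_snd)

/-- The equation is solved for a Y-coordinate whose pair is independent of everything else: `Y i` if
`k = j`, and `Y j` otherwise (also for `k = i`). The divisions by `1 - c` and `c` force the end
values of `c` to be treated separately, where `M` is a Y-point. -/
theorem ae_ne_center (h : IsSample μ F X Y) (hF : MemH F ω₁ ω₂) (c : ℝ) :
    ∀ᵐ ω ∂μ, ∀ k i j, i ≠ j → X k ω ≠ Y i ω + c * (Y j ω - Y i ω) := by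
  have := h.indep.isProbabilityMeasure
  have key : ∀ k i j, i ≠ j → ∀ᵐ ω ∂μ, X k ω ≠ Y i ω + c * (Y j ω - Y i ω) := by
    intro k i j hij
    by_cases hc0 : c = 0
    · filter_upwards [h.ae_X_ne_Y hF] with ω hω
      simpa [hc0] using hω k i
    by_cases hc1 : c = 1
    · filter_upwards [h.ae_X_ne_Y hF] with ω hω
      simpa [hc1] using hω k j
    by_cases hkj : k = j
    · subst hkj
      have hn := h.nullSingleton_Y hF i
      have hind : IndepFun (fun ω => (X k ω - c * Y k ω) / (1 - c)) (Y i) μ :=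
        (h.indep.indepFun hij.symm).comp (φ := fun z : ℝ × ℝ => (z.1 - c * z.2) / (1 - c))
          (by fun_prop) measurable_snd
      filter_upwards [ae_ne_of_indepFun (by have := h.measurable_X k; have := h.measurable_Y k; fun_prop) (h.measurable_Y i) hind] with ω hω heq
      refine hω ?_
      rw [div_eq_iff (sub_ne_zero.2 (Ne.symm hc1)), heq]
      ring
    · have hn := h.nullSingleton_Y hF j
      have hind : IndepFun (fun ω => (X k ω - (1 - c) * Y i ω) / c) (Y j) μ :=
        (h.indep.indepFun_prodMk h.measurable_pair k i j hkj hij).comp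
          (φ := fun z : (ℝ × ℝ) × (ℝ × ℝ) => (z.1.1 - (1 - c) * z.2.2) / c)
          (by fun_prop) measurable_snd
      filter_upwards [ae_ne_of_indepFun (by have := h.measurable_X k; have := h.measurable_Y i; fun_prop) (h.measurable_Y j) hind] with ω hω heq
      refine hω ?_
      rw [div_eq_iff hc0, heq]
      ring
  filter_upwards [ae_all_iff.2 fun k => ae_all_iff.2 fun i => ae_all_iff.2 fun j =>
    ae_all_iff.2 (key k i j)] with ω hω
  exact hω

theorem ae_genericSeq (h : IsSample μ F X Y) (hF : MemH F ω₁ ω₂) (m : ℕ) :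
    ∀ᵐ ω ∂μ, GenericSeq ω₁ ω₂ (fun k => X k ω) fun j : Fin m => Y j ω := by
  filter_upwards [h.ae_mem hF, h.ae_X_ne_Y hF,
    ae_injective h.measurable_X h.indep_X (h.nullSingleton_X hF),
    ae_injective h.measurable_Y h.indep_Y (h.nullSingleton_Y hF),
    ae_visits h.measurable_X h.indep_X h.law_X hF.fst_Ioo_ne_zero] with ω h1 h2 h3 h4 h5
  exact ⟨hF.lt, h3, fun i j hij => Fin.ext (h4 hij), fun i j => h2 i j, fun j => (h1 j).2, h5⟩

theorem measurable_gam (h : IsSample μ F X Y) (r c : ℝ) (n m : ℕ) :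
    Measurable (gam X Y r c n m) :=
  (measurable_domNumber r c).comp
    ((measurable_pi_lambda _ fun i : Fin n => h.measurable_X i).prodMk
      (measurable_pi_lambda _ fun j : Fin m => h.measurable_Y j))

theorem tendsto_one (h : IsSample μ F X Y) {r c : ℝ} {m k : ℕ}
    (hk : ∀ᵐ ω ∂μ, ∀ᶠ n in atTop, gam X Y r c n m ω = k) :
    Tendsto (fun n => μ {ω | gam X Y r c n m ω = k}) atTop (𝓝 1) := by
  have := h.indep.isProbabilityMeasure
  rw [← measure_univ (μ := μ)]
  refine tendsto_measure_of_ae_tendsto_indicator_of_isFiniteMeasure atTop MeasurableSet.univ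
    (fun n => h.measurable_gam r c n m (measurableSet_singleton k)) ?_
  filter_upwards [hk] with ω hω
  filter_upwards [hω] with n hn
  simpa using hn

/-- The Y-points eventually enter every gap between two of the `n` distinct X-points. -/
theorem ae_tendsto_card (h : IsSample μ F X Y) (hF : MemH F ω₁ ω₂) (n : ℕ) (r c : ℝ) :
    ∀ᵐ ω ∂μ, Tendsto (fun m => gam X Y r c n m ω) atTop (𝓝 n) := by
  filter_upwards [h.ae_mem hF, h.ae_X_ne_Y hF,
    ae_injective h.measurable_X h.indep_X (h.nullSingleton_X hF),
    ae_visits h.measurable_Y h.indep_Y h.law_Y hF.snd_Ioo_ne_zero] with ω h1 h2 h3 h4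
  have hsep : ∀ᶠ m : ℕ in atTop, ∀ u v : Fin n, X u ω < X v ω →
      ∃ j : Fin m, X u ω < Y j ω ∧ Y j ω < X v ω := by
    rw [eventually_all]; intro u
    rw [eventually_all]; intro v
    by_cases huv : X u ω < X v ω
    · obtain ⟨k, -, hk⟩ := h4 _ _ (h1 u).1.1.le huv (h1 v).1.2.le 0
      filter_upwards [eventually_gt_atTop k] with m hm _ using ⟨⟨k, hm⟩, hk⟩
    · exact Eventually.of_forall fun m h => absurd h huv
  refine tendsto_const_nhds.congr' ?_
  filter_upwards [hsep] with m hm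
  exact (domNumber_eq_of_separated r c (fun u j => h2 u j) hm
    fun i j hij => Fin.ext (h3 hij)).symm

/-! ### Conditional laws -/

/-- The X-sample starts at index `m` because `X i` and `Y i` may be dependent for `i < m`. -/
theorem indepFun_head_tail (h : IsSample μ F X Y) (m n : ℕ) :
    IndepFun (fun ω (j : Fin m) => Y j ω) (fun ω (i : Fin n) => X (m + i) ω) μ := by
  have h1 := h.indep.indepFun_finset (Finset.range m) (Finset.Ico m (m + n))
    (Finset.disjoint_left.2 fun a ha hb => by
      simp only [Finset.mem_range, Finset.mem_Ico] at ha hb; omega) h.measurable_pair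
  exact h1.comp
    (φ := fun (z : Finset.range m → ℝ × ℝ) (j : Fin m) => (z ⟨j, Finset.mem_range.2 j.isLt⟩).2)
    (ψ := fun (z : Finset.Ico m (m + n) → ℝ × ℝ) (i : Fin n) => (z ⟨m + i, Finset.mem_Ico.2 ⟨by omega, by omega⟩⟩).1)
    (by fun_prop) (by fun_prop)

theorem map_tail (h : IsSample μ F X Y) (m n : ℕ) :
    μ.map (fun ω (i : Fin n) => X (m + i) ω) = Measure.pi fun _ => F.map Prod.fst := by
  have := h.indep.isProbabilityMeasure
  have hinj : Function.Injective fun i : Fin n => m + (i : ℕ) := fun i j hij =>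
    Fin.ext (Nat.add_left_cancel hij)
  rw [(iIndepFun_iff_map_fun_eq_pi_map fun i => (h.measurable_X _).aemeasurable).1
    (h.indep_X.precomp hinj)]
  simp only [h.law_X]

theorem condDistrib_tail [IsProbabilityMeasure μ] (h : IsSample μ F X Y)
    (m n : ℕ) :
    ∀ᵐ y ∂(μ.map fun ω (j : Fin m) => Y j ω),
      condDistrib (fun ω (i : Fin n) => X (m + i) ω) (fun ω (j : Fin m) => Y j ω) μ y =
        Measure.pi fun _ => F.map Prod.fst := by
  have hW : Measurable fun ω (j : Fin m) => Y j ω :=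
    measurable_pi_lambda _ fun j => h.measurable_Y j
  have hT : Measurable fun ω (i : Fin n) => X (m + i) ω :=
    measurable_pi_lambda _ fun j => h.measurable_X _
  have : IsProbabilityMeasure (μ.map fun ω (i : Fin n) => X (m + i) ω) :=
    Measure.isProbabilityMeasure_map hT.aemeasurable
  have := condDistrib_ae_eq_of_measure_eq_compProd_of_measurable (μ := μ) hW hT
    (κ := Kernel.const _ (μ.map fun ω (i : Fin n) => X (m + i) ω)) (by
      rw [Measure.compProd_const]
      exact (indepFun_iff_map_prod_eq_prod_map_map hW.aemeasurable hT.aemeasurable).1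
        (h.indepFun_head_tail m n))
  filter_upwards [this] with y hy
  rw [hy, Kernel.const_apply, h.map_tail]

/-- The conditional probabilities given `𝒴_m = y` have the same limit as those for an i.i.d. sample
and fixed points `y`. -/
theorem tendsto_condDistrib [IsProbabilityMeasure μ] (h : IsSample μ F X Y) (hF : MemH F ω₁ ω₂)
    {m : ℕ} (hm : 0 < m) {r c : ℝ} (hr : 1 ≤ r) {p : (Fin m → ℝ) → Fin (m - 1) → unitInterval}
    (hp : ∀ᵐ y ∂(μ.map fun ω (j : Fin m) => Y j ω), AreLimitProbs (F.map Prod.fst) r c y (p y)) :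
    ∀ᵐ y ∂(μ.map fun ω (j : Fin m) => Y j ω), ∀ S : Set ℕ,
      Tendsto (fun n => condDistrib (fun ω => gam X Y r c n m ω) (fun ω (j : Fin m) => Y j ω) μ y S)
        atTop (𝓝 (bernoulliSumLaw m (p y) S)) := by
  have hFp := hF.prob
  have hν : IsProbabilityMeasure (F.map Prod.fst) :=
    Measure.isProbabilityMeasure_map measurable_fst.aemeasurable
  have hνn := hF.noAtoms_fst
  set W : Ω → Fin m → ℝ := fun ω j => Y j ω with hWdef
  have hW : Measurable W := measurable_pi_lambda _ fun j => h.measurable_Y j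
  set Z : Ω → ℕ → ℝ × ℝ := fun ω i => (X i ω, Y i ω) with hZdef
  have hZ : Measurable Z := measurable_pi_lambda _ h.measurable_pair
  set w : (ℕ → ℝ × ℝ) → Fin m → ℝ := fun z j => (z j).2 with hw
  have hwm : Measurable w := by fun_prop
  -- A single conditional law of the whole sequence serves all `n` at once, so that eventual
  -- pathwise statements can be transferred to almost every `y`.
  set ρ := condDistrib Z W μ with hρ
  let g : ℕ → (ℕ → ℝ × ℝ) → ℕ := fun n z => domNumber r c (fun i : Fin n => (z i).1) (w z)
  let t : ∀ n : ℕ, (ℕ → ℝ × ℝ) → Fin n → ℝ := fun n z i => (z (m + i)).1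
  have htm : ∀ n, Measurable (t n) := fun n => by fun_prop
  have hgm : ∀ n, Measurable (g n) := fun n => (measurable_domNumber r c).comp
    ((by fun_prop : Measurable fun (z : ℕ → ℝ × ℝ) (i : Fin n) => (z i).1).prodMk hwm)
  have hg'm : ∀ n, Measurable fun z => domNumber r c (t n z) (w z) := fun n =>
    (measurable_domNumber r c).comp ((htm n).prodMk hwm)
  -- almost sure properties of the whole sequence
  have hmeasW : Measurable fun ω => (W ω, Z ω) := hW.prodMk hZ
  have e1 : ∀ᵐ y ∂(μ.map W), ∀ᵐ z ∂(ρ y), w z = y := by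
    refine Measure.ae_ae_of_ae_compProd (p := fun q : (Fin m → ℝ) × (ℕ → ℝ × ℝ) => w q.2 = q.1) ?_
    rw [hρ, compProd_map_condDistrib hZ.aemeasurable]
    exact (ae_map_iff hmeasW.aemeasurable
      (measurableSet_eq_fun (hwm.comp measurable_snd) measurable_fst)).2
      (Eventually.of_forall fun ω => rfl)
  have e2 : ∀ᵐ y ∂(μ.map W), ∀ᵐ z ∂(ρ y), ∀ᶠ n in atTop,
      g (m + n) z = domNumber r c (t n z) (w z) := by
    refine Measure.ae_ae_of_ae_compProd (p := fun q : (Fin m → ℝ) × (ℕ → ℝ × ℝ) =>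
      ∀ᶠ n in atTop, g (m + n) q.2 = domNumber r c (t n q.2) (w q.2)) ?_
    rw [hρ, compProd_map_condDistrib hZ.aemeasurable]
    refine (ae_map_iff hmeasW.aemeasurable ?_).2 ?_
    · simp only [eventually_atTop]
      refine measurableSet_exists fun N => ?_
      have : {q : (Fin m → ℝ) × (ℕ → ℝ × ℝ) | ∀ n, N ≤ n →
          g (m + n) q.2 = domNumber r c (t n q.2) (w q.2)} = ⋂ n, ⋂ (_ : N ≤ n),
          {q | g (m + n) q.2 = domNumber r c (t n q.2) (w q.2)} := by ext; simp
      change MeasurableSet {q : (Fin m → ℝ) × (ℕ → ℝ × ℝ) | ∀ n, N ≤ n →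
          g (m + n) q.2 = domNumber r c (t n q.2) (w q.2)}
      rw [this]
      exact MeasurableSet.iInter fun n => MeasurableSet.iInter fun _ =>
        measurableSet_eq_fun ((hgm _).comp measurable_snd) ((hg'm n).comp measurable_snd)
    · filter_upwards [h.ae_genericSeq hF m, h.ae_ne_center hF c] with ω h1 h2
      exact h1.eventually_domNumber_shift hm hr
        (fun k i j hij => h2 k i j fun h => hij (Fin.ext h)) m
  have e3 : ∀ᵐ y ∂(μ.map W), ∀ n, (ρ y).map (t n) = Measure.pi fun _ => F.map Prod.fst := by
    rw [ae_all_iff]; intro n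
    filter_upwards [h.condDistrib_tail m n, condDistrib_comp (μ := μ) W hZ.aemeasurable (htm n)]
      with y h1 h2
    rw [← Kernel.map_apply _ (htm n), ← h2]
    exact h1
  have e4 : ∀ᵐ y ∂(μ.map W), ∀ n, condDistrib (fun ω => gam X Y r c n m ω) W μ y =
      (ρ y).map (g n) := by
    rw [ae_all_iff]; intro n
    filter_upwards [condDistrib_comp (μ := μ) W hZ.aemeasurable (hgm n)] with y h2
    rw [← Kernel.map_apply _ (hgm n), ← h2]
    rfl
  have e5 : ∀ᵐ y ∂(μ.map W), y.Injective ∧ ∀ j, y j ∈ Set.Ioo ω₁ ω₂ := by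
    have hms : MeasurableSet {y : Fin m → ℝ | y.Injective ∧ ∀ j, y j ∈ Set.Ioo ω₁ ω₂} := by
      have : {y : Fin m → ℝ | y.Injective ∧ ∀ j, y j ∈ Set.Ioo ω₁ ω₂} =
          (⋂ i, ⋂ j, ⋂ (_ : i ≠ j), {y | y i = y j}ᶜ) ∩ ⋂ j, {y | y j ∈ Set.Ioo ω₁ ω₂} := by
        ext y
        simp only [Set.mem_inter_iff, Set.mem_iInter]
        exact and_congr ⟨fun hy i j hij h => hij (hy h), fun hy i j hij => by
          by_contra hne; exact hy i j hne hij⟩ Iff.rfl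
      rw [this]
      exact (MeasurableSet.iInter fun i => MeasurableSet.iInter fun j => MeasurableSet.iInter
        fun _ => (measurableSet_eq_fun (measurable_pi_apply i) (measurable_pi_apply j)).compl).inter
        (MeasurableSet.iInter fun j => measurable_pi_apply j measurableSet_Ioo)
    refine (ae_map_iff hW.aemeasurable hms).2 ?_
    filter_upwards [h.ae_genericSeq hF m] with ω hω using ⟨hω.inj_y, hω.mem_y⟩
  filter_upwards [e1, e2, e3, e4, e5, hp] with y h1 h2 h3 h4 h5 h6 S
  have hlim := tendsto_domNumber_law hF.lt hF.fst_Ioo_ne_zero hm h5.1 h5.2 hr h6 S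
  have hmS : ∀ n, MeasurableSet {x : Fin n → ℝ | domNumber r c x y ∈ S} := fun n =>
    (measurable_domNumber r c).comp (measurable_id.prodMk measurable_const)
      MeasurableSet.of_discrete
  -- The sample of size `n + m` is compared with its tail of size `n`, which given `y` is i.i.d.
  rw [← tendsto_add_atTop_iff_nat m]
  simp only [← h3, Measure.map_apply (htm _) (hmS _)] at hlim
  simp only [h4, Measure.map_apply (hgm _) MeasurableSet.of_discrete]
  refine tendsto_measure_of_ae_eventually_iff (fun n => hgm _ MeasurableSet.of_discrete)
    (fun n => htm n (hmS n)) ?_ hlim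
  filter_upwards [h1, h2] with z hz1 hz2
  filter_upwards [hz2] with n hn
  change g (n + m) z ∈ S ↔ domNumber r c (t n z) y ∈ S
  rw [add_comm n m, hn, hz1]

theorem convergesToBernoulliSum [IsProbabilityMeasure μ] (h : IsSample μ F X Y)
    (hF : MemH F ω₁ ω₂) {m : ℕ} (hm : 0 < m) {r c : ℝ} (hr : 1 ≤ r)
    {p : (Fin m → ℝ) → Fin (m - 1) → unitInterval}
    (hp : ∀ᵐ y ∂(μ.map fun ω (j : Fin m) => Y j ω), AreLimitProbs (F.map Prod.fst) r c y (p y)) :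
    ConvergesToBernoulliSum μ X Y r c m p := by
  have hW : Measurable fun ω (j : Fin m) => Y j ω :=
    measurable_pi_lambda _ fun j => h.measurable_Y j
  have key := h.tendsto_condDistrib hF hm hr hp
  refine ⟨?_, fun S => ?_⟩
  · filter_upwards [key] with y hy
    -- Portmanteau: convergence on every set is more than the bound for open sets that is needed.
    refine tendsto_of_forall_isOpen_le_liminf' fun G _ => ?_
    exact (hy G).liminf_eq.ge
  · have : IsProbabilityMeasure (μ.map fun ω (j : Fin m) => Y j ω) :=
      Measure.isProbabilityMeasure_map hW.aemeasurable
    have heq : ∀ n, μ {ω | gam X Y r c n m ω ∈ S} =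
        ∫⁻ y, condDistrib (fun ω => gam X Y r c n m ω) (fun ω (j : Fin m) => Y j ω) μ y S
          ∂(μ.map fun ω (j : Fin m) => Y j ω) := by
      intro n
      have h1 := condDistrib_comp_map (μ := μ) hW.aemeasurable
        (h.measurable_gam r c n m).aemeasurable
      rw [← Measure.bind_apply MeasurableSet.of_discrete (Kernel.aemeasurable _), h1,
        Measure.map_apply (h.measurable_gam r c n m) MeasurableSet.of_discrete]
      rfl
    simp only [heq]
    refine tendsto_lintegral_of_dominated_convergence (fun _ => 1)
      (fun n => Kernel.measurable_coe _ MeasurableSet.of_discrete)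
      (fun n => Eventually.of_forall fun y => prob_le_one) (by simp) ?_
    filter_upwards [key] with y hy using hy S

end IsSample

/-! ### Which of two families of small sets is hit first -/

section Race

variable {E : Type*} [MeasurableSpace E] {ν : Measure E} [IsProbabilityMeasure ν]

/-- No sample point satisfies `u < s / n` or `v < t / n`. -/
def survivalSet (u v : E → ℝ) (s t : ℝ) (n : ℕ) : Set (Fin n → E) :=
  Set.univ.pi fun _ => {x | s / n ≤ u x ∧ t / n ≤ v x}

theorem mem_survivalSet {D : Type*} {u v : D → ℝ} {s t : ℝ} {n : ℕ} {x : Fin n → D} :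
    x ∈ survivalSet u v s t n ↔ ∀ k, s / n ≤ u (x k) ∧ t / n ≤ v (x k) := by
  simp [survivalSet]

theorem measurableSet_survivalSet {u v : E → ℝ} (hu : Measurable u) (hv : Measurable v) (s t : ℝ)
    (n : ℕ) : MeasurableSet (survivalSet u v s t n) :=
  MeasurableSet.univ_pi fun _ =>
    (measurableSet_le measurable_const hu).inter (measurableSet_le measurable_const hv)

/-- For large `n` the two events for one point are almost surely disjoint, so the probability is an
`n`-th power of `1 - (β s + α t + o(1)) / n`. -/
theorem tendsto_survival {u v : E → ℝ} (hu : Measurable u) (hv : Measurable v) {α β δ : ℝ}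
    (hδ : 0 < δ) (hdisj : ∀ᵐ x ∂ν, ¬ (u x < δ ∧ v x < δ)) {s t : ℝ}
    (hus : Tendsto (fun n : ℕ => n * ν.real {x | u x < s / n}) atTop (𝓝 (β * s)))
    (hvt : Tendsto (fun n : ℕ => n * ν.real {x | v x < t / n}) atTop (𝓝 (α * t))) :
    Tendsto (fun n : ℕ => (Measure.pi fun _ : Fin n => ν).real (survivalSet u v s t n)) atTop
      (𝓝 (Real.exp (-(β * s + α * t)))) := by
  have hlim : Tendsto (fun n : ℕ => (n : ℝ) * (-(ν.real {x | u x < s / n} + ν.real {x | v x < t / n})))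
      atTop (𝓝 (-(β * s + α * t))) := (hus.add hvt).neg.congr fun n => by ring
  refine (Real.tendsto_one_add_pow_exp_of_tendsto hlim).congr' ?_
  have h0 : ∀ s : ℝ, ∀ᶠ n : ℕ in atTop, s / n < δ := fun s =>
    (tendsto_const_div_atTop_nhds_zero_nat s).eventually (gt_mem_nhds hδ)
  filter_upwards [h0 s, h0 t] with n hs ht
  have hmu : MeasurableSet {x | u x < s / n} := measurableSet_lt hu measurable_const
  have hmv : MeasurableSet {x | v x < t / n} := measurableSet_lt hv measurable_const
  have hunion : ν.real ({x | u x < s / n} ∪ {x | v x < t / n}) =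
      ν.real {x | u x < s / n} + ν.real {x | v x < t / n} := by
    have hae : AEDisjoint ν {x | u x < s / n} {x | v x < t / n} := by
      refine measure_eq_zero_iff_ae_notMem.2 ?_
      filter_upwards [hdisj] with x hx hx'
      exact hx ⟨hx'.1.trans hs, hx'.2.trans ht⟩
    rw [measureReal_def, measure_union₀ hmv.nullMeasurableSet hae,
      ENNReal.toReal_add (measure_ne_top _ _) (measure_ne_top _ _)]
    rfl
  have hcompl : {x | s / n ≤ u x ∧ t / n ≤ v x} = ({x | u x < s / n} ∪ {x | v x < t / n})ᶜ := by
    ext x; simp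
  have hpow : (Measure.pi fun _ : Fin n => ν).real (survivalSet u v s t n) =
      ν.real {x | s / n ≤ u x ∧ t / n ≤ v x} ^ n := by
    simp [survivalSet, measureReal_def, Measure.pi_pi]
  rw [hpow, hcompl, probReal_compl_eq_one_sub (hmu.union hmv), hunion]
  ring

/-- The sum is a lower Riemann-type sum for the integral of `β exp (-(α + β) s)` over the positive
half-line. Its `k`-th term is the limiting probability that the rescaled minimum of `u` lies in `[k
h, (k + 1) h)` while that of `v` is at least `(k + 1) h`. -/
theorem exists_geometric_lower_bound {α β L : ℝ} (hα : 0 < α) (hβ : 0 < β) (hL : L < β / (α + β)) :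
    ∃ h : ℝ, 0 < h ∧ ∃ K : ℕ, L < ∑ k ∈ Finset.range K,
      (Real.exp (-(β * (k * h) + α * ((k + 1) * h))) -
        Real.exp (-(β * ((k + 1) * h) + α * ((k + 1) * h)))) := by
  have hγ : 0 < α + β := by linarith
  have h1 : Tendsto (fun N : ℕ => Real.exp (-((α + β) / N)) * (β / (α + β)) *
      (1 - Real.exp (-((α + β) * N)))) atTop (𝓝 (Real.exp (-0) * (β / (α + β)) * (1 - 0))) := by
    refine Tendsto.mul (Tendsto.mul_const _ ?_) (Tendsto.const_sub _ ?_)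
    · exact (Real.continuous_exp.tendsto _).comp (tendsto_const_div_atTop_nhds_zero_nat _).neg
    · exact Real.tendsto_exp_neg_atTop_nhds_zero.comp
        (tendsto_natCast_atTop_atTop.const_mul_atTop hγ)
  simp only [neg_zero, Real.exp_zero, one_mul, sub_zero, mul_one] at h1
  obtain ⟨N, hN, hN0⟩ := ((h1.eventually (lt_mem_nhds hL)).and (eventually_gt_atTop 0)).exists
  have hN' : (0 : ℝ) < N := by exact_mod_cast hN0
  -- Mesh `1 / N` with `N ^ 2` terms covers `[0, N]`, so mesh and truncation errors vanish together.
  refine ⟨1 / N, by positivity, N ^ 2, hN.trans_le ?_⟩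
  set h : ℝ := 1 / N with hh
  have hhpos : 0 < h := by positivity
  set q := Real.exp (-((α + β) * h)) with hq
  have hq0 : 0 < q := Real.exp_pos _
  have hq1 : q < 1 := by
    rw [hq, Real.exp_lt_one_iff]; nlinarith
  have hterm : ∀ k : ℕ, Real.exp (-(β * (k * h) + α * ((k + 1) * h))) -
      Real.exp (-(β * ((k + 1) * h) + α * ((k + 1) * h))) = q * (Real.exp (β * h) - 1) * q ^ k := by
    intro k
    rw [hq, ← Real.exp_nat_mul, mul_sub, sub_mul, mul_one, ← Real.exp_add, ← Real.exp_add,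
      ← Real.exp_add]
    congr 2 <;> ring
  simp only [hterm]
  rw [← Finset.mul_sum, geom_sum_eq hq1.ne]
  have hqK : q ^ N ^ 2 = Real.exp (-((α + β) * N)) := by
    rw [hq, ← Real.exp_nat_mul]
    congr 1
    rw [hh]; push_cast; field_simp
  have hqe : Real.exp (-((α + β) / N)) = q := by rw [hq, hh]; congr 1; ring
  rw [hqK, hqe]
  have h2 : β * h ≤ Real.exp (β * h) - 1 := by linarith [Real.add_one_le_exp (β * h)]
  have h3 : 1 - q ≤ (α + β) * h := by
    have := Real.add_one_le_exp (-((α + β) * h)); rw [← hq] at this; linarith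
  have h4 : 0 ≤ 1 - Real.exp (-((α + β) * N)) := by
    rw [sub_nonneg, Real.exp_le_one_iff]
    nlinarith
  have h5 : β / (α + β) ≤ (Real.exp (β * h) - 1) / (1 - q) := by
    rw [div_le_div_iff₀ hγ (by linarith)]
    calc β * (1 - q) ≤ β * ((α + β) * h) := by gcongr
      _ = β * h * (α + β) := by ring
      _ ≤ _ := by gcongr
  calc q * (β / (α + β)) * (1 - Real.exp (-((α + β) * N)))
      ≤ q * ((Real.exp (β * h) - 1) / (1 - q)) * (1 - Real.exp (-((α + β) * N))) := by gcongr
    _ = _ := by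
      have : q - 1 ≠ 0 := by linarith
      have : 1 - q ≠ 0 := by linarith
      field_simp
      ring

/-- Time is cut into strips of width `h / n`. The events that `u` is first hit in a given strip,
with `v` not hit before the end of it, are disjoint, and each makes `u` win. -/
theorem race_lower_bound {u v : E → ℝ} (hu : Measurable u) (hv : Measurable v) {α β δ : ℝ}
    (hα : 0 < α) (hβ : 0 < β) (hδ : 0 < δ) (hdisj : ∀ᵐ x ∂ν, ¬ (u x < δ ∧ v x < δ))
    (hus : ∀ s, 0 ≤ s →
      Tendsto (fun n : ℕ => n * ν.real {x | u x < s / n}) atTop (𝓝 (β * s)))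
    (hvt : ∀ t, 0 ≤ t →
      Tendsto (fun n : ℕ => n * ν.real {x | v x < t / n}) atTop (𝓝 (α * t)))
    {L : ℝ} (hL : L < β / (α + β)) :
    ∀ᶠ n : ℕ in atTop, L < (Measure.pi fun _ : Fin n => ν).real
      {x | ∃ j, ∀ k, u (x j) < v (x k)} := by
  obtain ⟨h, hh, K, hK⟩ := exists_geometric_lower_bound hα hβ hL
  have hlim := tendsto_finsetSum (Finset.range K) fun k _ =>
    (tendsto_survival hu hv hδ hdisj (hus (k * h) (by positivity))
      (hvt ((k + 1) * h) (by positivity))).sub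
    (tendsto_survival hu hv hδ hdisj (hus ((k + 1) * h) (by positivity))
      (hvt ((k + 1) * h) (by positivity)))
  filter_upwards [hlim.eventually (lt_mem_nhds hK)] with n hn
  refine hn.trans_le ?_
  have hmono : ∀ {s s' : ℝ}, s ≤ s' → s / n ≤ s' / n := fun h => by gcongr
  have hsub : ∀ k : ℕ, survivalSet u v ((k + 1) * h) ((k + 1) * h) n ⊆
      survivalSet u v (k * h) ((k + 1) * h) n := by
    intro k x hx
    rw [mem_survivalSet] at hx ⊢
    exact fun i => ⟨(hmono (by nlinarith)).trans (hx i).1, (hx i).2⟩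
  have hm := measurableSet_survivalSet (E := E) hu hv
  have hdiff : ∀ k : ℕ, ∀ x ∈ survivalSet u v (k * h) ((k + 1) * h) n \
      survivalSet u v ((k + 1) * h) ((k + 1) * h) n, ∃ j, u (x j) < (k + 1) * h / n := by
    rintro k x ⟨hx1, hx2⟩
    rw [mem_survivalSet] at hx1 hx2
    by_contra! hcon
    exact hx2 fun i => ⟨hcon i, (hx1 i).2⟩
  have hreal : ∀ k : ℕ, (Measure.pi fun _ : Fin n => ν).real (survivalSet u v (k * h) ((k + 1) * h) n)
      - (Measure.pi fun _ : Fin n => ν).real (survivalSet u v ((k + 1) * h) ((k + 1) * h) n) =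
      (Measure.pi fun _ : Fin n => ν).real (survivalSet u v (k * h) ((k + 1) * h) n \
        survivalSet u v ((k + 1) * h) ((k + 1) * h) n) := fun k =>
    (measureReal_sdiff (hsub k) (hm _ _ n)).symm
  simp only [hreal]
  rw [← measureReal_biUnion_finset]
  · refine measureReal_mono ?_
    intro x hx
    obtain ⟨k, -, hk⟩ := Set.mem_iUnion₂.1 hx
    obtain ⟨j, hj⟩ := hdiff k x hk
    exact ⟨j, fun i => hj.trans_le (mem_survivalSet.1 hk.1 i).2⟩
  · have key : ∀ k l : ℕ, k < l → Disjoint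
        (survivalSet u v (k * h) ((k + 1) * h) n \ survivalSet u v ((k + 1) * h) ((k + 1) * h) n)
        (survivalSet u v (l * h) ((l + 1) * h) n \
          survivalSet u v ((l + 1) * h) ((l + 1) * h) n) := by
      intro k l hkl
      refine Set.disjoint_left.2 fun x hx hx' => ?_
      obtain ⟨j, hj⟩ := hdiff k x hx
      have hkl' : (k : ℝ) + 1 ≤ l := by exact_mod_cast hkl
      have := (mem_survivalSet.1 hx'.1 j).1
      exact absurd (hj.trans_le ((hmono (by nlinarith)).trans this)) (lt_irrefl _)
    intro k _ l _ hkl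
    rcases lt_or_gt_of_ne hkl with h' | h'
    · exact key k l h'
    · exact (key l k h').symm
  · exact fun k _ => (hm _ _ n).diff (hm _ _ n)

/-- The upper bound is the lower bound with `u` and `v` exchanged: both cannot win, and the two
limits add up to 1. -/
theorem tendsto_race {u v : E → ℝ} (hu : Measurable u) (hv : Measurable v) {α β δ : ℝ}
    (hα : 0 < α) (hβ : 0 < β) (hδ : 0 < δ) (hdisj : ∀ᵐ x ∂ν, ¬ (u x < δ ∧ v x < δ))
    (hus : ∀ s, 0 ≤ s →
      Tendsto (fun n : ℕ => n * ν.real {x | u x < s / n}) atTop (𝓝 (β * s)))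
    (hvt : ∀ t, 0 ≤ t →
      Tendsto (fun n : ℕ => n * ν.real {x | v x < t / n}) atTop (𝓝 (α * t))) :
    Tendsto (fun n : ℕ => (Measure.pi fun _ : Fin n => ν).real
      {x | ∃ j, ∀ k, u (x j) < v (x k)}) atTop (𝓝 (β / (α + β))) := by
  refine tendsto_order.2 ⟨fun L hL => race_lower_bound hu hv hα hβ hδ hdisj hus hvt hL,
    fun L hL => ?_⟩
  have h1 : 1 - L < α / (β + α) := by
    have : α / (β + α) = 1 - β / (α + β) := by field_simp; ring
    linarith
  have hm : ∀ n : ℕ, MeasurableSet {x : Fin n → E | ∃ j, ∀ k, v (x j) < u (x k)} := fun n =>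
    measurableSet_exists fun j => by
      have : {x : Fin n → E | ∀ k, v (x j) < u (x k)} = ⋂ k, {x | v (x j) < u (x k)} := by
        ext; simp
      rw [this]
      exact MeasurableSet.iInter fun k => measurableSet_lt (by fun_prop) (by fun_prop)
  filter_upwards [race_lower_bound hv hu hβ hα hδ (hdisj.mono fun x hx h => hx ⟨h.2, h.1⟩)
    hvt hus h1] with n hn
  have hle : (Measure.pi fun _ : Fin n => ν).real {x | ∃ j, ∀ k, u (x j) < v (x k)} ≤
      1 - (Measure.pi fun _ : Fin n => ν).real {x | ∃ j, ∀ k, v (x j) < u (x k)} := by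
    rw [← probReal_compl_eq_one_sub (hm n)]
    refine measureReal_mono ?_
    rintro x ⟨j, hj⟩ ⟨i, hi⟩
    exact absurd ((hj i).trans (hi j)) (lt_irrefl _)
  linarith

end Race

/-! ### One-sided densities -/

/-- `ν` has positive finite one-sided densities at `x`. -/
def HasPosDensityAt (ν : Measure ℝ) (x : ℝ) : Prop :=
  ∃ d : ℝ, 0 < d ∧
    Tendsto (fun t => ν.real (Set.Icc (x - t) x) / t) (𝓝[>] 0) (𝓝 d) ∧
    Tendsto (fun t => ν.real (Set.Icc x (x + t)) / t) (𝓝[>] 0) (𝓝 d)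

/-- Lebesgue differentiation along one-sided intervals of the Vitali family; `hU` makes the density
positive almost everywhere on `U`. -/
theorem ae_hasPosDensityAt {ν : Measure ℝ} [IsFiniteMeasure ν] {U : Set ℝ}
    (hac : ν ≪ volume) (hU : volume.restrict U ≪ ν) :
    ∀ᵐ x ∂(volume.restrict U), HasPosDensityAt ν x := by
  have h1 := ae_restrict_of_ae (s := U)
    ((IsUnifLocDoublingMeasure.vitaliFamily (volume : Measure ℝ) 1).ae_tendsto_rnDeriv ν)
  have h2 := ae_restrict_of_ae (s := U) (Measure.rnDeriv_lt_top ν volume)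
  have h3 : ∀ᵐ x ∂(volume.restrict U), 0 < ν.rnDeriv volume x := hU.ae_le (Measure.rnDeriv_pos hac)
  filter_upwards [h1, h2, h3] with x hx hlt hpos
  refine ⟨(ν.rnDeriv volume x).toReal, ENNReal.toReal_pos hpos.ne' hlt.ne, ?_, ?_⟩
  · have hs : Tendsto (fun t : ℝ => x - t) (𝓝[>] 0) (𝓝[<] x) := by
      refine tendsto_nhdsWithin_iff.2 ⟨?_, ?_⟩
      · have : Tendsto (fun t : ℝ => x - t) (𝓝 0) (𝓝 (x - 0)) := tendsto_const_nhds.sub tendsto_id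
        rw [sub_zero] at this
        exact this.mono_left nhdsWithin_le_nhds
      · filter_upwards [self_mem_nhdsWithin] with t ht
        exact sub_lt_self x ht
    refine ((ENNReal.tendsto_toReal hlt.ne).comp
      ((hx.comp (Real.tendsto_Icc_vitaliFamily_left x)).comp hs)).congr' ?_
    filter_upwards [self_mem_nhdsWithin] with t (ht : 0 < t)
    simp [measureReal_def, ht.le]
  · have hs : Tendsto (fun t : ℝ => x + t) (𝓝[>] 0) (𝓝[>] x) := by
      refine tendsto_nhdsWithin_iff.2 ⟨?_, ?_⟩
      · have : Tendsto (fun t : ℝ => x + t) (𝓝 0) (𝓝 (x + 0)) := tendsto_const_nhds.add tendsto_id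
        rw [add_zero] at this
        exact this.mono_left nhdsWithin_le_nhds
      · filter_upwards [self_mem_nhdsWithin] with t ht
        exact lt_add_of_pos_right x ht
    refine ((ENNReal.tendsto_toReal hlt.ne).comp
      ((hx.comp (Real.tendsto_Icc_vitaliFamily_right x)).comp hs)).congr' ?_
    filter_upwards [self_mem_nhdsWithin] with t (ht : 0 < t)
    simp [measureReal_def, ht.le]

theorem tendsto_nat_mul_of_tendsto_div {D : ℝ → ℝ} {β : ℝ} (h0 : D 0 = 0)
    (h : Tendsto (fun t => D t / t) (𝓝[>] 0) (𝓝 β)) {s : ℝ} (hs : 0 ≤ s) :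
    Tendsto (fun n : ℕ => n * D (s / n)) atTop (𝓝 (β * s)) := by
  rcases hs.eq_or_lt with rfl | hs
  · simp [h0]
  have h1 : Tendsto (fun n : ℕ => s / (n : ℝ)) atTop (𝓝[>] 0) := by
    refine tendsto_nhdsWithin_iff.2 ⟨tendsto_const_div_atTop_nhds_zero_nat s, ?_⟩
    filter_upwards [eventually_gt_atTop 0] with n hn
    exact div_pos hs (by exact_mod_cast hn)
  refine ((h.comp h1).mul_const s).congr' ?_
  filter_upwards [eventually_gt_atTop 0] with n hn
  have : (n : ℝ) ≠ 0 := by exact_mod_cast hn.ne'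
  simp only [Function.comp]
  field_simp

/-- Turns a one-sided density of `ν` into a hitting rate for the conditioned law: the slope `r` of
the racing function divides the density, and conditioning divides by the mass of `I`. -/
theorem tendsto_real_div_of_eventuallyEq {E : Type*} [MeasurableSpace E] {ν : Measure E}
    [IsFiniteMeasure ν] {I : Set E} (hI : MeasurableSet I) {A B : ℝ → Set E} {r d : ℝ} (hr : 0 < r)
    (h : ∀ᶠ t in 𝓝[>] (0 : ℝ), (I ∩ A t : Set E) =ᵐ[ν] B (t / r))
    (hB : Tendsto (fun t => ν.real (B t) / t) (𝓝[>] 0) (𝓝 d)) :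
    Tendsto (fun t => (ν[|I]).real (A t) / t) (𝓝[>] 0) (𝓝 ((ν.real I)⁻¹ * (d / r))) := by
  have h1 : Tendsto (fun t : ℝ => t / r) (𝓝[>] 0) (𝓝[>] 0) := by
    refine tendsto_nhdsWithin_iff.2 ⟨?_, ?_⟩
    · have : Tendsto (fun t : ℝ => t / r) (𝓝 0) (𝓝 (0 / r)) := tendsto_id.div_const r
      rw [zero_div] at this
      exact this.mono_left nhdsWithin_le_nhds
    · filter_upwards [self_mem_nhdsWithin] with t (ht : 0 < t)
      exact div_pos ht hr
  refine (((hB.comp h1).div_const r).const_mul (ν.real I)⁻¹).congr' ?_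
  filter_upwards [h] with t ht
  rw [measureReal_def (ν[|I]), cond_apply hI, ENNReal.toReal_mul, ENNReal.toReal_inv, ← measureReal_def,
    ← measureReal_def, measureReal_congr ht]
  simp only [Function.comp]
  field_simp

/-! ### The limit probability in the critical case -/

/-- If, up to samples missing some set `J`, a dominating point exists exactly when `u` wins the race
against `v`, then the limit probability exists and lies in `(0, 1)`. -/
theorem exists_limitProb_of_race {ν : Measure ℝ} [IsProbabilityMeasure ν] [NullSingletonClass ν]
    {a b r c : ℝ} (hr : 1 ≤ r) (hI : ∀ᵐ x ∂ν, x ∈ Set.Ioo a b) {u v : ℝ → ℝ} (hu : Measurable u)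
    (hv : Measurable v) (hu0 : ∀ x ∈ Set.Ioo a b, 0 ≤ u x) (hv0 : ∀ x ∈ Set.Ioo a b, 0 ≤ v x)
    {α β δ : ℝ} (hα : 0 < α) (hβ : 0 < β) (hδ : 0 < δ)
    (hdisj : ∀ x ∈ Set.Ioo a b, ¬ (u x < δ ∧ v x < δ))
    (hut : Tendsto (fun t => ν.real {x | u x < t} / t) (𝓝[>] 0) (𝓝 β))
    (hvt : Tendsto (fun t => ν.real {x | v x < t} / t) (𝓝[>] 0) (𝓝 α))
    {J : Set ℝ} (hJ : MeasurableSet J) (hJpos : ν J ≠ 0)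
    (hiff : ∀ (n : ℕ) (w : Fin n → ℝ), (∀ j, w j ∈ Set.Ioo a b) → (∃ j, w j ∈ J) →
      (HasDominator (Set.range w) a b r c ↔ ∃ j, ∀ k, u (w j) < v (w k))) :
    ∃ p : unitInterval, IsLimitProb ν a b r c p ∧ 0 < p ∧ p < 1 := by
  have hzero : ∀ f : ℝ → ℝ, (∀ x ∈ Set.Ioo a b, 0 ≤ f x) → ν.real {x | f x < 0} = 0 := by
    intro f hf
    rw [measureReal_def, measure_eq_zero_iff_ae_notMem.2, ENNReal.toReal_zero]
    filter_upwards [hI] with x hx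
    exact not_lt.2 (hf x hx)
  have hrace := tendsto_race hu hv hα hβ hδ (hI.mono hdisj)
    (fun s hs => tendsto_nat_mul_of_tendsto_div (hzero u hu0) hut hs)
    (fun s hs => tendsto_nat_mul_of_tendsto_div (hzero v hv0) hvt hs)
  have hq0 : 0 < β / (α + β) := by positivity
  have hq1 : β / (α + β) < 1 := by rw [div_lt_one (by positivity)]; linarith
  -- Two points are needed exactly when `u` loses the race.
  refine ⟨⟨1 - β / (α + β), by linarith, by linarith⟩, ?_, ?_, ?_⟩
  rotate_left
  · exact Subtype.mk_lt_mk.2 (by linarith : (0 : ℝ) < 1 - β / (α + β))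
  · exact Subtype.mk_lt_mk.2 (by linarith : 1 - β / (α + β) < (1 : ℝ))
  have hmA : ∀ n, MeasurableSet {w : Fin n → ℝ | HasDominator (Set.range w) a b r c} := fun n =>
    measurableSet_hasDominator a b r c
  have hmB : ∀ n, MeasurableSet {w : Fin n → ℝ | ∃ j, ∀ k, u (w j) < v (w k)} := fun n =>
    measurableSet_exists fun j => by
      have : {x : Fin n → ℝ | ∀ k, u (x j) < v (x k)} = ⋂ k, {x | u (x j) < v (x k)} := by
        ext; simp
      rw [this]
      exact MeasurableSet.iInter fun k => measurableSet_lt (by fun_prop) (by fun_prop)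
  have hdom : Tendsto (fun n : ℕ => (Measure.pi fun _ : Fin n => ν).real
      {w | HasDominator (Set.range w) a b r c}) atTop (𝓝 (β / (α + β))) := by
    have hrestr : ∀ n, Measurable fun (x : ℕ → ℝ) (j : Fin n) => x j := fun n => by fun_prop
    have h1 := ENNReal.tendsto_ofReal hrace
    simp only [measureReal_def, ENNReal.ofReal_toReal (measure_ne_top _ _)] at h1
    simp only [← infinitePi_map_fin (ν := ν), Measure.map_apply (hrestr _) (hmB _)] at h1
    have h2 := tendsto_measure_of_ae_eventually_iff (fun n => hrestr n (hmA n))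
      (fun n => hrestr n (hmB n)) ?_ h1
    · simp only [← Measure.map_apply (hrestr _) (hmA _), infinitePi_map_fin] at h2
      have h3 := (ENNReal.tendsto_toReal ENNReal.ofReal_ne_top).comp h2
      rwa [ENNReal.toReal_ofReal hq0.le] at h3
    · have hall : ∀ᵐ x ∂(Measure.infinitePi fun _ : ℕ => ν), ∀ i, x i ∈ Set.Ioo a b := by
        rw [ae_all_iff]; intro i
        refine ae_of_ae_map (f := fun x : ℕ → ℝ => x i)
          (measurable_pi_apply i).aemeasurable ?_
        rw [infinitePi_iid.2 i]
        exact hI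
      filter_upwards [hall, ae_frequently_mem (fun i => measurable_pi_apply i)
        (infinitePi_iid (ν := ν)).1 infinitePi_iid.2 hJ hJpos] with x hx hxJ
      obtain ⟨k, -, hk⟩ := hxJ 0
      filter_upwards [eventually_gt_atTop k] with n hn
      exact hiff n (fun j => x j) (fun j => hx j) ⟨⟨k, hn⟩, hk⟩
  refine (hdom.const_sub 1).congr' ?_
  filter_upwards [eventually_gt_atTop 0] with n hn
  rw [probTwo_eq c hr hI hn, ← probReal_compl_eq_one_sub (hmA n)]
  rfl

/-- As `r c = 1`, a left-case point at distance `d` from `M` reaches exactly `b - r d`. The point in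
`J` is out of reach of every right-case candidate. The default value `b - a` prevents points beyond
`M` from winning, because every `b - w k` is smaller. -/
theorem hasDominator_iff_race_left {n : ℕ} {w : Fin n → ℝ} {a b r c : ℝ} (hr : 1 < r)
    (hc : c ∈ Set.Icc (0 : ℝ) 1) (hrc : r * c = 1) (hw : ∀ j, w j ∈ Set.Ioo a b)
    (hJ : ∃ j, w j ∈ Set.Ioo a (b - r * (1 - c) * (b - a))) :
    HasDominator (Set.range w) a b r c ↔
      ∃ j, ∀ k, (if w j ≤ a + c * (b - a) then r * (a + c * (b - a) - w j) else b - a) <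
        b - w k := by
  obtain ⟨j₀, hj₀⟩ := hJ
  have hab : a < b := (hw j₀).1.trans (hw j₀).2
  have hrM : r * (c * (b - a)) = b - a := by rw [← mul_assoc, hrc, one_mul]
  constructor
  · rintro ⟨_, ⟨⟨j, rfl⟩, hj⟩, h⟩
    refine ⟨j, fun k => ?_⟩
    have hjM : w j ≤ a + c * (b - a) := by
      by_contra hcon
      exact absurd (lt_of_dominated_right hab hr.le hc.2 (not_le.1 hcon)
        (h (w j₀) ⟨⟨j₀, rfl⟩, hw j₀⟩)) (not_le.2 hj₀.2)
    rw [if_pos hjM]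
    rcases h (w k) ⟨⟨k, rfl⟩, hw k⟩ with h | h
    · rw [h]; nlinarith [mul_pos (sub_pos.2 hr) (sub_pos.2 hj.1)]
    · have := ((mem_middleRegion_of_le hjM).1 h).2
      nlinarith
  · rintro ⟨j, h⟩
    have hjM : w j ≤ a + c * (b - a) := by
      by_contra hcon
      have := h j
      rw [if_neg hcon] at this
      linarith [(hw j).1]
    refine ⟨w j, ⟨⟨j, rfl⟩, hw j⟩, ?_⟩
    rintro _ ⟨⟨k, rfl⟩, hk⟩
    have := h k
    rw [if_pos hjM] at this
    exact Or.inr ((mem_middleRegion_of_le hjM).2 ⟨hk, by nlinarith⟩)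

theorem hasDominator_iff_race_right {n : ℕ} {w : Fin n → ℝ} {a b r c : ℝ} (hr : 1 < r)
    (hc : c ∈ Set.Icc (0 : ℝ) 1) (hrc : r * (1 - c) = 1) (hw : ∀ j, w j ∈ Set.Ioo a b)
    (hJ : ∃ j, w j ∈ Set.Ioo (a + r * c * (b - a)) b) :
    HasDominator (Set.range w) a b r c ↔
      ∃ j, ∀ k, (if w j ≤ a + c * (b - a) then b - a else r * (w j - (a + c * (b - a)))) <
        w k - a := by
  obtain ⟨j₀, hj₀⟩ := hJ
  have hab : a < b := (hw j₀).1.trans (hw j₀).2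
  have hrM : r * ((1 - c) * (b - a)) = b - a := by rw [← mul_assoc, hrc, one_mul]
  constructor
  · rintro ⟨_, ⟨⟨j, rfl⟩, hj⟩, h⟩
    refine ⟨j, fun k => ?_⟩
    have hjM : ¬ w j ≤ a + c * (b - a) := by
      intro hcon
      exact absurd (lt_of_dominated_left hab hr.le hc.1 hcon
        (h (w j₀) ⟨⟨j₀, rfl⟩, hw j₀⟩)) (not_le.2 hj₀.1)
    rw [if_neg hjM]
    rcases h (w k) ⟨⟨k, rfl⟩, hw k⟩ with h | h
    · rw [h]; nlinarith [mul_pos (sub_pos.2 hr) (sub_pos.2 hj.2)]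
    · have := ((mem_middleRegion_of_lt (not_le.1 hjM)).1 h).2
      nlinarith
  · rintro ⟨j, h⟩
    have hjM : ¬ w j ≤ a + c * (b - a) := by
      intro hcon
      have := h j
      rw [if_pos hcon] at this
      linarith [(hw j).2]
    refine ⟨w j, ⟨⟨j, rfl⟩, hw j⟩, ?_⟩
    rintro _ ⟨⟨k, rfl⟩, hk⟩
    have := h k
    rw [if_neg hjM] at this
    exact Or.inr ((mem_middleRegion_of_lt (not_le.1 hjM)).2 ⟨hk, by nlinarith⟩)

theorem eventually_lt_nhdsGT_zero {δ : ℝ} (hδ : 0 < δ) : ∀ᶠ t in 𝓝[>] (0 : ℝ), 0 < t ∧ t < δ := by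
  filter_upwards [self_mem_nhdsWithin, nhdsWithin_le_nhds (gt_mem_nhds hδ)] with t h1 h2
    using ⟨h1, h2⟩

variable {ν : Measure ℝ} [IsProbabilityMeasure ν] [NullSingletonClass ν] {a b r c : ℝ}

/-- From `r c = 1` and `r < 2` follows `r (1 - c) = r - 1 < 1`, so `J` is a nondegenerate interval
and only left-case points can dominate. -/
theorem exists_limitProb_left (hab : a < b)
    (hpos : ∀ p q, a ≤ p → p < q → q ≤ b → ν (Set.Ioo p q) ≠ 0) (hr : 1 < r) (hr2 : r < 2)
    (hc : c ∈ Set.Ioo (0 : ℝ) 1) (hrc : r * c = 1) (hb : HasPosDensityAt ν b)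
    (hM : HasPosDensityAt ν (a + c * (b - a))) :
    ∃ p : unitInterval, IsLimitProb (ν[|Set.Ioo a b]) a b r c p ∧ 0 < p ∧ p < 1 := by
  have hI0 : ν (Set.Ioo a b) ≠ 0 := hpos a b le_rfl hab le_rfl
  have hcond := cond_isProbabilityMeasure hI0
  have hreal : 0 < ν.real (Set.Ioo a b) := ENNReal.toReal_pos hI0 (measure_ne_top _ _)
  have hd : 0 < b - a := sub_pos.2 hab
  obtain ⟨dM, hdM, hM', -⟩ := hM
  obtain ⟨db, hdb, hb', -⟩ := hb
  set M := a + c * (b - a) with hMdef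
  have hr0 : 0 < r := by linarith
  have haM : a < M := by rw [hMdef]; nlinarith [mul_pos hc.1 hd]
  have hMb : M < b := by rw [hMdef]; nlinarith [mul_pos (sub_pos.2 hc.2) hd]
  have hrM : r * (M - a) = b - a := by
    rw [hMdef, add_sub_cancel_left, ← mul_assoc, hrc, one_mul]
  have hr1c : r * (1 - c) < 1 := by linarith
  have hr1c0 : 0 < r * (1 - c) := mul_pos hr0 (sub_pos.2 hc.2)
  -- The choice `δ = b - M` works since `b - x < b - M` places `x` beyond `M`, where `u` equals `b -
  -- a > δ`. The rate of `u` comes from the density at `M`, that of `v` from the density at `b`.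
  refine exists_limitProb_of_race (ν := ν[|Set.Ioo a b]) hr.le (ae_cond_mem measurableSet_Ioo)
    (u := fun x => if x ≤ M then r * (M - x) else b - a) (v := fun x => b - x)
    (β := (ν.real (Set.Ioo a b))⁻¹ * (dM / r)) (α := (ν.real (Set.Ioo a b))⁻¹ * (db / 1))
    (δ := b - M) (J := Set.Ioo a (b - r * (1 - c) * (b - a)))
    (Measurable.ite measurableSet_Iic (by fun_prop) measurable_const) (by fun_prop) ?_ ?_
    (by positivity) (by positivity) (by linarith) ?_ ?_ ?_ measurableSet_Ioo ?_ ?_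
  · intro x hx
    by_cases h : x ≤ M
    · simp only [h, if_true]; exact mul_nonneg hr0.le (by linarith)
    · simp only [h, if_false]; exact hd.le
  · intro x hx
    linarith [hx.2]
  · rintro x hx ⟨h1, h2⟩
    have h : ¬ x ≤ M := by linarith
    simp only [h, if_false] at h1
    linarith
  · refine tendsto_real_div_of_eventuallyEq (B := fun t => Set.Icc (M - t) M) measurableSet_Ioo
      hr0 ?_ hM'
    filter_upwards [eventually_lt_nhdsGT_zero hd] with t ht
    have hset : Set.Ioo a b ∩ {x | (if x ≤ M then r * (M - x) else b - a) < t} =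
        Set.Ioc (M - t / r) M := by
      ext x
      simp only [Set.mem_inter_iff, Set.mem_Ioo, Set.mem_Ioc]
      change (a < x ∧ x < b) ∧ (if x ≤ M then r * (M - x) else b - a) < t ↔ _
      rw [sub_lt_comm, lt_div_iff₀ hr0, mul_comm _ r]
      by_cases h : x ≤ M
      · rw [if_pos h]
        exact ⟨fun h' => ⟨h'.2, h⟩, fun h' => ⟨⟨by nlinarith, by linarith⟩, h'.1⟩⟩
      · rw [if_neg h]
        exact ⟨fun h' => absurd h'.2 (by linarith), fun h' => absurd h'.2 h⟩
    rw [hset]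
    exact Ioc_ae_eq_Icc
  · refine tendsto_real_div_of_eventuallyEq (B := fun t => Set.Icc (b - t) b) measurableSet_Ioo
      one_pos ?_ hb'
    filter_upwards [eventually_lt_nhdsGT_zero hd] with t ht
    have hset : Set.Ioo a b ∩ {x | b - x < t} = Set.Ioo (b - t / 1) b := by
      ext x
      simp only [Set.mem_inter_iff, Set.mem_Ioo, div_one]
      change (a < x ∧ x < b) ∧ b - x < t ↔ _
      exact ⟨fun h => ⟨by linarith, h.1.2⟩, fun h => ⟨⟨by linarith, h.2⟩, by linarith⟩⟩
    rw [hset]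
    exact Ioo_ae_eq_Icc
  · rw [cond_apply measurableSet_Ioo, Set.inter_eq_self_of_subset_right
      (Set.Ioo_subset_Ioo_right (by nlinarith))]
    exact mul_ne_zero (ENNReal.inv_ne_zero.2 (measure_ne_top _ _))
      (hpos _ _ le_rfl (by nlinarith) (by nlinarith))
  · intro n w hw hJ
    exact hasDominator_iff_race_left hr ⟨hc.1.le, hc.2.le⟩ hrc hw hJ

theorem exists_limitProb_right (hab : a < b)
    (hpos : ∀ p q, a ≤ p → p < q → q ≤ b → ν (Set.Ioo p q) ≠ 0) (hr : 1 < r) (hr2 : r < 2)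
    (hc : c ∈ Set.Ioo (0 : ℝ) 1) (hrc : r * (1 - c) = 1) (ha : HasPosDensityAt ν a)
    (hM : HasPosDensityAt ν (a + c * (b - a))) :
    ∃ p : unitInterval, IsLimitProb (ν[|Set.Ioo a b]) a b r c p ∧ 0 < p ∧ p < 1 := by
  have hI0 : ν (Set.Ioo a b) ≠ 0 := hpos a b le_rfl hab le_rfl
  have hcond := cond_isProbabilityMeasure hI0
  have hreal : 0 < ν.real (Set.Ioo a b) := ENNReal.toReal_pos hI0 (measure_ne_top _ _)
  have hd : 0 < b - a := sub_pos.2 hab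
  obtain ⟨dM, hdM, -, hM'⟩ := hM
  obtain ⟨da, hda, -, ha'⟩ := ha
  set M := a + c * (b - a) with hMdef
  have hr0 : 0 < r := by linarith
  have haM : a < M := by rw [hMdef]; nlinarith [mul_pos hc.1 hd]
  have hMb : M < b := by rw [hMdef]; nlinarith [mul_pos (sub_pos.2 hc.2) hd]
  have hrM : r * (b - M) = b - a := by
    rw [hMdef]; linear_combination (b - a) * hrc
  have hr1c : r * c < 1 := by linarith
  have hr1c0 : 0 < r * c := mul_pos hr0 hc.1
  refine exists_limitProb_of_race (ν := ν[|Set.Ioo a b]) hr.le (ae_cond_mem measurableSet_Ioo)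
    (u := fun x => if x ≤ M then b - a else r * (x - M)) (v := fun x => x - a)
    (β := (ν.real (Set.Ioo a b))⁻¹ * (dM / r)) (α := (ν.real (Set.Ioo a b))⁻¹ * (da / 1))
    (δ := M - a) (J := Set.Ioo (a + r * c * (b - a)) b)
    (Measurable.ite measurableSet_Iic measurable_const (by fun_prop)) (by fun_prop) ?_ ?_
    (by positivity) (by positivity) (by linarith) ?_ ?_ ?_ measurableSet_Ioo ?_ ?_
  · intro x hx
    by_cases h : x ≤ M
    · simp only [h, if_true]; exact hd.le
    · simp only [h, if_false]; exact mul_nonneg hr0.le (by linarith)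
  · intro x hx
    linarith [hx.1]
  · rintro x hx ⟨h1, h2⟩
    have h : x ≤ M := by linarith
    simp only [h, if_true] at h1
    linarith
  · refine tendsto_real_div_of_eventuallyEq (B := fun t => Set.Icc M (M + t)) measurableSet_Ioo
      hr0 ?_ hM'
    filter_upwards [eventually_lt_nhdsGT_zero hd] with t ht
    have hset : Set.Ioo a b ∩ {x | (if x ≤ M then b - a else r * (x - M)) < t} =
        Set.Ioo M (M + t / r) := by
      ext x
      simp only [Set.mem_inter_iff, Set.mem_Ioo]
      change (a < x ∧ x < b) ∧ (if x ≤ M then b - a else r * (x - M)) < t ↔ _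
      rw [← sub_lt_iff_lt_add', lt_div_iff₀ hr0, mul_comm _ r]
      by_cases h : x ≤ M
      · rw [if_pos h]
        exact ⟨fun h' => absurd h'.2 (by linarith), fun h' => absurd h'.1 (not_lt.2 h)⟩
      · rw [if_neg h]
        exact ⟨fun h' => ⟨not_le.1 h, h'.2⟩, fun h' => ⟨⟨by linarith, by nlinarith⟩, h'.2⟩⟩
    rw [hset]
    exact Ioo_ae_eq_Icc
  · refine tendsto_real_div_of_eventuallyEq (B := fun t => Set.Icc a (a + t)) measurableSet_Ioo
      one_pos ?_ ha'
    filter_upwards [eventually_lt_nhdsGT_zero hd] with t ht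
    have hset : Set.Ioo a b ∩ {x | x - a < t} = Set.Ioo a (a + t / 1) := by
      ext x
      simp only [Set.mem_inter_iff, Set.mem_Ioo, div_one]
      change (a < x ∧ x < b) ∧ x - a < t ↔ _
      exact ⟨fun h => ⟨h.1.1, by linarith⟩, fun h => ⟨⟨h.1, by linarith⟩, by linarith⟩⟩
    rw [hset]
    exact Ioo_ae_eq_Icc
  · rw [cond_apply measurableSet_Ioo, Set.inter_eq_self_of_subset_right
      (Set.Ioo_subset_Ioo_left (by nlinarith))]
    exact mul_ne_zero (ENNReal.inv_ne_zero.2 (measure_ne_top _ _))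
      (hpos _ _ (by nlinarith) (by nlinarith) le_rfl)
  · intro n w hw hJ
    exact hasDominator_iff_race_right hr ⟨hc.1.le, hc.2.le⟩ hrc hw hJ

theorem exists_limitProb_critical (hab : a < b)
    (hpos : ∀ p q, a ≤ p → p < q → q ≤ b → ν (Set.Ioo p q) ≠ 0) (hr2 : r < 2)
    (hc : c ∈ Set.Ioo (0 : ℝ) 1) (hrc : r = rStar c) (ha : HasPosDensityAt ν a)
    (hb : HasPosDensityAt ν b) (hM : HasPosDensityAt ν (a + c * (b - a))) :
    ∃ p : unitInterval, IsLimitProb (ν[|Set.Ioo a b]) a b r c p ∧ 0 < p ∧ p < 1 := by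
  have hc' : 0 < 1 - c := sub_pos.2 hc.2
  rcases le_total (1 - c) c with h | h
  · have h1 : r * c = 1 := by
      rw [hrc, rStar, max_eq_left h, div_mul_cancel₀ _ hc.1.ne']
    exact exists_limitProb_left hab hpos (by nlinarith [hc.1, hc.2]) hr2 hc h1 hb hM
  · have h1 : r * (1 - c) = 1 := by
      rw [hrc, rStar, max_eq_right h, div_mul_cancel₀ _ hc'.ne']
    exact exists_limitProb_right hab hpos (by nlinarith [hc.1, hc.2]) hr2 hc h1 ha hM

/-! ### Almost every realization in the critical case -/

/-- For a fixed first coordinate the map is affine in the second with slope `c ≠ 0`, so it pulls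
null sets back to null sets. Convexity keeps the value in `U`, and measurable hulls are used because
`P` need not be measurable. -/
theorem ae_prod_affine {P : ℝ → Prop} {U : Set ℝ} (hU : Convex ℝ U)
    (hP : ∀ᵐ x ∂(volume.restrict U), P x) {κ : Measure ℝ} [SFinite κ] (hκ : κ ≪ volume)
    (hκU : ∀ᵐ x ∂κ, x ∈ U) {c : ℝ} (hc : c ∈ Set.Ioo (0 : ℝ) 1) :
    ∀ᵐ q ∂(κ.prod κ), P (q.1 + c * (q.2 - q.1)) := by
  set N := toMeasurable (volume.restrict U) {x | ¬ P x} with hN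
  have hN0 : volume.restrict U N = 0 := by rw [hN, measure_toMeasurable]; exact hP
  have hNm : MeasurableSet N := measurableSet_toMeasurable _ _
  have hNU : volume (N ∩ U) = 0 := by
    rwa [Measure.restrict_apply hNm] at hN0
  set T := toMeasurable volume (N ∩ U) with hT
  have hT0 : volume T = 0 := by rw [hT, measure_toMeasurable]; exact hNU
  have hTm : MeasurableSet T := measurableSet_toMeasurable _ _
  have hf : Measurable fun q : ℝ × ℝ => q.1 + c * (q.2 - q.1) := by fun_prop
  have h1 : (κ.prod κ) ((fun q : ℝ × ℝ => q.1 + c * (q.2 - q.1)) ⁻¹' T) = 0 := by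
    rw [Measure.measure_prod_null (hf hTm)]
    refine Eventually.of_forall fun x => hκ ?_
    have : Prod.mk x ⁻¹' ((fun q : ℝ × ℝ => q.1 + c * (q.2 - q.1)) ⁻¹' T) =
        (fun y => c * y) ⁻¹' ((fun y => (1 - c) * x + y) ⁻¹' T) := by
      ext y
      simp only [Set.mem_preimage]
      ring_nf
    rw [this, Real.volume_preimage_mul_left hc.1.ne', measure_preimage_add, hT0, mul_zero]
  have h2 : ∀ᵐ q ∂(κ.prod κ), q.1 ∈ U := Measure.quasiMeasurePreserving_fst.ae hκU
  have h3 : ∀ᵐ q ∂(κ.prod κ), q.2 ∈ U := Measure.quasiMeasurePreserving_snd.ae hκU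
  filter_upwards [measure_eq_zero_iff_ae_notMem.1 h1, h2, h3] with q hq hq1 hq2
  have hmem : q.1 + c * (q.2 - q.1) ∈ U := by
    have := hU hq1 hq2 (sub_nonneg.2 hc.2.le) hc.1.le (by ring)
    simp only [smul_eq_mul] at this
    convert this using 1
    ring
  by_contra hcon
  exact hq (subset_toMeasurable _ _ ⟨subset_toMeasurable _ _ hcon, hmem⟩)

namespace IsSample

variable {Ω : Type*} [MeasurableSpace Ω] {μ : Measure Ω} [IsProbabilityMeasure μ]
  {F : Measure (ℝ × ℝ)} {ω₁ ω₂ : ℝ} {X Y : ℕ → Ω → ℝ}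

/-- Positive densities are needed at the Y-points and at the points `M`. The law of `Y` is
absolutely continuous, so the exceptional null set is avoided by the former directly and by the
latter through `ae_prod_affine`. -/
theorem ae_exists_limitProbs (h : IsSample μ F X Y) (hF : MemH F ω₁ ω₂) (m : ℕ) {r c : ℝ}
    (hr2 : r < 2) (hc : c ∈ Set.Ioo (0 : ℝ) 1) (hrc : r = rStar c)
    (hXac : F.map Prod.fst ≪ volume) (hYac : F.map Prod.snd ≪ volume)
    (hac : volume.restrict (Set.Ioo ω₁ ω₂) ≪ F.map Prod.fst) :
    ∀ᵐ y ∂(μ.map fun ω (j : Fin m) => Y j ω), ∃ p : Fin (m - 1) → unitInterval,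
      AreLimitProbs (F.map Prod.fst) r c y p ∧ ∀ i, 0 < p i ∧ p i < 1 := by
  have hFp := hF.prob
  have hν : IsProbabilityMeasure (F.map Prod.fst) :=
    Measure.isProbabilityMeasure_map measurable_fst.aemeasurable
  have hνn := hF.noAtoms_fst
  have hκ : IsProbabilityMeasure (F.map Prod.snd) :=
    Measure.isProbabilityMeasure_map measurable_snd.aemeasurable
  have hW : Measurable fun ω (j : Fin m) => Y j ω :=
    measurable_pi_lambda _ fun j => h.measurable_Y j
  have hdens := ae_hasPosDensityAt (ν := F.map Prod.fst) hXac hac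
  have hlawY : ∀ j : Fin m, (μ.map fun ω (j : Fin m) => Y j ω).map (fun y => y j) =
      F.map Prod.snd := fun j => by
    rw [Measure.map_map (measurable_pi_apply j) hW, ← h.law_Y j]
    rfl
  have hYU : ∀ᵐ x ∂(F.map Prod.snd), x ∈ Set.Ioo ω₁ ω₂ := by
    rw [← h.law_Y 0]
    refine (ae_map_iff (h.measurable_Y 0).aemeasurable measurableSet_Ioo).2 ?_
    filter_upwards [h.ae_mem hF] with ω hω using (hω 0).2
  have hYdens : ∀ᵐ x ∂(F.map Prod.snd), HasPosDensityAt (F.map Prod.fst) x := by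
    filter_upwards [hYac.ae_le ((ae_restrict_iff' measurableSet_Ioo).1 hdens), hYU] with x h1 h2
      using h1 h2
  have e1 : ∀ᵐ y ∂(μ.map fun ω (j : Fin m) => Y j ω),
      ∀ j, HasPosDensityAt (F.map Prod.fst) (y j) ∧ y j ∈ Set.Ioo ω₁ ω₂ := by
    rw [ae_all_iff]; intro j
    exact ae_of_ae_map (μ := μ.map fun ω (j : Fin m) => Y j ω) (f := fun y : Fin m → ℝ => y j)
      (p := fun x => HasPosDensityAt (F.map Prod.fst) x ∧ x ∈ Set.Ioo ω₁ ω₂)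
      (measurable_pi_apply j).aemeasurable (by rw [hlawY j]; exact hYdens.and hYU)
  have e2 : ∀ᵐ y ∂(μ.map fun ω (j : Fin m) => Y j ω), ∀ i j, i ≠ j →
      HasPosDensityAt (F.map Prod.fst) (y i + c * (y j - y i)) ∧ y i ≠ y j := by
    rw [ae_all_iff]; intro i
    rw [ae_all_iff]; intro j
    by_cases hij : i = j
    · exact Eventually.of_forall fun y hne => absurd hij hne
    have hprod : (μ.map fun ω (j : Fin m) => Y j ω).map (fun y => (y i, y j)) =
        (F.map Prod.snd).prod (F.map Prod.snd) := by
      rw [Measure.map_map ((measurable_pi_apply i).prodMk (measurable_pi_apply j)) hW]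
      have := (indepFun_iff_map_prod_eq_prod_map_map (h.measurable_Y i).aemeasurable
        (h.measurable_Y j).aemeasurable).1 (h.indep_Y.indepFun fun h => hij (Fin.ext h))
      rw [h.law_Y, h.law_Y] at this
      exact this
    have hne : ∀ᵐ q ∂((F.map Prod.snd).prod (F.map Prod.snd)), q.1 ≠ q.2 := by
      have := hF.noAtoms_snd
      refine measure_eq_zero_iff_ae_notMem.1
        ((Measure.measure_prod_null (measurableSet_eq_fun measurable_fst measurable_snd)).2 ?_)
      refine Eventually.of_forall fun u => ?_
      have : Prod.mk u ⁻¹' {z : ℝ × ℝ | z.1 = z.2} = {u} := by ext v; simp [eq_comm]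
      change (F.map Prod.snd) (Prod.mk u ⁻¹' {z : ℝ × ℝ | z.1 = z.2}) = 0
      rw [this]
      exact measure_singleton u
    have := ae_of_ae_map (μ := μ.map fun ω (j : Fin m) => Y j ω)
      (f := fun y : Fin m → ℝ => (y i, y j))
      (p := fun q => HasPosDensityAt (F.map Prod.fst) (q.1 + c * (q.2 - q.1)) ∧ q.1 ≠ q.2)
      ((measurable_pi_apply i).prodMk (measurable_pi_apply j)).aemeasurable (by
        rw [hprod]
        exact (ae_prod_affine (convex_Ioo _ _) hdens hYac hYU hc).and hne)
    exact this.mono fun y hy _ => hy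
  filter_upwards [e1, e2] with y h1 h2
  have hinj : y.Injective := fun i j hij => by
    by_contra hne
    exact (h2 i j hne).2 hij
  have key : ∀ i : Fin (m - 1), ∃ p : unitInterval,
      IsLimitProb ((F.map Prod.fst)[|Set.Ioo (lo y i) (hi y i)]) (lo y i) (hi y i) r c p ∧
        0 < p ∧ p < 1 := by
    intro i
    refine exists_limitProb_critical (lo_lt_hi hinj i) ?_ hr2 hc hrc (h1 _).1 (h1 _).1
      (h2 _ _ fun heq => ?_).1
    · exact fun p q hp hpq hq => hF.fst_Ioo_ne_zero p q ((h1 _).2.1.le.trans hp) hpq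
        (hq.trans (h1 _).2.2.le)
    · have := (Tuple.sort y).injective heq
      simp [Fin.ext_iff] at this
  choose p hp using key
  exact ⟨p, fun i => (hp i).1, fun i => (hp i).2⟩

/-- Both `m + 1` and `m + 2` carry positive mass; `m ≥ 2` provides a Bernoulli variable to
distinguish them. -/
theorem bernoulliSumLaw_singleton_lt_one {m : ℕ} (hm : 2 ≤ m) {p : Fin (m - 1) → unitInterval}
    (hp : ∀ i, 0 < p i ∧ p i < 1) (k : ℕ) : bernoulliSumLaw m p {k} < 1 := by
  classical
  have h1 : ∀ s : Finset (Fin (m - 1)), 0 < bernoulliSumLaw m p {m + 1 + s.card} := by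
    intro s
    rw [bernoulliSumLaw_apply]
    refine lt_of_lt_of_le ?_ (Finset.single_le_sum (f := fun s => ∏ i, patternProb p s i)
      (fun _ _ => zero_le) (a := s) (by simp))
    refine pos_iff_ne_zero.2 (Finset.prod_ne_zero_iff.2 fun i _ => ?_)
    have h0 : (0 : ℝ) < p i := (hp i).1
    have h1 : (p i : ℝ) < 1 := (hp i).2
    unfold patternProb
    split_ifs
    · exact (ENNReal.ofReal_pos.2 h0).ne'
    · exact (ENNReal.ofReal_pos.2 (by linarith)).ne'
  have key : ∀ l, l ≠ k → 0 < bernoulliSumLaw m p {l} → bernoulliSumLaw m p {k} < 1 := by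
    intro l hl hpos
    have hle : bernoulliSumLaw m p {k} + bernoulliSumLaw m p {l} ≤ 1 := by
      rw [← measure_union (by simpa using hl.symm) MeasurableSet.of_discrete]
      exact prob_le_one
    exact lt_of_lt_of_le (ENNReal.lt_add_right (measure_ne_top _ _) hpos.ne') hle
  by_cases hk : m + 1 + (∅ : Finset (Fin (m - 1))).card = k
  · refine key _ ?_ (h1 {⟨0, by omega⟩})
    simp only [Finset.card_empty, Finset.card_singleton] at hk ⊢
    omega
  · exact key _ hk (h1 ∅)

theorem not_tendsto_one (h : IsSample μ F X Y) (hF : MemH F ω₁ ω₂) {m : ℕ} (hm : 2 ≤ m) {r c : ℝ}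
    (hr : 1 ≤ r)
    (hex : ∀ᵐ y ∂(μ.map fun ω (j : Fin m) => Y j ω), ∃ p : Fin (m - 1) → unitInterval,
      AreLimitProbs (F.map Prod.fst) r c y p ∧ ∀ i, 0 < p i ∧ p i < 1) :
    ¬ ∃ k : ℕ, Tendsto (fun n => μ {ω | gam X Y r c n m ω = k}) atTop (𝓝 1) := by
  rintro ⟨k, hk⟩
  have hW : Measurable fun ω (j : Fin m) => Y j ω :=
    measurable_pi_lambda _ fun j => h.measurable_Y j
  have : IsProbabilityMeasure (μ.map fun ω (j : Fin m) => Y j ω) :=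
    Measure.isProbabilityMeasure_map hW.aemeasurable
  have hex' : ∃ p : (Fin m → ℝ) → Fin (m - 1) → unitInterval,
      ∀ᵐ y ∂(μ.map fun ω (j : Fin m) => Y j ω),
        AreLimitProbs (F.map Prod.fst) r c y (p y) ∧ ∀ i, 0 < p y i ∧ p y i < 1 := by
    classical
    refine ⟨fun y => if hy : ∃ p : Fin (m - 1) → unitInterval,
      AreLimitProbs (F.map Prod.fst) r c y p ∧ ∀ i, 0 < p i ∧ p i < 1 then hy.choose
      else fun _ => 0, ?_⟩
    filter_upwards [hex] with y hy
    simp only [hy, dif_pos]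
    exact hy.choose_spec
  obtain ⟨p, hp⟩ := hex'
  have hp1 := hp.mono fun y hy => hy.1
  have hlim := (h.convergesToBernoulliSum hF (by omega) hr hp1).2 {k}
  have hone := tendsto_nhds_unique hlim hk
  -- `p` was chosen pointwise, so measurability is obtained from the convergence of the conditional
  -- probabilities.
  have hmeas : AEMeasurable (fun y => bernoulliSumLaw m (p y) {k})
      (μ.map fun ω (j : Fin m) => Y j ω) := by
    refine aemeasurable_of_tendsto_metrizable_ae' (f := fun n y =>
      condDistrib (fun ω => gam X Y r c n m ω) (fun ω (j : Fin m) => Y j ω) μ y {k})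
      (fun n => (Kernel.measurable_coe _ MeasurableSet.of_discrete).aemeasurable) ?_
    filter_upwards [h.tendsto_condDistrib hF (by omega) hr hp1] with y hy using hy {k}
  have hlt : ∫⁻ y, bernoulliSumLaw m (p y) {k} ∂(μ.map fun ω (j : Fin m) => Y j ω) <
      ∫⁻ _, 1 ∂(μ.map fun ω (j : Fin m) => Y j ω) := by
    refine lintegral_strict_mono (IsProbabilityMeasure.ne_zero _) aemeasurable_const ?_ ?_
    · rw [hone]; exact ENNReal.one_ne_top
    · filter_upwards [hp] with y hy using bernoulliSumLaw_singleton_lt_one hm hy.2 k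
  rw [hone] at hlt
  simp at hlt

end IsSample

end PICD

end

/-! ### Assembly of the theorem -/

open PICD
theorem mainTheorem4 {Ω : Type*} [MeasurableSpace Ω] (μ : Measure Ω) [IsProbabilityMeasure μ]
    (F : Measure (ℝ × ℝ)) (ω₁ ω₂ : ℝ) (hF : MemH F ω₁ ω₂)
    (X Y : ℕ → Ω → ℝ) (hX : ∀ i, Measurable (X i)) (hY : ∀ i, Measurable (Y i))
    (hindep : iIndepFun (fun i ω => (X i ω, Y i ω)) μ)
    (hlaw : ∀ i, μ.map (fun ω => (X i ω, Y i ω)) = F) :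
    -- (i)
    (∀ (n : ℕ) (r c : ℝ), 1 ≤ r → c ∈ Set.Icc (0 : ℝ) 1 →
      ∀ᵐ ω ∂μ, Tendsto (fun m => gam X Y r c n m ω) atTop (𝓝 n)) ∧
    ∀ m : ℕ, 1 ≤ m →
      -- (ii)
      ((∀ c ∈ Set.Ioo (0 : ℝ) 1,
          Tendsto (fun n => μ {ω | gam X Y 1 c n m ω = 2 * m}) atTop (𝓝 1)) ∧
        Tendsto (fun n => μ {ω | gam X Y 1 0 n m ω = m + 1}) atTop (𝓝 1) ∧
        Tendsto (fun n => μ {ω | gam X Y 1 1 n m ω = m + 1}) atTop (𝓝 1)) ∧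
      -- (iii)
      (∀ r c : ℝ, 2 < r → c ∈ Set.Ioo (0 : ℝ) 1 →
        Tendsto (fun n => μ {ω | gam X Y r c n m ω = m + 1}) atTop (𝓝 1)) ∧
      -- (iv)
      ((∀ c ∈ Set.Icc (0 : ℝ) 1, c ≠ 1 / 2 →
          Tendsto (fun n => μ {ω | gam X Y 2 c n m ω = m + 1}) atTop (𝓝 1)) ∧
        ∀ p : (Fin m → ℝ) → Fin (m - 1) → unitInterval,
          (∀ᵐ y ∂(μ.map fun ω (j : Fin m) => Y j ω),
            AreLimitProbs (F.map Prod.fst) 2 (1 / 2) y (p y)) →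
          ConvergesToBernoulliSum μ X Y 2 (1 / 2) m p) ∧
      -- (v)
      (∀ r c : ℝ, 1 ≤ r → r < 2 → c ∈ Set.Icc (0 : ℝ) 1 →
        (rStar c < r →
          Tendsto (fun n => μ {ω | gam X Y r c n m ω = m + 1}) atTop (𝓝 1)) ∧
        (r = rStar c → ∀ p : (Fin m → ℝ) → Fin (m - 1) → unitInterval,
          (∀ᵐ y ∂(μ.map fun ω (j : Fin m) => Y j ω),
            AreLimitProbs (F.map Prod.fst) r c y (p y)) →
          ConvergesToBernoulliSum μ X Y r c m p) ∧
        (r < rStar c →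
          Tendsto (fun n => μ {ω | gam X Y r c n m ω = 2 * m}) atTop (𝓝 1)) ∧
        -- existence and non-degeneracy of the limit law in the critical case
        (r = rStar c → c ∈ Set.Ioo (0 : ℝ) 1 → 2 ≤ m →
          F.map Prod.fst ≪ volume → F.map Prod.snd ≪ volume →
          volume.restrict (Set.Ioo ω₁ ω₂) ≪ F.map Prod.fst →
          (∀ᵐ y ∂(μ.map fun ω (j : Fin m) => Y j ω),
            ∃ p : Fin (m - 1) → unitInterval,
              AreLimitProbs (F.map Prod.fst) r c y p ∧ ∀ i, 0 < p i ∧ p i < 1) ∧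
          ¬ ∃ k : ℕ, Tendsto (fun n => μ {ω | gam X Y r c n m ω = k}) atTop (𝓝 1))) := by
  have hs : IsSample μ F X Y := ⟨hX, hY, hindep, hlaw⟩
  refine ⟨fun n r c _ _ => hs.ae_tendsto_card hF n r c, fun m hm => ?_⟩
  have hgt : ∀ r c : ℝ, 1 ≤ r → c ∈ Set.Icc (0 : ℝ) 1 → rStar c < r →
      Tendsto (fun n => μ {ω | gam X Y r c n m ω = m + 1}) atTop (𝓝 1) := fun r c hr hc hrc =>
    hs.tendsto_one ((hs.ae_genericSeq hF m).mono fun ω hω =>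
      hω.eventually_eq_succ_of_rStar_lt hm hr hc hrc)
  have hlt : ∀ r c : ℝ, 1 ≤ r → c ∈ Set.Icc (0 : ℝ) 1 → r < rStar c →
      Tendsto (fun n => μ {ω | gam X Y r c n m ω = 2 * m}) atTop (𝓝 1) := fun r c hr hc hrc =>
    hs.tendsto_one ((hs.ae_genericSeq hF m).mono fun ω hω =>
      hω.eventually_eq_two_mul_of_lt_rStar hm hr hc hrc)
  have hend : ∀ c : ℝ, c = 0 ∨ c = 1 →
      Tendsto (fun n => μ {ω | gam X Y 1 c n m ω = m + 1}) atTop (𝓝 1) := fun c hc =>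
    hs.tendsto_one ((hs.ae_genericSeq hF m).mono fun ω hω =>
      hω.eventually_eq_succ_of_endpoint hm le_rfl hc)
  refine ⟨⟨fun c hc => hlt 1 c le_rfl ⟨hc.1.le, hc.2.le⟩ ?_, hend 0 (Or.inl rfl),
    hend 1 (Or.inr rfl)⟩, fun r c hr hc => hgt r c (by linarith) ⟨hc.1.le, hc.2.le⟩ ?_,
    ⟨fun c hc hne => hgt 2 c one_le_two hc ?_,
      fun p hp => hs.convergesToBernoulliSum hF hm one_le_two hp⟩,
    fun r c hr hr2 hc => ⟨hgt r c hr hc, fun _ p hp => hs.convergesToBernoulliSum hF hm hr hp,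
      hlt r c hr hc, fun hrc hc' hm2 hXac hYac hac => ?_⟩⟩
  · rw [lt_rStar_iff le_rfl]
    constructor <;> linarith [hc.1, hc.2]
  · rw [rStar_lt_iff (by linarith)]
    -- One of `c` and `1 - c` is at least `1 / 2`, and `r > 2` makes its product with `r` exceed 1.
    rcases le_total c (1 / 2) with h | h
    · right; nlinarith
    · left; nlinarith
  · rw [rStar_lt_iff one_le_two]
    rcases lt_or_gt_of_ne hne with h | h
    · right; linarith
    · left; linarith
  · have hex := hs.ae_exists_limitProbs hF m hr2 hc' hrc hXac hYac hac
    exact ⟨hex, hs.not_tendsto_one hF hm2 hr hex⟩
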